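/- Let $P,Q\ge 2$, let $j_1,\dots,j_P,\tilde j_1,\dots,\tilde j_Q\in\frac12\mathbb N$ be spins (with $0$ allowed), and let $\hat n_1,\dots,\hat n_P,\hat{\tilde n}_1,\dots,\hat{\tilde n}_Q$ be unit vectors in $\mathbb R^3$. Let $V^j$ be the spin-$j$ representation of $SU(2)$ with its orthonormal basis $|j,m\rangle$, $\bar V^j$ its dual, and $|j,\hat n\rangle=g(\hat n)|j,j\rangle$, where $\hat n\mapsto g(\hat n)\in SU(2)$ is any fixed choice with $g(\hat n)\hat z=\hat n$. With $dg$ the normalized Haar measure, put $$|\mathcal I\rangle=\int_{SU(2)}dg\,\bigotimes_{I=1}^{P}g|j_I,\hat n_I\rangle\otimes\bigotimes_{J=1}^{Q}\langle\tilde j_J,\hat{\tilde n}_J|g^{-1}\ \in\ \mathcal H_A\otimes\mathcal H_B,\qquad \mathcal H_A=\bigotimes_I V^{j_I},\quad \mathcal H_B=\bigotimes_J\bar V^{\tilde j_J}.$$ **Recoupling vectors.** Let $C$ denote the Clebsch–Gordan coefficients. A recoupling path $j_\iota=(j_{\iota_1},\dots,j_{\iota_p})$, $p=P-2$, of central spin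 $j$ couples $j_P,j_{P-1}$ to $j_{\iota_p}$, then $j_{\iota_p},j_{p}$ to $j_{\iota_{p-1}}$, and so on, and finally $j_{\iota_1},j_1$ to $j$ (for $p=0$ it couples $j_2,j_1$ to $j$); every step satisfies the triangle condition. Let $|j_\iota;j,k\rangle\in\mathcal H_A$ be the resulting vector, $$|j_\iota;j,k\rangle=\sum_{k_{\iota_1},\dots,k_{\iota_p}}|j_P,j_{P-1};j_{\iota_p},k_{\iota_p}\rangle\otimes|j_{\iota_p},k_{\iota_p};j_p;j_{\iota_{p-1}},k_{\iota_{p-1}}\rangle\otimes\dots\otimes|j_{\iota_1},k_{\iota_1};j_1;j,k\rangle ,$$ with $|j',j'';j,k\rangle=\sum_{m',m''}C^{j'j''j}_{m'm''k}|j',m'\rangle\otimes|j'',m''\rangle$ and $|j',k';j'';j,k\rangle=\sum_{m''}C^{j'j''j}_{k'm''k}|j'',m''\rangle$. Define $\langle\tilde j_\iota;j,k|\in\mathcal H_B$ in the same way from the $Q$ out-going legs. All sums over $j_\iota$, $\tilde j_\iota$ below run over recoupling paths of central spin $j$. **Coefficients.** Put $$c^{j_P,j_{P-1},l}_{\hat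 n_P,\hat n_{P-1},m}=\sum_{k}\langle j_P,j_{P-1};l,k|\int dg\;g|j_P,\hat n_P\rangle\otimes g|j_{P-1},\hat n_{P-1}\rangle\,\langle l,m|g^{-1}|l,k\rangle,$$ $$c^{l',j_i,l}_{m',\hat n_i,m}=\sum_{k',k}\langle l',k';j_i;l,k|\int dg\;g|j_i,\hat n_i\rangle\,\langle l',k'|g|l',m'\rangle\,\langle l,m|g^{-1}|l,k\rangle,$$ and define the coefficients of the out-going legs in the same way, with all kets replaced by the corresponding bras. Let $c_{j,j_\iota,\tilde j_\iota}$ be the sum, over the central magnetic number $m$ and over all magnetic numbers $m_{\iota_i}$ and $\tilde m_{\iota_i}$, of the product of these coefficients over all vertices of the two recoupling trees, the two trees sharing $m$. **Claims.** 1. The vectors $(2j+1)^{-1/2}\sum_k|j_\iota;j,k\rangle\otimes\langle\tilde j_\iota;j,k|$, over all $j,j_\iota,\tilde j_\iota$, form an orthonormal basis of the space of $SU(2)$-invariant vectors of $\mathcal H_A\otimes\mathcal H_B$. The vector $|\mathcal I\rangle$ is invariant, and $$|\mathcal I\rangle=\sum_j(2j+1)\sum_{k,m=-j}^{j}|\mathcal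 I_P;j,m,k\rangle\otimes\langle\mathcal I_Q;j,m,k|=\sum_{j,j_\iota,\tilde j_\iota}(2j+1)^{-1}c_{j,j_\iota,\tilde j_\iota}\sum_{k=-j}^{j}|j_\iota;j,k\rangle\otimes\langle\tilde j_\iota;j,k| ,$$ $$\langle\mathcal I|\mathcal I\rangle=\sum_{j,j_\iota,\tilde j_\iota}(2j+1)^{-1}|c_{j,j_\iota,\tilde j_\iota}|^2,$$ where $|\mathcal I_P;j,m,k\rangle=\int dg\,\bigl(\bigotimes_I g|j_I,\hat n_I\rangle\bigr)\langle j,m|g^{-1}|j,k\rangle$ and $\langle\mathcal I_Q;j,m,k|=\int dh\,\langle j,k|h|j,m\rangle\bigotimes_J\langle\tilde j_J,\hat{\tilde n}_J|h^{-1}$. 2. Suppose $\mathcal I\neq0$. Let $\rho_A=\mathrm{Tr}_B\,|\mathcal I\rangle\langle\mathcal I|/\langle\mathcal I|\mathcal I\rangle$ and $E(A|B)=-\mathrm{Tr}(\rho_A\ln\rho_A)$. For each $j$ let $p_j$ be the matrix, indexed by pairs of paths of the in-going legs, $$p_{j,j_\iota,j'_\iota}=\frac{(2j+1)^{-1}\sum_{\tilde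 j_\iota}c_{j,j_\iota,\tilde j_\iota}\,\overline{c_{j,j'_\iota,\tilde j_\iota}}}{\langle\mathcal I|\mathcal I\rangle},$$ and put $\tilde p_j=\mathrm{Tr}\,p_j$, $\bar p_j=p_j/\tilde p_j$, $E_{\bar p_j}(A|B)=-\mathrm{Tr}(\bar p_j\ln\bar p_j)$ and $E_p(A|B)=-\sum_j\mathrm{Tr}(p_j\ln p_j)$, with $0\ln0=0$ and with $\bar p_j=0$ if $\tilde p_j=0$. Then $$\rho_A=\sum_j\sum_{j_\iota,j'_\iota}p_{j,j_\iota,j'_\iota}\,(2j+1)^{-1}\sum_k|j_\iota;j,k\rangle\langle j'_\iota;j,k| ,$$ every $p_j$ is positive semidefinite, $\tilde p_j\ge0$, $\sum_j\tilde p_j=1$, and $$E(A|B)=E_p(A|B)+\sum_j\tilde p_j\ln(2j+1),\qquad E_p(A|B)=-\sum_j\tilde p_j\ln\tilde p_j+\sum_j\tilde p_jE_{\bar p_j}(A|B).$$ If moreover every $p_j$ is diagonal, then $\tilde p_j=\sum_{j_\iota,j'_\iota}p_{j,j_\iota,j'_\iota}$, $E_{\bar p_j}(A|B)=-\sum_{j_\iota,j'_\iota}\bar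 p_{j,j_\iota,j'_\iota}\ln\bar p_{j,j_\iota,j'_\iota}$ and $E_p(A|B)=-\sum_{j,j_\iota,j'_\iota}p_{j,j_\iota,j'_\iota}\ln p_{j,j_\iota,j'_\iota}$. 3. If $P=Q=2$ and $\mathcal I\ne0$, then $$\tilde p_j=p_j:=\frac{\bigl|\sum_mC^{j_1j_2j}_{\hat n_1\hat n_2m}\,\overline{C^{\tilde j_1\tilde j_2j}_{\hat{\tilde n}_1\hat{\tilde n}_2m}}\bigr|^2}{(2j+1)\langle\mathcal I|\mathcal I\rangle},\qquad C^{j_1j_2j}_{\hat n_1\hat n_2m}=\sum_{m_1,m_2}\langle j_1,m_1|j_1,\hat n_1\rangle\langle j_2,m_2|j_2,\hat n_2\rangle\,\overline{C^{j_1j_2j}_{m_1m_2m}},$$ and $E(A|B)=-\sum_jp_j\ln p_j+\sum_jp_j\ln(2j+1)$. -/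

import Mathlib

open MeasureTheory Matrix
open scoped ComplexOrder

noncomputable section

namespace Intertwiner

/-! ## The group `SU(2)` and its normalized Haar measure -/

/-- The group `SU(2)`. -/
abbrev SU2 : Type := Matrix.specialUnitaryGroup (Fin 2) ℂ

instance instMeasurableSpaceSU2 : MeasurableSpace SU2 := borel SU2

instance instBorelSpaceSU2 : BorelSpace SU2 := ⟨rfl⟩

instance instIsTopologicalGroupSU2 : IsTopologicalGroup SU2 where
  continuous_inv := by
    refine Continuous.subtype_mk ?_ _
    exact continuous_star.comp continuous_subtype_val

instance instCompactSpaceSU2 : CompactSpace SU2 := by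
  have hc : IsClosed ((Matrix.specialUnitaryGroup (Fin 2) ℂ : Set (Matrix (Fin 2) (Fin 2) ℂ))) := by
    have h : (Matrix.specialUnitaryGroup (Fin 2) ℂ : Set (Matrix (Fin 2) (Fin 2) ℂ))
        = {A | A * star A = 1} ∩ {A | A.det = 1} := by
      ext A
      simp [Matrix.mem_specialUnitaryGroup_iff, Matrix.mem_unitaryGroup_iff]
    rw [h]
    refine IsClosed.inter (isClosed_eq ?_ continuous_const) (isClosed_eq ?_ continuous_const)
    · exact continuous_id.mul continuous_star
    · exact Continuous.matrix_det continuous_id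
  have hk : IsCompact (Set.univ.pi fun _ : Fin 2 => Set.univ.pi fun _ : Fin 2 =>
      Metric.closedBall (0 : ℂ) 1) :=
    isCompact_univ_pi fun _ => isCompact_univ_pi fun _ => isCompact_closedBall _ _
  refine isCompact_iff_compactSpace.mp (hk.of_isClosed_subset hc ?_)
  intro A hA i _ j _
  rw [mem_closedBall_zero_iff]
  exact entry_norm_bound_of_unitary (Matrix.specialUnitaryGroup_le_unitaryGroup hA) i j

/-- The Haar measure of `SU(2)` of total mass `1`. -/
def haarSU2 : Measure SU2 := Measure.haarMeasure ⊤

/-! ## The spin representations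

The spin `j ∈ {0, 1/2, 1, …}` is encoded by the natural number `d = 2 j`, so that the
representation space `V^j` has dimension `d + 1 = 2 j + 1`. The basis vector `|j, m⟩` is encoded by
the index `k = j + m ∈ {0, …, d}`; the highest weight vector `|j, j⟩` has index `d`. -/

/-- The matrix elements `⟨j, k| g |j, l⟩`. Here `V^j` is the space of binary forms of degree `d` in
`x`, `y`, with `|k⟩ = x ^ k * y ^ (d - k) / √(k! (d - k)!)`, on which `g` acts by the substitution
`x ↦ g₀₀ x + g₁₀ y`, `y ↦ g₀₁ x + g₁₁ y`; the forms are written with `y = 1`. -/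
def wignerD (d : ℕ) (g : SU2) : Matrix (Fin (d + 1)) (Fin (d + 1)) ℂ := fun k l =>
  (Real.sqrt (((k : ℕ).factorial * (d - k : ℕ).factorial : ℝ) /
      ((l : ℕ).factorial * (d - l : ℕ).factorial)) : ℂ) *
    ((Polynomial.C (g.1 0 0) * Polynomial.X + Polynomial.C (g.1 1 0)) ^ (l : ℕ) *
      (Polynomial.C (g.1 0 1) * Polynomial.X + Polynomial.C (g.1 1 1)) ^ (d - l : ℕ)).coeff k

/-- The triangle condition `|j₁ - j₂| ≤ j ≤ j₁ + j₂`, `j₁ + j₂ + j ∈ ℤ`, for `a = 2 j₁`,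
`b = 2 j₂`, `c = 2 j`. -/
def Triangle (a b c : ℕ) : Prop :=
  c ≤ a + b ∧ a ≤ b + c ∧ b ≤ a + c ∧ Even (a + b + c)

instance (a b c : ℕ) : Decidable (Triangle a b c) := by unfold Triangle; infer_instance

/-- The Clebsch-Gordan coefficient `C^{j₁ j₂ j}_{m₁ m₂ m} = ⟨j₁, m₁, j₂, m₂ | j, m⟩` in the
Condon-Shortley phase convention (so it is real), by the Racah - van der Waerden formula, for
`a = 2 j₁`, `b = 2 j₂`, `c = 2 j`, `k = j₁ + m₁`, `l = j₂ + m₂`, `n = j + m`. With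
`A = j₁ + j₂ - j` the condition `n + A = k + l` says `m = m₁ + m₂`. -/
def clebschGordan (a b c k l n : ℕ) : ℝ :=
  let A := (a + b - c) / 2
  if Triangle a b c ∧ k ≤ a ∧ l ≤ b ∧ n ≤ c ∧ n + A = k + l then
    Real.sqrt (((c + 1) * k.factorial * (a - k).factorial * l.factorial * (b - l).factorial *
        n.factorial * (c - n).factorial : ℝ) /
      (A.factorial * (a - A).factorial * (b - A).factorial * (a + b - A + 1).factorial)) *
    ∑ t ∈ (Finset.range (A + 1)).filter (fun t => t ≤ l ∧ A ≤ k + t),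
      (-1 : ℝ) ^ t * A.choose t * (a - A).choose (k + t - A) * (b - A).choose (l - t)
  else 0

/-! ## Coherent states -/

/-- The unit sphere of `ℝ³`. -/
abbrev Sphere : Type := Metric.sphere (0 : EuclideanSpace ℝ (Fin 3)) 1

/-- The matrix `v₁ σ₁ + v₂ σ₂ + v₃ σ₃`. -/
def pauli (v : EuclideanSpace ℝ (Fin 3)) : Matrix (Fin 2) (Fin 2) ℂ :=
  !![(v 2 : ℂ), (v 0 : ℂ) - Complex.I * (v 1 : ℂ);
     (v 0 : ℂ) + Complex.I * (v 1 : ℂ), -(v 2 : ℂ)]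

/-- `v = g u` for the action of `SU(2)` on `ℝ³` by rotations. -/
def Rotates (g : SU2) (u v : EuclideanSpace ℝ (Fin 3)) : Prop :=
  g.1 * pauli u * g.1ᴴ = pauli v

/-- A choice, for every unit vector `n`, of `γ n ∈ SU(2)` with `n = (γ n) ẑ`, `ẑ = (0, 0, 1)`. -/
def IsSection (γ : Sphere → SU2) : Prop :=
  ∀ n : Sphere, Rotates (γ n) !₂[0, 0, 1] n

/-- The coherent state `|j, n⟩ = g(n) |j, j⟩`. -/
def coherent (γ : Sphere → SU2) (d : ℕ) (n : Sphere) : Fin (d + 1) → ℂ :=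
  wignerD d (γ n) *ᵥ Pi.single (Fin.last d) 1

/-- The components on the basis `|j, k⟩` of the ket `g |ψ⟩`. -/
def ketAct {d : ℕ} (g : SU2) (ψ : Fin (d + 1) → ℂ) : Fin (d + 1) → ℂ :=
  wignerD d g *ᵥ ψ

/-- The components on the dual basis `⟨j, k|` of the bra `⟨ψ| g⁻¹`. -/
def braAct {d : ℕ} (g : SU2) (ψ : Fin (d + 1) → ℂ) : Fin (d + 1) → ℂ :=
  star ψ ᵥ* wignerD d g⁻¹

/-! ## The vertex space `⨂ V^{j_I} ⊗ ⨂ dual (V^{j̃_J})`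

A vector is given by its components on the orthonormal basis
`⨂_I |j_I, m_I⟩ ⊗ ⨂_J ⟨j̃_J, m̃_J|`. -/

/-- The tuples of magnetic indices of legs of spins `a`. -/
abbrev Mag {N : ℕ} (a : Fin N → ℕ) : Type := (I : Fin N) → Fin (a I + 1)

/-- `H_A ⊗ H_B` with `H_A = ⨂ V^{j_I}` and `H_B = ⨂ dual (V^{j̃_J})`. -/
abbrev VertexSpace {M N : ℕ} (a : Fin M → ℕ) (b : Fin N → ℕ) : Type :=
  EuclideanSpace ℂ (Mag a × Mag b)

/-- The action of `g ∈ SU(2)` on the vertex space: `g` on every ket, `· g⁻¹` on every bra. -/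
def vertexAct {M N : ℕ} {a : Fin M → ℕ} {b : Fin N → ℕ} (g : SU2) (v : VertexSpace a b) :
    VertexSpace a b :=
  WithLp.toLp 2 fun x => ∑ y : Mag a × Mag b,
    (∏ I, wignerD (a I) g (x.1 I) (y.1 I)) * (∏ J, wignerD (b J) g⁻¹ (y.2 J) (x.2 J)) * v y

/-- Gauge invariant intertwiners. -/
def IsIntertwiner {M N : ℕ} {a : Fin M → ℕ} {b : Fin N → ℕ} (v : VertexSpace a b) : Prop :=
  ∀ g : SU2, vertexAct g v = v

/-- The coherent intertwiner
`∫ dg ⨂_I g |j_I, n_I⟩ ⨂_J ⟨j̃_J, ñ_J| g⁻¹`. -/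
def coherentIntertwiner (γ : Sphere → SU2) {M N : ℕ} (a : Fin M → ℕ) (b : Fin N → ℕ)
    (n : Fin M → Sphere) (n' : Fin N → Sphere) : VertexSpace a b :=
  WithLp.toLp 2 fun x => ∫ g : SU2,
    (∏ I, ketAct g (coherent γ (a I) (n I)) (x.1 I)) *
      (∏ J, braAct g (coherent γ (b J) (n' J)) (x.2 J)) ∂haarSU2

/-! ## States and entropy -/

/-- The density matrix `|ψ⟩⟨ψ| / ⟨ψ|ψ⟩`. -/
def density {X : Type*} [Fintype X] (ψ : EuclideanSpace ℂ X) : Matrix X X ℂ := fun x y =>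
  ψ x * star (ψ y) / ((‖ψ‖ ^ 2 : ℝ) : ℂ)

/-- The partial trace over the second factor. -/
def partialTrace {X Y : Type*} [Fintype Y] (ρ : Matrix (X × Y) (X × Y) ℂ) : Matrix X X ℂ :=
  fun x x' => ∑ y, ρ (x, y) (x', y)

/-- `-Tr (ρ ln ρ)` for a positive semidefinite matrix `ρ`. -/
def entropy {X : Type*} [Fintype X] [DecidableEq X] (ρ : Matrix X X ℂ) : ℝ :=
  -(ρ * cfc Real.log ρ).trace.re

/-- The reduced density matrix `ρ_A = Tr_B (|I⟩⟨I| / ⟨I|I⟩)`. -/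
def reducedDensity {M N : ℕ} {a : Fin M → ℕ} {b : Fin N → ℕ} (v : VertexSpace a b) :
    Matrix (Mag a) (Mag a) ℂ :=
  partialTrace (density v)

/-- The entanglement entropy `E(A|B) = -Tr (ρ_A ln ρ_A)`. -/
def entanglement {M N : ℕ} {a : Fin M → ℕ} {b : Fin N → ℕ} (v : VertexSpace a b) : ℝ :=
  entropy (reducedDensity v)

/-! ## The recoupling scheme

For `P = p + 2` legs, the spin `j_{i+1}` is `a i`, `i = 0, …, p + 1`. The legs `j_P` and `j_{P-1}`
are coupled to `j_{ι_p}`, then `j_{ι_p}` and `j_p` to `j_{ι_{p-1}}`, and so on, and at last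
`j_{ι_1}` and `j_1` to the central spin `j`. The recoupling spins are collected in
`s = (j, j_{ι_1}, …, j_{ι_p}, j_P)`: the vertex number `i ∈ {0, …, p}` couples `s (i + 1)` and
`a i` to `s i`. -/

/-- The admissible sequences `(j, j_{ι_1}, …, j_{ι_p}, j_P)` with central spin `j`. (The bound by the
sum of all spins follows from the triangle conditions.) -/
def paths {p : ℕ} (a : Fin (p + 2) → ℕ) (j : ℕ) : Finset (Fin (p + 2) → ℕ) :=
  (Fintype.piFinset fun _ => Finset.range (∑ I, a I + 1)).filter fun s =>
    s 0 = j ∧ s (Fin.last (p + 1)) = a (Fin.last (p + 1)) ∧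
      ∀ i : Fin (p + 1), Triangle (s i.succ) (a i.castSucc) (s i.castSucc)

/-- The component at `|j_1, m_1⟩ ⊗ … ⊗ |j_P, m_P⟩` of the recoupled vector
`∑_{k_{ι_1}, …, k_{ι_p}} |j_P, j_{P-1}; j_{ι_p}, k_{ι_p}⟩ ⊗ … ⊗ |j_{ι_1}, k_{ι_1}; j_1; j, k⟩`.
The Clebsch-Gordan coefficients being real, it is also the component at
`⟨j_1, m_1| ⊗ … ⊗ ⟨j_P, m_P|` of the corresponding bra. -/
def recoupled {p : ℕ} (a : Fin (p + 2) → ℕ) (s : Fin (p + 2) → ℕ) (k : ℕ) (m : Mag a) : ℂ :=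
  ∑ κ : Mag s,
    if (κ 0 : ℕ) = k ∧ (κ (Fin.last (p + 1)) : ℕ) = m (Fin.last (p + 1)) then
      ∏ i : Fin (p + 1), (clebschGordan (s i.succ) (a i.castSucc) (s i.castSucc)
        (κ i.succ) (m i.castSucc) (κ i.castSucc) : ℂ)
    else 0

/-- The intertwiner `∑_k |s; j, k⟩ ⊗ ⟨s'; j, k|` of the two recoupling trees glued along the central
spin `j`. -/
def recoupledIntertwiner {p q : ℕ} (a : Fin (p + 2) → ℕ) (b : Fin (q + 2) → ℕ) (j : ℕ)
    (s : Fin (p + 2) → ℕ) (s' : Fin (q + 2) → ℕ) : VertexSpace a b :=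
  WithLp.toLp 2 fun x => ∑ k ∈ Finset.range (j + 1), recoupled a s k x.1 * recoupled b s' k x.2

/-- The recoupling basis of the intertwiner space: `(2 j + 1)^{-1/2} ∑_k |s; j, k⟩ ⊗ ⟨s'; j, k|`. -/
def recouplingBasis {p q : ℕ} (a : Fin (p + 2) → ℕ) (b : Fin (q + 2) → ℕ)
    (x : Σ j : ℕ, paths a j × paths b j) : VertexSpace a b :=
  ((Real.sqrt (x.1 + 1 : ℝ))⁻¹ : ℂ) • recoupledIntertwiner a b x.1 x.2.1.1 x.2.2.1

/-! ## The expansion coefficients of the coherent intertwiner -/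

/-- `c^{j_P, j_{P-1}, j_ι}_{n_P, n_{P-1}, μ}`, that is,
`∑_k ⟨j_P, j_{P-1}; j_ι, k| ∫ dg g|ψ⟩ ⊗ g|φ⟩ ⟨j_ι, μ| g⁻¹ |j_ι, k⟩` with `ψ`, `φ` the coherent states
on the legs `j_P`, `j_{P-1}` (of spins `d`, `e`). -/
def endCoeff {d e : ℕ} (ψ : Fin (d + 1) → ℂ) (φ : Fin (e + 1) → ℂ) (c : ℕ) (μ : Fin (c + 1)) : ℂ :=
  ∑ k : Fin (c + 1), ∑ x : Fin (d + 1), ∑ y : Fin (e + 1), (clebschGordan d e c x y k : ℂ) *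
    ∫ g : SU2, ketAct g ψ x * ketAct g φ y * wignerD c g⁻¹ μ k ∂haarSU2

/-- `c^{j_ι', j_i, j_ι}_{ν, n_i, μ}`, that is,
`∑_{k', k} ⟨j_ι', k'; j_i; j_ι, k| ∫ dg g|ψ⟩ ⟨j_ι', k'|g|j_ι', ν⟩ ⟨j_ι, μ| g⁻¹ |j_ι, k⟩`, with `ψ` the
coherent state on the leg `j_i` (of spin `e`), and `d`, `c` the spins `j_ι'`, `j_ι`. -/
def midCoeff {e : ℕ} (ψ : Fin (e + 1) → ℂ) (d c : ℕ) (ν : Fin (d + 1)) (μ : Fin (c + 1)) : ℂ :=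
  ∑ k' : Fin (d + 1), ∑ k : Fin (c + 1), ∑ y : Fin (e + 1), (clebschGordan d e c k' y k : ℂ) *
    ∫ g : SU2, ketAct g ψ y * wignerD d g k' ν * wignerD c g⁻¹ μ k ∂haarSU2

/-- The bra counterpart of `endCoeff`: `∑_k` of the pairing of
`∫ dg ⟨j_ι, k|g|j_ι, μ⟩ ⟨ψ|g⁻¹ ⊗ ⟨φ|g⁻¹` with `|j̃_Q, j̃_{Q-1}; j_ι, k⟩`. -/
def endCoeffBra {d e : ℕ} (ψ : Fin (d + 1) → ℂ) (φ : Fin (e + 1) → ℂ) (c : ℕ)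
    (μ : Fin (c + 1)) : ℂ :=
  ∑ k : Fin (c + 1), ∑ x : Fin (d + 1), ∑ y : Fin (e + 1), (clebschGordan d e c x y k : ℂ) *
    ∫ g : SU2, wignerD c g k μ * braAct g ψ x * braAct g φ y ∂haarSU2

/-- The bra counterpart of `midCoeff`: `∑_{k', k}` of the pairing of
`∫ dg ⟨j_ι, k|g|j_ι, μ⟩ ⟨j_ι', ν|g⁻¹|j_ι', k'⟩ ⟨ψ|g⁻¹` with `|j_ι', k'; j̃_i; j_ι, k⟩`. -/
def midCoeffBra {e : ℕ} (ψ : Fin (e + 1) → ℂ) (d c : ℕ) (ν : Fin (d + 1)) (μ : Fin (c + 1)) : ℂ :=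
  ∑ k' : Fin (d + 1), ∑ k : Fin (c + 1), ∑ y : Fin (e + 1), (clebschGordan d e c k' y k : ℂ) *
    ∫ g : SU2, wignerD c g k μ * wignerD d g⁻¹ ν k' * braAct g ψ y ∂haarSU2

/-- The sum over `m_{ι_1}, …, m_{ι_p}` of the product of the coefficients of all vertices of the ket
tree, with the central magnetic number `m` fixed. -/
def chainCoeff (γ : Sphere → SU2) {p : ℕ} (a : Fin (p + 2) → ℕ) (n : Fin (p + 2) → Sphere)
    (s : Fin (p + 2) → ℕ) (m : ℕ) : ℂ :=
  ∑ μ : (i : Fin (p + 1)) → Fin (s i.castSucc + 1),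
    if (μ 0 : ℕ) = m then
      endCoeff (coherent γ (a (Fin.last (p + 1))) (n (Fin.last (p + 1))))
          (coherent γ (a (Fin.last p).castSucc) (n (Fin.last p).castSucc))
          (s (Fin.last p).castSucc) (μ (Fin.last p)) *
        ∏ i : Fin p, midCoeff (coherent γ (a i.castSucc.castSucc) (n i.castSucc.castSucc))
          (s i.succ.castSucc) (s i.castSucc.castSucc) (μ i.succ) (μ i.castSucc)
    else 0

/-- The bra counterpart of `chainCoeff`. -/
def chainCoeffBra (γ : Sphere → SU2) {q : ℕ} (b : Fin (q + 2) → ℕ) (n : Fin (q + 2) → Sphere)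
    (s : Fin (q + 2) → ℕ) (m : ℕ) : ℂ :=
  ∑ μ : (i : Fin (q + 1)) → Fin (s i.castSucc + 1),
    if (μ 0 : ℕ) = m then
      endCoeffBra (coherent γ (b (Fin.last (q + 1))) (n (Fin.last (q + 1))))
          (coherent γ (b (Fin.last q).castSucc) (n (Fin.last q).castSucc))
          (s (Fin.last q).castSucc) (μ (Fin.last q)) *
        ∏ i : Fin q, midCoeffBra (coherent γ (b i.castSucc.castSucc) (n i.castSucc.castSucc))
          (s i.succ.castSucc) (s i.castSucc.castSucc) (μ i.succ) (μ i.castSucc)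
    else 0

/-- The coefficient `c_{j, j_ι, j̃_ι}`. -/
def coeff (γ : Sphere → SU2) {p q : ℕ} (a : Fin (p + 2) → ℕ) (b : Fin (q + 2) → ℕ)
    (n : Fin (p + 2) → Sphere) (n' : Fin (q + 2) → Sphere) (j : ℕ)
    (s : Fin (p + 2) → ℕ) (s' : Fin (q + 2) → ℕ) : ℂ :=
  ∑ m ∈ Finset.range (j + 1), chainCoeff γ a n s m * chainCoeffBra γ b n' s' m

/-- The components of `|I_P; j, m, k⟩ = ∫ dg (⨂_I g |j_I, n_I⟩) ⟨j, m| g⁻¹ |j, k⟩`. -/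
def ketPart (γ : Sphere → SU2) {M : ℕ} (a : Fin M → ℕ) (n : Fin M → Sphere) (j : ℕ)
    (m k : Fin (j + 1)) (x : Mag a) : ℂ :=
  ∫ g : SU2, (∏ I, ketAct g (coherent γ (a I) (n I)) (x I)) * wignerD j g⁻¹ m k ∂haarSU2

/-- The components of `⟨I_Q; j, m, k| = ∫ dh ⟨j, k| h |j, m⟩ ⨂_J ⟨j̃_J, ñ_J| h⁻¹`. -/
def braPart (γ : Sphere → SU2) {N : ℕ} (b : Fin N → ℕ) (n : Fin N → Sphere) (j : ℕ)
    (m k : Fin (j + 1)) (y : Mag b) : ℂ :=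
  ∫ h : SU2, wignerD j h k m * ∏ J, braAct h (coherent γ (b J) (n J)) (y J) ∂haarSU2

/-! ## The distribution of the recoupling spins -/

/-- The matrix `p_{j, j_ι, j_ι'} = (2 j + 1)⁻¹ ∑_{j̃_ι} c_{j, j_ι, j̃_ι} c̄_{j, j_ι', j̃_ι} / ⟨I|I⟩`. -/
def pMatrix (γ : Sphere → SU2) {p q : ℕ} (a : Fin (p + 2) → ℕ) (b : Fin (q + 2) → ℕ)
    (n : Fin (p + 2) → Sphere) (n' : Fin (q + 2) → Sphere) (j : ℕ) :
    Matrix (paths a j) (paths a j) ℂ := fun s t =>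
  ((j + 1 : ℂ))⁻¹ * (∑ s' ∈ paths b j, coeff γ a b n n' j s.1 s' * star (coeff γ a b n n' j t.1 s'))
    / ((‖coherentIntertwiner γ a b n n'‖ ^ 2 : ℝ) : ℂ)

/-- The distribution `p̃_j` of the central recoupling spin: the trace of the block `p_j`. -/
def centralProb (γ : Sphere → SU2) {p q : ℕ} (a : Fin (p + 2) → ℕ) (b : Fin (q + 2) → ℕ)
    (n : Fin (p + 2) → Sphere) (n' : Fin (q + 2) → Sphere) (j : ℕ) : ℝ :=
  (pMatrix γ a b n n' j).trace.re

/-- The normalized block `p̄_j = p_j / p̃_j`. -/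
def pBar (γ : Sphere → SU2) {p q : ℕ} (a : Fin (p + 2) → ℕ) (b : Fin (q + 2) → ℕ)
    (n : Fin (p + 2) → Sphere) (n' : Fin (q + 2) → Sphere) (j : ℕ) :
    Matrix (paths a j) (paths a j) ℂ :=
  ((centralProb γ a b n n' j : ℂ))⁻¹ • pMatrix γ a b n n' j

/-- The central spins: all `j` up to the sum of the spins of the in-going legs. (Those which are not
admissible have no recoupling paths and do not contribute.) -/
def centralSpins {p : ℕ} (a : Fin (p + 2) → ℕ) : Finset ℕ := Finset.range (∑ I, a I + 1)

/-- The intertwiner entropy `E_p(A|B) = -∑_j Tr (p_j ln p_j)`. -/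
def intertwinerEntropy (γ : Sphere → SU2) {p q : ℕ} (a : Fin (p + 2) → ℕ) (b : Fin (q + 2) → ℕ)
    (n : Fin (p + 2) → Sphere) (n' : Fin (q + 2) → Sphere) : ℝ :=
  ∑ j ∈ centralSpins a, entropy (pMatrix γ a b n n' j)

/-! ## Four legs -/

/-- `C^{j₁ j₂ j}_{n₁ n₂ m} = ∑_{m₁, m₂} c_{j₁ m₁}(n₁) c_{j₂ m₂}(n₂) C^{j₁ j₂ j}_{m₁ m₂ m}`. -/
def coherentCG (γ : Sphere → SU2) (a : Fin 2 → ℕ) (n : Fin 2 → Sphere) (j m : ℕ) : ℂ :=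
  ∑ x : Fin (a 0 + 1), ∑ y : Fin (a 1 + 1),
    coherent γ (a 0) (n 0) x * coherent γ (a 1) (n 1) y * (clebschGordan (a 0) (a 1) j x y m : ℂ)

/-- The distribution `p_j` of the recoupling spin of the four-leg coherent intertwiner. -/
def fourLegProb (γ : Sphere → SU2) (a b : Fin 2 → ℕ) (n n' : Fin 2 → Sphere) (j : ℕ) : ℝ :=
  ‖∑ m ∈ Finset.range (j + 1), coherentCG γ a n j m * star (coherentCG γ b n' j m)‖ ^ 2 /
    ((j + 1) * ‖coherentIntertwiner γ a b n n'‖ ^ 2)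

end Intertwiner

end

noncomputable section

namespace Intertwiner

/-! ## The spin representations on powers of vectors of `ℂ²` -/

/-! The argument rests on Schur's lemma, the unitarity of the Clebsch-Gordan coefficients, and a
block diagonalization of the reduced density matrix.

The representation space is spanned by the powers `u^{⊗d}` of vectors of `ℂ²`
(`eq_zero_of_sum_spinPower`), on which `g` acts by `u ↦ g u`. Testing on powers gives
multiplicativity and unitarity of `wignerD`. Every power is a multiple of a rotated highest-weight
vector, so an intertwiner is determined by its last column, and weights restrict that column to one
entry: this is Schur's lemma (`schur_of_ne`, `schur_self`). With left invariance of the Haar measure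
it yields `haar_orthogonality`.

The Clebsch-Gordan coefficients have the generating function `(u ∧ w)^A (z·u)^B (z·w)^E`, up to a
constant, where `u ∧ w = u 0 * w 1 - u 1 * w 0`. It is visibly `SU(2)`-covariant, so the
coefficients intertwine. Schur's lemma gives their orthogonality up to a constant, which the
highest-weight vector fixes, and a dimension count gives completeness. Induction on the number of
legs carries orthonormality, completeness and covariance over to the recoupled vectors
(`treeVec_orthonormal`, `treeVec_complete`, `treeVec_covariant`).

Inserting the completeness relation into a product of rotated states leaves a single Wigner matrix
at the root of each tree, so the Haar integral is evaluated by Schur orthogonality. The integrands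
defining the vertex coefficients are, after summation, constant in `g` by covariance; hence `c_{j,
j_ι, j̃_ι}` is the contraction of two tree amplitudes over the central magnetic number (`coeff_eq`).
An arbitrary invariant vector, viewed as a matrix between the two legs' spaces, is cut by the same
completeness relations into blocks that are scalar by Schur.

In the recoupling basis the coherent intertwiner is `⊕_j (2j+1)⁻¹ c_j ⊗ 1`, so `ρ_A = ⊕_j (2j+1)⁻¹
p_j ⊗ 1`. Each eigenvalue `λ` of `p_j` becomes `λ / (2j+1)` with multiplicity `2j+1`, which produces
the term `ln (2j+1)`; the rest is the grouping property of entropy. For four legs each `p_j` has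
size at most one, and the order of coupling matters only by a sign. -/

/-- The components of the `d`-th symmetric power of `u ∈ ℂ²`. -/
def spinPower (d : ℕ) (u : Fin 2 → ℂ) : Fin (d + 1) → ℂ := fun k =>
  (Real.sqrt (d.choose k) : ℂ) * (u 0 ^ (k : ℕ) * u 1 ^ (d - k : ℕ))

theorem sqrt_choose_ne_zero {d : ℕ} (k : Fin (d + 1)) : (Real.sqrt (d.choose k) : ℂ) ≠ 0 := by
  have : 0 < d.choose k := Nat.choose_pos (Nat.lt_succ_iff.mp k.2)
  have h : (0 : ℝ) < Real.sqrt (d.choose k) := Real.sqrt_pos.mpr (by exact_mod_cast this)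
  exact_mod_cast h.ne'

theorem sqrt_choose_sq (d k : ℕ) :
    (Real.sqrt (d.choose k) : ℂ) * (Real.sqrt (d.choose k) : ℂ) = (d.choose k : ℂ) := by
  rw [← Complex.ofReal_mul, Real.mul_self_sqrt (Nat.cast_nonneg _)]
  simp

/-- On the vectors `(x, 1)` the pairing is a polynomial in `x` whose coefficients are nonzero
multiples of the `c k`. Thus powers span the representation space, and matrix identities may be
tested on them. -/
theorem eq_zero_of_sum_spinPower {d : ℕ} (c : Fin (d + 1) → ℂ)
    (h : ∀ u, ∑ k, c k * spinPower d u k = 0) : c = 0 := by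
  have hq : (∑ k : Fin (d + 1), Polynomial.C (c k * (Real.sqrt (d.choose k) : ℂ)) *
      Polynomial.X ^ (k : ℕ)) = (0 : Polynomial ℂ) := by
    refine Polynomial.funext fun x => ?_
    have := h ![x, 1]
    simp only [spinPower] at this
    rw [Polynomial.eval_finsetSum]
    simp only [Polynomial.eval_mul, Polynomial.eval_C, Polynomial.eval_pow, Polynomial.eval_X,
      Polynomial.eval_zero]
    rw [← this]
    refine Finset.sum_congr rfl fun k _ => ?_
    simp [mul_assoc]
  funext k
  have hk := congrArg (fun q : Polynomial ℂ => q.coeff k) hq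
  simp only [Polynomial.finsetSum_coeff, Polynomial.coeff_C_mul, Polynomial.coeff_X_pow,
    Polynomial.coeff_zero] at hk
  rw [Finset.sum_eq_single k] at hk
  · rw [if_pos rfl, mul_one] at hk
    exact (mul_eq_zero.mp hk).resolve_right (sqrt_choose_ne_zero k)
  · intro l _ hl
    have : (k : ℕ) ≠ l := fun h => hl (Fin.ext h.symm)
    simp [this]
  · simp

theorem eq_of_sum_spinPower {d : ℕ} {c c' : Fin (d + 1) → ℂ}
    (h : ∀ u, ∑ k, c k * spinPower d u k = ∑ k, c' k * spinPower d u k) : c = c' := by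
  refine sub_eq_zero.mp (eq_zero_of_sum_spinPower (c - c') fun u => ?_)
  simp [sub_mul, Finset.sum_sub_distrib, h u]

theorem matrix_eq_of_mulVec_spinPower {d : ℕ} {ι : Type*} {M M' : Matrix ι (Fin (d + 1)) ℂ}
    (h : ∀ u, M *ᵥ spinPower d u = M' *ᵥ spinPower d u) : M = M' := by
  funext i
  exact eq_of_sum_spinPower fun u => congrFun (h u) i

theorem coeff_linear_pow (α β : ℂ) {d k : ℕ} (hk : k ≤ d) :
    ((Polynomial.C α * Polynomial.X + Polynomial.C β) ^ d).coeff k =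
      (d.choose k : ℂ) * (α ^ k * β ^ (d - k)) := by
  rw [add_pow, Polynomial.finsetSum_coeff, Finset.sum_eq_single k]
  · rw [mul_pow, ← Polynomial.C_pow, ← Polynomial.C_pow, ← Polynomial.C_eq_natCast,
      Polynomial.coeff_mul_C, Polynomial.coeff_mul_C, Polynomial.coeff_C_mul,
      Polynomial.coeff_X_pow_self]
    ring
  · intro l _ hl
    rw [mul_pow, ← Polynomial.C_pow, ← Polynomial.C_pow, ← Polynomial.C_eq_natCast,
      Polynomial.coeff_mul_C, Polynomial.coeff_mul_C, Polynomial.coeff_C_mul,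
      Polynomial.coeff_X_pow]
    simp [hl.symm]
  · intro h
    exact absurd (Finset.mem_range.mpr (by omega)) h

theorem wignerD_eq (d : ℕ) (g : SU2) (k l : Fin (d + 1)) :
    wignerD d g k l = (Real.sqrt (d.choose l) : ℂ) / (Real.sqrt (d.choose k) : ℂ) *
    ((Polynomial.C (g.1 0 0) * Polynomial.X + Polynomial.C (g.1 1 0)) ^ (l : ℕ) *
      (Polynomial.C (g.1 0 1) * Polynomial.X + Polynomial.C (g.1 1 1)) ^ (d - l : ℕ)).coeff k := by
  unfold wignerD
  rw [← Complex.ofReal_div, ← Real.sqrt_div (Nat.cast_nonneg _)]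
  congr 3
  rw [Nat.cast_choose ℝ (Nat.lt_succ_iff.mp k.2), Nat.cast_choose ℝ (Nat.lt_succ_iff.mp l.2)]
  have h1 := Nat.factorial_ne_zero d
  have h2 := Nat.factorial_ne_zero k
  have h3 := Nat.factorial_ne_zero l
  have h4 := Nat.factorial_ne_zero (d - k)
  have h5 := Nat.factorial_ne_zero (d - l)
  field_simp

/-- The polynomial `((g u)₀ X + (g u)₁) ^ d` is expanded in two ways: directly, and as a binomial in
the two linear forms weighted by `u 0` and `u 1`. The identity compares coefficients of `X ^ k`. -/
theorem wignerD_mulVec_spinPower (d : ℕ) (g : SU2) (u : Fin 2 → ℂ) :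
    wignerD d g *ᵥ spinPower d u = spinPower d (g.1 *ᵥ u) := by
  funext k
  have hk : (k : ℕ) ≤ d := Nat.lt_succ_iff.mp k.2
  have key := coeff_linear_pow (g.1 0 0 * u 0 + g.1 0 1 * u 1) (g.1 1 0 * u 0 + g.1 1 1 * u 1) hk
  have e : (Polynomial.C (g.1 0 0 * u 0 + g.1 0 1 * u 1) * Polynomial.X +
      Polynomial.C (g.1 1 0 * u 0 + g.1 1 1 * u 1) : Polynomial ℂ) =
      Polynomial.C (u 0) * (Polynomial.C (g.1 0 0) * Polynomial.X + Polynomial.C (g.1 1 0)) +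
      Polynomial.C (u 1) * (Polynomial.C (g.1 0 1) * Polynomial.X + Polynomial.C (g.1 1 1)) := by
    simp only [map_add, map_mul]
    ring
  rw [e, add_pow, Polynomial.finsetSum_coeff, Finset.sum_range] at key
  have hs := sqrt_choose_ne_zero k
  have hg : spinPower d (g.1 *ᵥ u) k = (Real.sqrt (d.choose k) : ℂ)⁻¹ * ((d.choose k : ℂ) *
      ((g.1 0 0 * u 0 + g.1 0 1 * u 1) ^ (k : ℕ) * (g.1 1 0 * u 0 + g.1 1 1 * u 1) ^ (d - k : ℕ))) := by
    rw [← sqrt_choose_sq]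
    simp only [spinPower, Matrix.mulVec, dotProduct, Fin.sum_univ_two]
    field_simp
  rw [hg, ← key, Finset.mul_sum]
  simp only [Matrix.mulVec, dotProduct]
  refine Finset.sum_congr rfl fun l _ => ?_
  rw [wignerD_eq, mul_pow, mul_pow, ← Polynomial.C_pow, ← Polynomial.C_pow,
    ← Polynomial.C_eq_natCast, Polynomial.coeff_mul_C, mul_mul_mul_comm, ← Polynomial.C_mul,
    Polynomial.coeff_C_mul, ← sqrt_choose_sq]
  simp only [spinPower]
  ring

/-- This is the binomial theorem. The pairing is bilinear, without conjugation, so it transfers the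
action from kets to row vectors. -/
theorem spinPower_dotProduct (d : ℕ) (z u : Fin 2 → ℂ) :
    spinPower d z ⬝ᵥ spinPower d u = (z ⬝ᵥ u) ^ d := by
  simp only [dotProduct, Fin.sum_univ_two]
  rw [add_pow, Finset.sum_range]
  refine Finset.sum_congr rfl fun k _ => ?_
  simp only [spinPower]
  rw [← sqrt_choose_sq, mul_pow, mul_pow]
  ring

theorem star_spinPower (d : ℕ) (u : Fin 2 → ℂ) : star (spinPower d u) = spinPower d (star u) := by
  funext k
  simp [spinPower, Complex.conj_ofReal]

theorem spinPower_smul (d : ℕ) (r : ℂ) (u : Fin 2 → ℂ) :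
    spinPower d (r • u) = r ^ d • spinPower d u := by
  funext k
  have : r ^ d = r ^ (k : ℕ) * r ^ (d - k : ℕ) := by
    rw [← pow_add, Nat.add_sub_cancel' (Nat.lt_succ_iff.mp k.2)]
  simp only [spinPower, Pi.smul_apply, smul_eq_mul, mul_pow, this]
  ring

theorem spinPower_single (d : ℕ) : spinPower d ![1, 0] = Pi.single (Fin.last d) 1 := by
  funext k
  by_cases h : k = Fin.last d
  · subst h; simp [spinPower]
  · have : d - (k : ℕ) ≠ 0 := by
      have h1 : (k : ℕ) ≠ d := fun h' => h (Fin.ext h')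
      omega
    simp [spinPower, h, this]

/-! ### Homomorphism property and unitarity -/

theorem wignerD_mul (d : ℕ) (g h : SU2) : wignerD d (g * h) = wignerD d g * wignerD d h := by
  refine matrix_eq_of_mulVec_spinPower fun u => ?_
  rw [← Matrix.mulVec_mulVec, wignerD_mulVec_spinPower, wignerD_mulVec_spinPower,
    wignerD_mulVec_spinPower, Matrix.mulVec_mulVec]
  rfl

theorem wignerD_one (d : ℕ) : wignerD d 1 = 1 := by
  refine matrix_eq_of_mulVec_spinPower fun u => ?_
  rw [wignerD_mulVec_spinPower, Matrix.one_mulVec]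
  change spinPower d ((1 : Matrix (Fin 2) (Fin 2) ℂ) *ᵥ u) = _
  rw [Matrix.one_mulVec]

theorem spinPower_vecMul_wignerD (d : ℕ) (g : SU2) (z : Fin 2 → ℂ) :
    spinPower d z ᵥ* wignerD d g = spinPower d (z ᵥ* g.1) := by
  refine eq_of_sum_spinPower fun u => ?_
  change (spinPower d z ᵥ* wignerD d g) ⬝ᵥ spinPower d u = spinPower d (z ᵥ* g.1) ⬝ᵥ spinPower d u
  rw [← Matrix.dotProduct_mulVec, wignerD_mulVec_spinPower, spinPower_dotProduct,
    spinPower_dotProduct, Matrix.dotProduct_mulVec]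

theorem wignerD_inv (d : ℕ) (g : SU2) : wignerD d g⁻¹ = (wignerD d g)ᴴ := by
  refine matrix_eq_of_mulVec_spinPower fun u => ?_
  have h : (wignerD d g)ᴴ *ᵥ spinPower d u = star (star (spinPower d u) ᵥ* wignerD d g) := by
    rw [Matrix.star_vecMul, star_star]
  rw [h, star_spinPower, spinPower_vecMul_wignerD, star_spinPower, Matrix.star_vecMul, star_star,
    wignerD_mulVec_spinPower]
  rfl

theorem wignerD_inv_apply (d : ℕ) (g : SU2) (k l : Fin (d + 1)) :
    wignerD d g⁻¹ k l = star (wignerD d g l k) := by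
  rw [wignerD_inv]; rfl

theorem wignerD_mul_inv (d : ℕ) (g : SU2) : wignerD d g * wignerD d g⁻¹ = 1 := by
  rw [← wignerD_mul, mul_inv_cancel, wignerD_one]

theorem wignerD_inv_mul (d : ℕ) (g : SU2) : wignerD d g⁻¹ * wignerD d g = 1 := by
  rw [← wignerD_mul, inv_mul_cancel, wignerD_one]

/-! ### Continuity of the matrix elements -/

theorem continuous_coeff_mul {X : Type*} [TopologicalSpace X] {P Q : X → Polynomial ℂ}
    (hP : ∀ k, Continuous fun x => (P x).coeff k) (hQ : ∀ k, Continuous fun x => (Q x).coeff k)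
    (k : ℕ) : Continuous fun x => (P x * Q x).coeff k := by
  simp only [Polynomial.coeff_mul]
  exact continuous_finsetSum _ fun i _ => (hP _).mul (hQ _)

theorem continuous_coeff_pow {X : Type*} [TopologicalSpace X] {P : X → Polynomial ℂ}
    (hP : ∀ k, Continuous fun x => (P x).coeff k) (m k : ℕ) :
    Continuous fun x => (P x ^ m).coeff k := by
  induction m generalizing k with
  | zero => simpa using continuous_const
  | succ m ih => simpa only [pow_succ] using continuous_coeff_mul ih hP k

theorem continuous_wignerD (d : ℕ) (k l : Fin (d + 1)) : Continuous fun g => wignerD d g k l := by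
  have hc : ∀ i j, Continuous fun g : SU2 => g.1 i j := fun i j =>
    (continuous_apply_apply i j).comp continuous_subtype_val
  have hlin : ∀ i j, ∀ m, Continuous fun g : SU2 =>
      (Polynomial.C (g.1 0 i) * Polynomial.X + Polynomial.C (g.1 1 j)).coeff m := by
    intro i j m
    simp only [Polynomial.coeff_add, Polynomial.coeff_C_mul, Polynomial.coeff_C]
    refine ((hc _ _).mul continuous_const).add ?_
    split_ifs
    · exact hc _ _
    · exact continuous_const
  unfold wignerD
  exact continuous_const.mul (continuous_coeff_mul (continuous_coeff_pow (hlin _ _) _)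
    (continuous_coeff_pow (hlin _ _) _) _)

/-! ## Schur's lemma -/

/-- The diagonal element `diag(z, z̄)`. -/
def torus (z : ℂ) (hz : z * star z = 1) : SU2 :=
  ⟨!![z, 0; 0, star z], by
    rw [Matrix.mem_specialUnitaryGroup_iff, Matrix.mem_unitaryGroup_iff]
    have hz' : star z * z = 1 := by rw [mul_comm, hz]
    refine ⟨?_, by simpa [Matrix.det_fin_two] using hz⟩
    ext i j
    fin_cases i <;> fin_cases j <;>
      simp_all [Matrix.mul_apply, Fin.sum_univ_two, Matrix.star_apply]⟩

theorem wignerD_torus (d : ℕ) (z : ℂ) (hz : z * star z = 1) :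
    wignerD d (torus z hz) = Matrix.diagonal fun k : Fin (d + 1) => z ^ (k : ℕ) * star z ^ (d - k : ℕ) := by
  refine matrix_eq_of_mulVec_spinPower fun u => ?_
  rw [wignerD_mulVec_spinPower]
  funext k
  simp only [torus, spinPower, Matrix.mulVec_diagonal]
  simp [Matrix.mulVec, dotProduct, Fin.sum_univ_two, mul_pow]
  ring

/-- The normalized vector is taken as first column; unitarity and determinant one dictate the
second. Consequently every power is a multiple of a rotated highest-weight vector. -/
theorem exists_smul_mulVec (u : Fin 2 → ℂ) : ∃ (r : ℂ) (g : SU2), u = r • (g.1 *ᵥ ![1, 0]) := by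
  by_cases hu : u = 0
  · exact ⟨0, 1, by simp [hu]⟩
  set N : ℝ := Complex.normSq (u 0) + Complex.normSq (u 1) with hN
  have hpos : 0 < N := by
    rcases (add_nonneg (Complex.normSq_nonneg (u 0)) (Complex.normSq_nonneg (u 1))).lt_or_eq with
      h | h
    · exact h
    · exfalso
      apply hu
      have h0 := Complex.normSq_nonneg (u 0)
      have h1 := Complex.normSq_nonneg (u 1)
      have e0 : Complex.normSq (u 0) = 0 := by linarith
      have e1 : Complex.normSq (u 1) = 0 := by linarith
      funext i
      fin_cases i
      · exact Complex.normSq_eq_zero.mp e0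
      · exact Complex.normSq_eq_zero.mp e1
  set r : ℂ := (Real.sqrt N : ℂ) with hr
  have hr0 : r ≠ 0 := by
    rw [hr]; exact_mod_cast (Real.sqrt_pos.mpr hpos).ne'
  have hrr : r * r = u 0 * star (u 0) + u 1 * star (u 1) := by
    rw [hr, ← Complex.ofReal_mul, Real.mul_self_sqrt hpos.le, hN]
    simp [Complex.mul_conj]
  have hstar : star r = r := by simp [hr, Complex.conj_ofReal]
  have hmem : (!![u 0 / r, -star (u 1) / r; u 1 / r, star (u 0) / r] :
      Matrix (Fin 2) (Fin 2) ℂ) ∈ Matrix.specialUnitaryGroup (Fin 2) ℂ := by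
    rw [Matrix.mem_specialUnitaryGroup_iff, Matrix.mem_unitaryGroup_iff]
    constructor
    · ext i j
      have hstar' : (starRingEnd ℂ) r = r := hstar
      fin_cases i <;> fin_cases j <;>
        simp [Matrix.mul_apply, Fin.sum_univ_two, Matrix.star_apply, hstar'] <;> field_simp <;>
        (try rw [sq, hrr]) <;> simp <;> ring
    · rw [Matrix.det_fin_two]
      simp
      field_simp
      rw [sq, hrr]; simp; ring
  refine ⟨r, ⟨_, hmem⟩, ?_⟩
  funext i
  fin_cases i <;> simp <;> field_simp

/-- The last column is the image of the highest-weight vector, whose orbit under the group gives all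
powers up to scalars. -/
theorem mulVec_eq_smul_of_intertwines {d e : ℕ} {T : Matrix (Fin (d + 1)) (Fin (e + 1)) ℂ}
    {S : Matrix (Fin (d + 1)) (Fin (e + 1)) ℂ}
    (hT : ∀ g, wignerD d g * T = T * wignerD e g) (hS : ∀ g, wignerD d g * S = S * wignerD e g)
    (h : ∀ k, T k (Fin.last e) = S k (Fin.last e)) : T = S := by
  refine matrix_eq_of_mulVec_spinPower fun u => ?_
  obtain ⟨r, g, rfl⟩ := exists_smul_mulVec u
  rw [spinPower_smul, Matrix.mulVec_smul, Matrix.mulVec_smul, ← wignerD_mulVec_spinPower,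
    Matrix.mulVec_mulVec, Matrix.mulVec_mulVec, ← hT, ← hS, ← Matrix.mulVec_mulVec,
    ← Matrix.mulVec_mulVec, spinPower_single]
  congr 2
  funext k
  simpa using h k

/-- A single torus element, `diag(e^i, e^{-i})`, separates all weights: two integer multiples of one
radian agree modulo `2π` only if they are equal, because `π` is irrational. -/
theorem eq_zero_of_weight {d e : ℕ} {T : Matrix (Fin (d + 1)) (Fin (e + 1)) ℂ}
    (hT : ∀ g, wignerD d g * T = T * wignerD e g) (k : Fin (d + 1)) (hk : 2 * (k : ℕ) ≠ d + e) :
    T k (Fin.last e) = 0 := by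
  have hz : Complex.exp Complex.I * star (Complex.exp Complex.I) = 1 := by
    rw [Complex.star_def, ← Complex.exp_conj, Complex.conj_I, ← Complex.exp_add]; simp
  have h := congrFun (congrFun (hT (torus _ hz)) k) (Fin.last e)
  rw [wignerD_torus, wignerD_torus, Matrix.diagonal_mul, Matrix.mul_diagonal, mul_comm] at h
  by_contra h0
  have h' := mul_left_cancel₀ h0 h
  rw [Complex.star_def, ← Complex.exp_conj, Complex.conj_I, ← Complex.exp_nat_mul,
    ← Complex.exp_nat_mul, ← Complex.exp_nat_mul, ← Complex.exp_nat_mul, ← Complex.exp_add,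
    ← Complex.exp_add, Complex.exp_eq_exp_iff_exists_int] at h'
  obtain ⟨n, hn⟩ := h'
  have hd : ((d - k : ℕ) : ℂ) = d - k := by
    rw [Nat.cast_sub (Nat.lt_succ_iff.mp k.2)]
  simp only [hd, Fin.val_last, Nat.sub_self, Nat.cast_zero, zero_mul, add_zero] at hn
  -- The weights are `2k - d` and `e`; equality of the exponentials makes their difference `2 n π`.
  have hI : ((2 * (k : ℤ) - d - e : ℤ) : ℂ) = ((2 * n : ℤ) : ℂ) * (Real.pi : ℂ) := by
    push_cast
    refine mul_right_cancel₀ Complex.I_ne_zero ?_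
    linear_combination hn
  have hR : ((2 * (k : ℤ) - d - e : ℤ) : ℝ) = ((2 * n : ℤ) : ℝ) * Real.pi := by
    exact_mod_cast hI
  rcases eq_or_ne n 0 with rfl | hn0
  · apply hk
    have : (2 * (k : ℤ) - d - e : ℤ) = 0 := by
      have : ((2 * (k : ℤ) - d - e : ℤ) : ℝ) = 0 := by rw [hR]; simp
      exact_mod_cast this
    omega
  · have hirr : Irrational (((2 * n : ℤ) : ℝ) * Real.pi) :=
      irrational_pi.intCast_mul (by simpa using hn0)
    rw [← hR] at hirr
    exact hirr.ne_int _ rfl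

/-- The weight `e` does not occur in the smaller representation, since `2k - d ≤ d < e`. -/
theorem schur_of_lt {d e : ℕ} (hde : d < e) {T : Matrix (Fin (d + 1)) (Fin (e + 1)) ℂ}
    (hT : ∀ g, wignerD d g * T = T * wignerD e g) : T = 0 := by
  refine mulVec_eq_smul_of_intertwines hT (by simp) fun k => ?_
  exact eq_zero_of_weight hT k (by omega)

theorem schur_of_ne {d e : ℕ} (hde : d ≠ e) {T : Matrix (Fin (d + 1)) (Fin (e + 1)) ℂ}
    (hT : ∀ g, wignerD d g * T = T * wignerD e g) : T = 0 := by
  rcases lt_or_gt_of_ne hde with h | h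
  · exact schur_of_lt h hT
  -- The adjoint intertwines in the opposite direction, which exchanges the two dimensions.
  · have : Tᴴ = 0 := by
      refine schur_of_lt h fun g => ?_
      have := congrArg Matrix.conjTranspose (hT g⁻¹)
      rw [Matrix.conjTranspose_mul, Matrix.conjTranspose_mul, ← wignerD_inv, ← wignerD_inv,
        inv_inv] at this
      exact this.symm
    simpa using this

/-- Only the bottom entry of the last column has the required weight, so this column agrees with
that of a scalar matrix. -/
theorem schur_self {d : ℕ} {T : Matrix (Fin (d + 1)) (Fin (d + 1)) ℂ}
    (hT : ∀ g, wignerD d g * T = T * wignerD d g) :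
    T = T (Fin.last d) (Fin.last d) • (1 : Matrix (Fin (d + 1)) (Fin (d + 1)) ℂ) := by
  refine mulVec_eq_smul_of_intertwines hT (by simp) fun k => ?_
  by_cases hk : k = Fin.last d
  · subst hk; simp
  · have h1 : (k : ℕ) ≠ d := fun h' => hk (Fin.ext h')
    rw [eq_zero_of_weight hT k (by omega)]
    simp [hk]

/-! ## Clebsch-Gordan coefficients -/

/-- `A = j₁ + j₂ - j`, `B = j₁ + j - j₂`, `E = j₂ + j - j₁` are the exponents in the generating
function. In these variables the parity condition and truncated subtractions disappear. -/
theorem triangle_iff {a b c : ℕ} :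
    Triangle a b c ↔ ∃ A B E, a = A + B ∧ b = A + E ∧ c = B + E := by
  constructor
  · rintro ⟨h1, h2, h3, r, hr⟩
    exact ⟨r - c, r - b, r - a, by omega, by omega, by omega⟩
  · rintro ⟨A, B, E, rfl, rfl, rfl⟩
    exact ⟨by omega, by omega, by omega, A + B + E, by omega⟩

theorem clebschGordan_of_not_triangle {a b c : ℕ} (h : ¬ Triangle a b c) (k l n : ℕ) :
    clebschGordan a b c k l n = 0 := by
  simp [clebschGordan, h]

/-- The alternating sum in the Clebsch-Gordan coefficient. -/
def racahSum (A B E k l : ℕ) : ℝ :=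
  ∑ t ∈ (Finset.range (A + 1)).filter (fun t => t ≤ l ∧ A ≤ k + t),
    (-1 : ℝ) ^ t * A.choose t * B.choose (k + t - A) * E.choose (l - t)

theorem clebschGordan_eq (A B E k l n : ℕ) :
    clebschGordan (A + B) (A + E) (B + E) k l n =
      if k ≤ A + B ∧ l ≤ A + E ∧ n ≤ B + E ∧ n + A = k + l then
        Real.sqrt (((B + E + 1 : ℕ) * k.factorial * (A + B - k).factorial * l.factorial *
            (A + E - l).factorial * n.factorial * (B + E - n).factorial : ℝ) /
          (A.factorial * B.factorial * E.factorial * (A + B + E + 1).factorial)) *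
        racahSum A B E k l
      else 0 := by
  have hA : (A + B + (A + E) - (B + E)) / 2 = A := by omega
  have h1 : A + B - A = B := by omega
  have h2 : A + E - A = E := by omega
  have h3 : A + B + (A + E) - A + 1 = A + B + E + 1 := by omega
  have hT : Triangle (A + B) (A + E) (B + E) := triangle_iff.mpr ⟨A, B, E, rfl, rfl, rfl⟩
  simp only [clebschGordan, racahSum, hA, h1, h2, h3, hT, true_and]
  push_cast
  rfl

theorem clebschGordan_eq_zero_of_lt {a b c k l n : ℕ} (h : c < n) :
    clebschGordan a b c k l n = 0 := by
  have : ¬ n ≤ c := by omega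
  simp [clebschGordan, this]

/-- The reflection `t ↦ A - t` exchanges the two outer binomials and costs the sign `(-1) ^ A`. -/
theorem racahSum_swap (A B E k l : ℕ) :
    racahSum A B E k l = (-1) ^ A * racahSum A E B l k := by
  unfold racahSum
  rw [Finset.mul_sum]
  refine Finset.sum_nbij' (fun t => A - t) (fun t => A - t) ?_ ?_ ?_ ?_ ?_
  · intro t ht
    simp only [Finset.mem_filter, Finset.mem_range] at ht ⊢
    omega
  · intro t ht
    simp only [Finset.mem_filter, Finset.mem_range] at ht ⊢
    omega
  · intro t ht
    simp only [Finset.mem_filter, Finset.mem_range] at ht ⊢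
    omega
  · intro t ht
    simp only [Finset.mem_filter, Finset.mem_range] at ht ⊢
    omega
  · intro t ht
    simp only [Finset.mem_filter, Finset.mem_range] at ht
    have e1 : l + (A - t) - A = l - t := by omega
    have e2 : k - (A - t) = k + t - A := by omega
    have e3 : (-1 : ℝ) ^ A * (-1) ^ (A - t) = (-1) ^ t := by
      rw [← pow_add, show A + (A - t) = 2 * (A - t) + t by omega, pow_add, pow_mul]
      simp
    rw [e1, e2, Nat.choose_symm (by omega), ← e3]
    ring

theorem clebschGordan_swap (a b c : ℕ) : ∃ ε : ℝ, ε * ε = 1 ∧ ∀ k l n,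
    clebschGordan a b c k l n = ε * clebschGordan b a c l k n := by
  by_cases hT : Triangle a b c
  · obtain ⟨A, B, E, rfl, rfl, rfl⟩ := triangle_iff.mp hT
    refine ⟨(-1) ^ A, by rw [← mul_pow]; simp, fun k l n => ?_⟩
    rw [clebschGordan_eq, add_comm B E, clebschGordan_eq]
    by_cases h : k ≤ A + B ∧ l ≤ A + E ∧ n ≤ E + B ∧ n + A = k + l
    · have h' : l ≤ A + E ∧ k ≤ A + B ∧ n ≤ E + B ∧ n + A = l + k := by omega
      rw [if_pos h, if_pos h', racahSum_swap A B E k l,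
        show A + E + B + 1 = A + B + E + 1 by omega, mul_left_comm]
      congr 3
      ring
    · have h' : ¬ (l ≤ A + E ∧ k ≤ A + B ∧ n ≤ E + B ∧ n + A = l + k) := by omega
      rw [if_neg h, if_neg h', mul_zero]
  · have hT' : ¬ Triangle b a c := by
      unfold Triangle at hT ⊢
      rwa [add_comm b a, and_congr_right_iff.mpr fun _ => and_left_comm]
    exact ⟨1, one_mul 1, fun k l n => by
      rw [clebschGordan_of_not_triangle hT, clebschGordan_of_not_triangle hT', mul_zero]⟩

/-! ### Normalization of the coupled highest-weight vector -/

/-- Both sides are the coefficient of `X ^ A` in `(1 - X)^{-(B+1)} (1 - X)^{-(E+1)} = (1 -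
X)^{-(B+E+2)}`. -/
theorem sum_choose_mul_choose (A B E : ℕ) :
    ∑ t ∈ Finset.range (A + 1), (A - t + B).choose B * (E + t).choose E =
      (A + B + E + 1).choose A := by
  have h := congrArg (fun p : (PowerSeries ℚ)ˣ => PowerSeries.coeff A p.val)
    (PowerSeries.invOneSubPow_add (S := ℚ) (d := E + 1) (B + 1))
  simp only [Units.val_mul] at h
  rw [show E + 1 + (B + 1) = (E + B + 1) + 1 by ring,
    PowerSeries.invOneSubPow_val_succ_eq_mk_add_choose,
    PowerSeries.invOneSubPow_val_succ_eq_mk_add_choose,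
    PowerSeries.invOneSubPow_val_succ_eq_mk_add_choose, PowerSeries.coeff_mul,
    PowerSeries.coeff_mk, Finset.Nat.sum_antidiagonal_eq_sum_range_succ_mk] at h
  simp only [PowerSeries.coeff_mk] at h
  have h' : (E + B + 1 + A).choose (E + B + 1) =
      ∑ t ∈ Finset.range A.succ, (E + t).choose E * (B + (A - t)).choose B := by
    exact_mod_cast h
  rw [show A + B + E + 1 = E + B + 1 + A by ring, ← Nat.choose_symm_add, h']
  refine Finset.sum_congr rfl fun t _ => ?_
  rw [mul_comm, add_comm B]

/-- At maximal `m` the binomials `B.choose (B - t + s)` and `E.choose (E + t - s)` are both nonzero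
only for `s = t`. -/
theorem racahSum_highest (A B E t : ℕ) (ht : t ≤ A) :
    racahSum A B E (A + B - t) (E + t) = (-1) ^ t * A.choose t := by
  unfold racahSum
  rw [Finset.sum_eq_single t]
  · rw [show A + B - t + t - A = B by omega, show E + t - t = E by omega]
    simp
  · intro s hs hst
    simp only [Finset.mem_filter, Finset.mem_range] at hs
    rcases lt_or_gt_of_ne hst with h | h
    · rw [Nat.choose_eq_zero_of_lt (show E < E + t - s by omega)]; simp
    · rw [Nat.choose_eq_zero_of_lt (show B < A + B - t + s - A by omega)]; simp
  · intro h
    exfalso; apply h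
    simp only [Finset.mem_filter, Finset.mem_range]
    omega

theorem clebschGordan_highest_sq (A B E t : ℕ) (ht : t ≤ A) :
    clebschGordan (A + B) (A + E) (B + E) (A + B - t) (E + t) (B + E) ^ 2 *
      ((A + B + E + 1).choose A : ℝ) = ((A - t + B).choose B * (E + t).choose E : ℕ) := by
  rw [clebschGordan_eq, if_pos (by omega), racahSum_highest A B E t ht, mul_pow,
    Real.sq_sqrt (by positivity), mul_pow, ← pow_mul, mul_comm t 2, pow_mul,
    show A + B - (A + B - t) = t by omega, show A + E - (E + t) = A - t by omega,
    show B + E - (B + E) = 0 by omega, show A + B - t = A - t + B by omega]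
  push_cast
  rw [Nat.cast_choose ℝ ht, Nat.cast_choose ℝ (show A ≤ A + B + E + 1 by omega),
    Nat.cast_choose ℝ (show B ≤ A - t + B by omega), Nat.cast_choose ℝ (show E ≤ E + t by omega),
    show A + B + E + 1 - A = (B + E) + 1 by omega, show A - t + B - B = A - t by omega,
    show E + t - E = t by omega, Nat.factorial_succ (B + E)]
  have h1 := Nat.factorial_ne_zero A
  have h2 := Nat.factorial_ne_zero B
  have h3 := Nat.factorial_ne_zero E
  have h4 := Nat.factorial_ne_zero t
  have h5 := Nat.factorial_ne_zero (A - t)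
  have h6 := Nat.factorial_ne_zero (A + B + E + 1)
  have h7 := Nat.factorial_ne_zero (B + E)
  have h8 : ((B : ℝ) + E + 1) ≠ 0 := by positivity
  push_cast
  simp only [Nat.factorial_zero]
  field_simp
  norm_num

theorem sum_clebschGordan_highest_sq {a b c : ℕ} (h : Triangle a b c) :
    ∑ x ∈ Finset.range (a + 1), ∑ y ∈ Finset.range (b + 1), clebschGordan a b c x y c ^ 2 = 1 := by
  obtain ⟨A, B, E, rfl, rfl, rfl⟩ := triangle_iff.mp h
  have hpos : (0 : ℝ) < ((A + B + E + 1).choose A : ℝ) := by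
    exact_mod_cast Nat.choose_pos (by omega)
  refine mul_right_cancel₀ hpos.ne' ?_
  rw [one_mul, ← Finset.sum_product', Finset.sum_mul]
  -- The selection rule leaves only the pairs `(A + B - t, E + t)` with `0 ≤ t ≤ A`.
  rw [← Finset.sum_of_injOn (s := Finset.range (A + 1)) (fun t => (A + B - t, E + t))
    (f := fun t => (((A - t + B).choose B * (E + t).choose E : ℕ) : ℝ))]
  · rw [← Nat.cast_sum, sum_choose_mul_choose]
  · intro t _ t' _ h
    simp only [Prod.mk.injEq] at h
    omega
  · intro t ht
    simp only [Finset.coe_product, Set.mem_prod, Finset.coe_range, Set.mem_Iio] at ht ⊢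
    omega
  · rintro ⟨x, y⟩ hxy hn
    simp only [Finset.mem_product, Finset.mem_range] at hxy
    rw [clebschGordan_eq, if_neg, zero_pow two_ne_zero, zero_mul]
    rintro ⟨h1, h2, h3, h4⟩
    refine hn ⟨A + B - x, ?_, ?_⟩
    · simp only [Finset.coe_range, Set.mem_Iio]; omega
    · simp only [Prod.mk.injEq]; omega
  · intro t ht
    simp only [Finset.mem_range] at ht
    exact (clebschGordan_highest_sq A B E t (by omega)).symm

/-! ### The generating function -/

/-- The three powers on the right are expanded by the binomial theorem. Collecting a given monomial
leaves the index `t` of the first expansion free, and this free sum is the alternating Racah sum. -/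
theorem racahSum_generating (A B E : ℕ) (u w z : Fin 2 → ℂ) :
    ∑ x ∈ Finset.range (A + B + 1), ∑ y ∈ Finset.range (A + E + 1),
      ∑ k ∈ Finset.range (B + E + 1), (if k + A = x + y then (racahSum A B E x y : ℂ) else 0) *
        ((u 0 ^ x * u 1 ^ (A + B - x)) * (w 0 ^ y * w 1 ^ (A + E - y)) *
          (z 0 ^ k * z 1 ^ (B + E - k))) =
      (u 0 * w 1 - u 1 * w 0) ^ A * (z ⬝ᵥ u) ^ B * (z ⬝ᵥ w) ^ E := by
  have hR : (u 0 * w 1 - u 1 * w 0) ^ A * (z ⬝ᵥ u) ^ B * (z ⬝ᵥ w) ^ E =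
      ∑ t ∈ Finset.range (A + 1), ∑ i ∈ Finset.range (B + 1), ∑ l ∈ Finset.range (E + 1),
        (((-1) ^ t * A.choose t * B.choose i * E.choose l : ℂ)) *
        ((u 0 ^ (A - t + i) * u 1 ^ (t + (B - i))) * (w 0 ^ (t + l) * w 1 ^ (A - t + (E - l))) *
          (z 0 ^ (i + l) * z 1 ^ (B - i + (E - l)))) := by
    rw [show u 0 * w 1 - u 1 * w 0 = -(u 1 * w 0) + u 0 * w 1 by ring]
    simp only [dotProduct, Fin.sum_univ_two]
    rw [add_pow, add_pow, add_pow, Finset.sum_mul_sum, Finset.sum_mul]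
    refine Finset.sum_congr rfl fun t _ => ?_
    rw [Finset.sum_mul_sum]
    refine Finset.sum_congr rfl fun i _ => ?_
    refine Finset.sum_congr rfl fun l _ => ?_
    rw [neg_pow]
    simp only [mul_pow, pow_add]
    ring
  rw [hR]
  have hL : ∀ x y k : ℕ, (if k + A = x + y then (racahSum A B E x y : ℂ) else 0) *
        ((u 0 ^ x * u 1 ^ (A + B - x)) * (w 0 ^ y * w 1 ^ (A + E - y)) *
          (z 0 ^ k * z 1 ^ (B + E - k))) = ∑ t ∈ Finset.range (A + 1),
        if k + A = x + y ∧ t ≤ y ∧ A ≤ x + t then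
          ((-1 : ℂ) ^ t * A.choose t * B.choose (x + t - A) * E.choose (y - t)) *
        ((u 0 ^ x * u 1 ^ (A + B - x)) * (w 0 ^ y * w 1 ^ (A + E - y)) *
          (z 0 ^ k * z 1 ^ (B + E - k))) else 0 := by
    intro x y k
    by_cases h : k + A = x + y
    · simp only [h, if_true, true_and, racahSum]
      rw [← Finset.sum_filter, Complex.ofReal_sum, Finset.sum_mul]
      push_cast
      rfl
    · simp [h]
  simp only [hL]
  simp only [← Finset.sum_product']
  symm
  -- The binomial indices `(t, i, l)` determine the exponents `x = A - t + i`, `y = t + l`, `k = i +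
  -- l`. Admissible index tuples outside the image contain a vanishing binomial.
  refine Finset.sum_of_injOn (fun p => (A - p.1 + p.2.1, p.1 + p.2.2, p.2.1 + p.2.2, p.1)) ?_ ?_ ?_ ?_
  · rintro ⟨t, i, l⟩ _ ⟨t', i', l'⟩ _ h
    simp only [Prod.mk.injEq] at h ⊢
    omega
  · rintro ⟨t, i, l⟩ h
    simp only [Finset.coe_product, Set.mem_prod, Finset.coe_range, Set.mem_Iio] at h ⊢
    omega
  · rintro ⟨x, y, k, t⟩ hxy hn
    simp only [Finset.mem_product, Finset.mem_range] at hxy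
    simp only
    split_ifs with h
    · by_cases hB : B < x + t - A
      · rw [Nat.choose_eq_zero_of_lt hB]; simp
      by_cases hE : E < y - t
      · rw [Nat.choose_eq_zero_of_lt hE]; simp
      exfalso
      refine hn ⟨(t, x + t - A, y - t), ?_, ?_⟩
      · simp only [Finset.coe_product, Set.mem_prod, Finset.coe_range, Set.mem_Iio]; omega
      · simp only [Prod.mk.injEq, and_true]; omega
    · rfl
  · rintro ⟨t, i, l⟩ h
    simp only [Finset.mem_product, Finset.mem_range] at h
    simp only
    rw [if_pos (by omega), show A - t + i + t - A = i by omega, show t + l - t = l by omega,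
      show A + B - (A - t + i) = t + (B - i) by omega,
      show A + E - (t + l) = A - t + (E - l) by omega,
      show B + E - (i + l) = B - i + (E - l) by omega]

/-- The normalization of the generating function of the Clebsch-Gordan coefficients. -/
def racahNorm (A B E : ℕ) : ℝ :=
  Real.sqrt (((B + E + 1 : ℕ) * (A + B).factorial * (A + E).factorial * (B + E).factorial : ℝ) /
    (A.factorial * B.factorial * E.factorial * (A + B + E + 1).factorial))

/-- The weights of `spinPower` cancel every factorial that depends on the magnetic indices, leaving
a constant times the Racah sum. -/
theorem clebschGordan_mul_sqrt (A B E k l n : ℕ) (hk : k ≤ A + B) (hl : l ≤ A + E)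
    (hn : n ≤ B + E) :
    clebschGordan (A + B) (A + E) (B + E) k l n * (Real.sqrt ((A + B).choose k) *
      Real.sqrt ((A + E).choose l) * Real.sqrt ((B + E).choose n)) =
      racahNorm A B E * if n + A = k + l then racahSum A B E k l else 0 := by
  rw [clebschGordan_eq]
  by_cases h : n + A = k + l
  · rw [if_pos ⟨hk, hl, hn, h⟩, if_pos h, mul_right_comm, ← Real.sqrt_mul (by positivity),
      ← Real.sqrt_mul (by positivity), ← Real.sqrt_mul (by positivity), racahNorm]
    congr 2
    rw [Nat.cast_choose ℝ hk, Nat.cast_choose ℝ hl, Nat.cast_choose ℝ hn]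
    have h1 := Nat.factorial_ne_zero k
    have h2 := Nat.factorial_ne_zero l
    have h3 := Nat.factorial_ne_zero n
    have h4 := Nat.factorial_ne_zero (A + B - k)
    have h5 := Nat.factorial_ne_zero (A + E - l)
    have h6 := Nat.factorial_ne_zero (B + E - n)
    field_simp
  · rw [if_neg (by tauto), if_neg h, zero_mul, mul_zero]

/-- The Clebsch-Gordan coefficients as a matrix `V^{j₁} ⊗ V^{j₂} → V^j`. -/
def cgMatrix (a b c : ℕ) : Matrix (Fin (c + 1)) (Fin (a + 1) × Fin (b + 1)) ℂ := fun k x =>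
  (clebschGordan a b c x.1 x.2 k : ℂ)

/-- The components of `u^{⊗ a} ⊗ w^{⊗ b}`. -/
def spinPower₂ (a b : ℕ) (u w : Fin 2 → ℂ) : Fin (a + 1) × Fin (b + 1) → ℂ := fun x =>
  spinPower a u x.1 * spinPower b w x.2

theorem cgMatrix_generating (A B E : ℕ) (u w z : Fin 2 → ℂ) :
    spinPower (B + E) z ⬝ᵥ (cgMatrix (A + B) (A + E) (B + E) *ᵥ spinPower₂ (A + B) (A + E) u w) =
      racahNorm A B E * ((u 0 * w 1 - u 1 * w 0) ^ A * (z ⬝ᵥ u) ^ B * (z ⬝ᵥ w) ^ E) := by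
  rw [← racahSum_generating, Finset.sum_range]
  simp only [Finset.sum_range, Matrix.mulVec, dotProduct, Fintype.sum_prod_type, cgMatrix,
    spinPower₂, spinPower, Finset.mul_sum]
  rw [Finset.sum_comm]
  refine Finset.sum_congr rfl fun x _ => ?_
  rw [Finset.sum_comm]
  refine Finset.sum_congr rfl fun y _ => ?_
  refine Finset.sum_congr rfl fun k _ => ?_
  have h := congrArg (fun r : ℝ => (r : ℂ)) (clebschGordan_mul_sqrt A B E x y k
    (Nat.lt_succ_iff.mp x.2) (Nat.lt_succ_iff.mp y.2) (Nat.lt_succ_iff.mp k.2))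
  simp only [Complex.ofReal_mul, apply_ite Complex.ofReal, Complex.ofReal_zero] at h
  rw [← mul_assoc (racahNorm A B E : ℂ), ← h]
  ring

theorem matrix_eq_of_mulVec_spinPower₂ {a b : ℕ} {ι : Type*}
    {M M' : Matrix ι (Fin (a + 1) × Fin (b + 1)) ℂ}
    (h : ∀ u w, M *ᵥ spinPower₂ a b u w = M' *ᵥ spinPower₂ a b u w) : M = M' := by
  funext i
  have h1 : ∀ w, (fun x => ∑ y, M i (x, y) * spinPower b w y) =
      fun x => ∑ y, M' i (x, y) * spinPower b w y := by
    intro w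
    refine eq_of_sum_spinPower fun u => ?_
    have := congrFun (h u w) i
    simp only [Matrix.mulVec, dotProduct, Fintype.sum_prod_type, spinPower₂] at this
    simp only [Finset.sum_mul]
    simpa only [mul_assoc, mul_comm (spinPower a u _)] using this
  funext ⟨x, y⟩
  exact congrFun (eq_of_sum_spinPower (c := fun y => M i (x, y)) (c' := fun y => M' i (x, y))
    fun w => congrFun (h1 w) x) y

open scoped Kronecker in
theorem kronecker_mulVec_spinPower₂ (a b : ℕ) (g : SU2) (u w : Fin 2 → ℂ) :
    (wignerD a g ⊗ₖ wignerD b g) *ᵥ spinPower₂ a b u w = spinPower₂ a b (g.1 *ᵥ u) (g.1 *ᵥ w) := by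
  funext ⟨x, y⟩
  simp only [spinPower₂, ← wignerD_mulVec_spinPower, Matrix.mulVec, dotProduct,
    Fintype.sum_prod_type, Matrix.kroneckerMap_apply, Finset.sum_mul_sum]
  refine Finset.sum_congr rfl fun i _ => Finset.sum_congr rfl fun j _ => ?_
  ring

open scoped Kronecker in
-- In the generating function `u ∧ w` is multiplied by `det g = 1`, and `z·(g u) = (z g)·u` moves
-- `g` to the coupled side.
theorem cgMatrix_intertwines (a b c : ℕ) (g : SU2) :
    cgMatrix a b c * (wignerD a g ⊗ₖ wignerD b g) = wignerD c g * cgMatrix a b c := by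
  by_cases hT : Triangle a b c
  · obtain ⟨A, B, E, rfl, rfl, rfl⟩ := triangle_iff.mp hT
    refine matrix_eq_of_mulVec_spinPower₂ fun u w => ?_
    refine eq_of_sum_spinPower fun z => ?_
    change _ ⬝ᵥ spinPower _ z = _ ⬝ᵥ spinPower _ z
    rw [dotProduct_comm, dotProduct_comm _ (spinPower _ z), ← Matrix.mulVec_mulVec,
      ← Matrix.mulVec_mulVec, kronecker_mulVec_spinPower₂, cgMatrix_generating,
      Matrix.dotProduct_mulVec (spinPower _ z), spinPower_vecMul_wignerD, cgMatrix_generating,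
      ← Matrix.dotProduct_mulVec, ← Matrix.dotProduct_mulVec]
    congr 4
    have hdet : g.1.det = 1 := (Matrix.mem_specialUnitaryGroup_iff.mp g.2).2
    rw [Matrix.det_fin_two] at hdet
    simp only [Matrix.mulVec, dotProduct, Fin.sum_univ_two]
    linear_combination (u 0 * w 1 - u 1 * w 0) * hdet
  · have : cgMatrix a b c = 0 := by
      funext k x
      simp [cgMatrix, clebschGordan_of_not_triangle hT]
    simp [this]

/-! ### Orthogonality -/

open scoped Kronecker in
theorem cgMatrix_mul_conjTranspose_intertwines (a b c c' : ℕ) (g : SU2) :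
    wignerD c g * (cgMatrix a b c * (cgMatrix a b c')ᴴ) =
      cgMatrix a b c * (cgMatrix a b c')ᴴ * wignerD c' g := by
  have h := congrArg Matrix.conjTranspose (cgMatrix_intertwines a b c' g⁻¹)
  rw [Matrix.conjTranspose_mul, Matrix.conjTranspose_mul, Matrix.conjTranspose_kronecker,
    ← wignerD_inv, ← wignerD_inv, ← wignerD_inv, inv_inv] at h
  rw [← Matrix.mul_assoc, ← cgMatrix_intertwines, Matrix.mul_assoc, h, Matrix.mul_assoc]

theorem cgMatrix_orthogonal {a b c c' : ℕ} (h : c ≠ c') :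
    cgMatrix a b c * (cgMatrix a b c')ᴴ = 0 :=
  schur_of_ne h (cgMatrix_mul_conjTranspose_intertwines a b c c')

/-- Schur's lemma reduces the product to a scalar, which is read off from its highest-weight
diagonal entry. -/
theorem cgMatrix_orthonormal {a b c : ℕ} (h : Triangle a b c) :
    cgMatrix a b c * (cgMatrix a b c)ᴴ = 1 := by
  rw [schur_self (cgMatrix_mul_conjTranspose_intertwines a b c c)]
  convert one_smul ℂ _
  have := congrArg (fun r : ℝ => (r : ℂ)) (sum_clebschGordan_highest_sq h)
  simp only [Complex.ofReal_sum, Complex.ofReal_pow, Complex.ofReal_one, Finset.sum_range] at this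
  rw [← this]
  simp [Matrix.mul_apply, Fintype.sum_prod_type, cgMatrix, sq, Complex.conj_ofReal]

/-! ### Completeness by counting dimensions -/

/-- The admissible spins are `c = a + b - 2A` with `0 ≤ A ≤ min a b`, so the sum is an arithmetic
progression. -/
theorem sum_triangle_dim (a b : ℕ) :
    ∑ c ∈ (Finset.range (a + b + 1)).filter (Triangle a b), (c + 1) = (a + 1) * (b + 1) := by
  have h1 : ∀ m M : ℕ, m ≤ M → ∀ n ≤ m, ∑ A ∈ Finset.range (n + 1), ((m : ℤ) + M - 2 * A + 1) =
      (n + 1) * (m + M + 1 - n) := by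
    intro m M _ n _
    induction n with
    | zero => simp
    | succ n ih => rw [Finset.sum_range_succ, ih (by omega)]; push_cast; ring
  have h2 : ∑ c ∈ (Finset.range (a + b + 1)).filter (Triangle a b), ((c : ℤ) + 1) =
      ∑ A ∈ Finset.range (min a b + 1), (((min a b : ℕ) : ℤ) + (max a b : ℕ) - 2 * A + 1) := by
    refine Finset.sum_nbij' (fun c => (a + b - c) / 2) (fun A => a + b - 2 * A) ?_ ?_ ?_ ?_ ?_
    · intro c hc
      simp only [Finset.mem_filter, Finset.mem_range, Triangle] at hc ⊢
      omega
    · intro A hA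
      simp only [Finset.mem_filter, Finset.mem_range, Triangle] at hA ⊢
      refine ⟨by omega, by omega, by omega, by omega, a + b - A, by omega⟩
    · intro c hc
      simp only [Finset.mem_filter, Finset.mem_range, Triangle] at hc
      obtain ⟨_, _, _, _, r, hr⟩ := hc
      omega
    · intro A hA
      simp only [Finset.mem_range] at hA
      omega
    · intro c hc
      simp only [Finset.mem_filter, Finset.mem_range, Triangle] at hc
      obtain ⟨_, _, _, _, r, hr⟩ := hc
      omega
  have h3 := h1 (min a b) (max a b) (by omega) (min a b) le_rfl
  rw [← h2] at h3
  have h4 : ((min a b : ℕ) + 1 : ℤ) * ((min a b : ℕ) + (max a b : ℕ) + 1 - (min a b : ℕ)) =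
      (a + 1) * (b + 1) := by
    rcases le_total a b with h | h
    · rw [min_eq_left h, max_eq_right h]; ring
    · rw [min_eq_right h, max_eq_left h]; ring
  rw [h4] at h3
  exact_mod_cast h3

/-- The pairs `(j, k)` of a spin in the decomposition of `V^{j₁} ⊗ V^{j₂}` and a magnetic index. -/
abbrev CoupledIndex (a b : ℕ) : Type :=
  Σ c : ((Finset.range (a + b + 1)).filter (Triangle a b) : Finset ℕ), Fin (c.1 + 1)

/-- All Clebsch-Gordan matrices of `V^{j₁} ⊗ V^{j₂}` together. -/
def cgFull (a b : ℕ) : Matrix (CoupledIndex a b) (Fin (a + 1) × Fin (b + 1)) ℂ := fun i =>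
  cgMatrix a b i.1 i.2

theorem cgFull_mul_conjTranspose (a b : ℕ) : cgFull a b * (cgFull a b)ᴴ = 1 := by
  funext ⟨⟨c, hc⟩, k⟩ ⟨⟨c', hc'⟩, k'⟩
  change (cgMatrix a b c * (cgMatrix a b c')ᴴ) k k' = _
  by_cases h : c = c'
  · subst h
    rw [cgMatrix_orthonormal (Finset.mem_filter.mp hc).2, Matrix.one_apply, Matrix.one_apply]
    simp
  · rw [cgMatrix_orthogonal h, Matrix.one_apply_ne]
    · rfl
    · simp [h]

/-- Equal cardinalities of the two index types make the one-sided inverse two-sided. -/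
theorem cgFull_conjTranspose_mul (a b : ℕ) : (cgFull a b)ᴴ * cgFull a b = 1 := by
  have hcard : Fintype.card (CoupledIndex a b) = Fintype.card (Fin (a + 1) × Fin (b + 1)) := by
    rw [Fintype.card_sigma, Fintype.card_prod]
    simp only [Fintype.card_fin]
    rw [← sum_triangle_dim]
    exact Finset.sum_coe_sort ((Finset.range (a + b + 1)).filter (Triangle a b)) (fun c => c + 1)
  exact (Matrix.mul_eq_one_comm_of_card_eq _ _ _ hcard).mp (cgFull_mul_conjTranspose a b)

theorem clebschGordan_complete (a b : ℕ) (x x' : Fin (a + 1)) (y y' : Fin (b + 1)) :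
    ∑ c ∈ (Finset.range (a + b + 1)).filter (Triangle a b), ∑ k : Fin (c + 1),
      (clebschGordan a b c x y k : ℂ) * (clebschGordan a b c x' y' k : ℂ) =
      if x = x' ∧ y = y' then 1 else 0 := by
  have h := congrFun (congrFun (cgFull_conjTranspose_mul a b) (x, y)) (x', y')
  rw [Matrix.one_apply, Matrix.mul_apply, Fintype.sum_sigma] at h
  simp only [Prod.mk.injEq] at h
  rw [← h, ← Finset.sum_coe_sort]
  simp [cgFull, cgMatrix, Complex.conj_ofReal]

theorem clebschGordan_orthonormal {a b c c' : ℕ} (h : Triangle a b c)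
    (k : Fin (c + 1)) (k' : Fin (c' + 1)) :
    ∑ x : Fin (a + 1), ∑ y : Fin (b + 1), (clebschGordan a b c x y k : ℂ) *
      (clebschGordan a b c' x y k' : ℂ) = if c = c' ∧ (k : ℕ) = k' then 1 else 0 := by
  have e : ∑ x : Fin (a + 1), ∑ y : Fin (b + 1), (clebschGordan a b c x y k : ℂ) *
      (clebschGordan a b c' x y k' : ℂ) = (cgMatrix a b c * (cgMatrix a b c')ᴴ) k k' := by
    simp [Matrix.mul_apply, Fintype.sum_prod_type, cgMatrix, Complex.conj_ofReal]
  rw [e]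
  by_cases hc : c = c'
  · subst hc
    rw [cgMatrix_orthonormal h, Matrix.one_apply]
    simp [Fin.ext_iff]
  · rw [cgMatrix_orthogonal hc]
    simp [hc]

theorem clebschGordan_intertwines (a b c : ℕ) (g : SU2) (k : Fin (c + 1)) (x : Fin (a + 1))
    (y : Fin (b + 1)) :
    ∑ x' : Fin (a + 1), ∑ y' : Fin (b + 1), (clebschGordan a b c x' y' k : ℂ) *
      (wignerD a g x' x * wignerD b g y' y) =
      ∑ k' : Fin (c + 1), wignerD c g k k' * (clebschGordan a b c x y k' : ℂ) := by
  have h := congrFun (congrFun (cgMatrix_intertwines a b c g) k) (x, y)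
  simpa only [Matrix.mul_apply, Fintype.sum_prod_type, cgMatrix, Matrix.kroneckerMap_apply] using h

/-! ## Orthogonality of the matrix elements -/

instance instIsProbabilityMeasureHaar : IsProbabilityMeasure haarSU2 := by
  refine ⟨?_⟩
  have h := Measure.haarMeasure_self (G := SU2) (K₀ := ⊤)
  simpa [haarSU2] using h

instance instIsMulLeftInvariantHaar : haarSU2.IsMulLeftInvariant := by
  unfold haarSU2; infer_instance

theorem integrable_haar {f : SU2 → ℂ} (hf : Continuous f) : Integrable f haarSU2 :=
  hf.integrable_of_hasCompactSupport (HasCompactSupport.of_compactSpace f)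

theorem integrable_wignerD_mul_star {d e : ℕ} (k l : Fin (d + 1)) (m n : Fin (e + 1)) :
    Integrable (fun g => wignerD d g k l * star (wignerD e g m n)) haarSU2 :=
  integrable_haar ((continuous_wignerD d k l).mul (continuous_star.comp (continuous_wignerD e m n)))

/-- Multiplication by `h` on either side is absorbed into an argument of the integrand; the two
results differ by the left translation `g ↦ h g`. -/
theorem haar_intertwines (d e : ℕ) (l : Fin (d + 1)) (n : Fin (e + 1)) (h : SU2) :
    wignerD d h * (Matrix.of fun k m => ∫ g, wignerD d g k l * star (wignerD e g m n) ∂haarSU2) =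
      (Matrix.of fun k m => ∫ g, wignerD d g k l * star (wignerD e g m n) ∂haarSU2) *
        wignerD e h := by
  funext k m
  simp only [Matrix.mul_apply, Matrix.of_apply]
  have hl : ∑ k', wignerD d h k k' * ∫ g, wignerD d g k' l * star (wignerD e g m n) ∂haarSU2 =
      ∫ g, wignerD d (h * g) k l * star (wignerD e g m n) ∂haarSU2 := by
    simp only [← integral_const_mul]
    rw [← integral_finsetSum _ fun i _ => (integrable_wignerD_mul_star _ _ _ _).const_mul _]
    congr 1; funext g
    rw [wignerD_mul, Matrix.mul_apply, Finset.sum_mul]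
    exact Finset.sum_congr rfl fun i _ => by ring
  have hr : ∑ m', (∫ g, wignerD d g k l * star (wignerD e g m' n) ∂haarSU2) * wignerD e h m' m =
      ∫ g, wignerD d g k l * star (wignerD e (h⁻¹ * g) m n) ∂haarSU2 := by
    simp only [← integral_mul_const]
    rw [← integral_finsetSum _ fun i _ => (integrable_wignerD_mul_star _ _ _ _).mul_const _]
    congr 1; funext g
    rw [wignerD_mul, Matrix.mul_apply, star_sum, Finset.mul_sum]
    refine Finset.sum_congr rfl fun i _ => ?_
    rw [star_mul', wignerD_inv_apply, star_star]
    ring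
  rw [hl, hr, ← integral_mul_left_eq_self
    (fun g => wignerD d g k l * star (wignerD e (h⁻¹ * g) m n)) h]
  simp only [inv_mul_cancel_left]

/-- Schur orthogonality. -/
theorem haar_orthogonality {d e : ℕ} (k l : Fin (d + 1)) (m n : Fin (e + 1)) :
    ∫ g, wignerD d g k l * star (wignerD e g m n) ∂haarSU2 =
      if d = e ∧ (k : ℕ) = m ∧ (l : ℕ) = n then ((d : ℂ) + 1)⁻¹ else 0 := by
  by_cases hde : d = e
  · subst hde
    set T : Matrix (Fin (d + 1)) (Fin (d + 1)) ℂ :=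
      Matrix.of fun k m => ∫ g, wignerD d g k l * star (wignerD d g m n) ∂haarSU2 with hT
    have hs := schur_self (haar_intertwines d d l n)
    rw [← hT] at hs
    -- The scalar in Schur's lemma is found from the trace: by unitarity the summed integrand is the
    -- constant `δ_{l n}`.
    have htr : T.trace = if l = n then 1 else 0 := by
      simp only [Matrix.trace, Matrix.diag, hT, Matrix.of_apply]
      rw [← integral_finsetSum _ fun i _ => integrable_wignerD_mul_star i l i n]
      have : ∀ g, ∑ i, wignerD d g i l * star (wignerD d g i n) = if l = n then 1 else 0 := by
        intro g
        have h := congrFun (congrFun (wignerD_inv_mul d g) n) l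
        rw [Matrix.mul_apply, Matrix.one_apply] at h
        simp only [wignerD_inv_apply] at h
        simp only [mul_comm (wignerD d g _ l), h, eq_comm]
      simp only [this, integral_const, probReal_univ, one_smul]
    have htr' : T.trace = T (Fin.last d) (Fin.last d) * ((d : ℂ) + 1) := by
      conv_lhs => rw [hs]
      simp
    have hd : (d : ℂ) + 1 ≠ 0 := by exact_mod_cast Nat.succ_ne_zero d
    have hval : T (Fin.last d) (Fin.last d) = (if l = n then 1 else 0) * ((d : ℂ) + 1)⁻¹ := by
      rw [eq_mul_inv_iff_mul_eq₀ hd, ← htr', htr]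
    change T k m = _
    rw [hs, Matrix.smul_apply, Matrix.one_apply, hval]
    simp only [true_and, ← Fin.ext_iff]
    by_cases h1 : k = m <;> by_cases h2 : l = n <;> simp [h1, h2]
  · have h := congrFun (congrFun (schur_of_ne hde (haar_intertwines d e l n)) k) m
    simpa [hde] using h

/-! ## Recoupling trees

The trees on `n + 1` legs, which are built by adding a leg at the root. -/

/-- The components of the recoupled vector on any positive number of legs. -/
def treeVec {n : ℕ} (a s : Fin (n + 1) → ℕ) (k : ℕ) (m : Mag a) : ℂ :=
  ∑ κ : Mag s,
    if (κ 0 : ℕ) = k ∧ (κ (Fin.last n) : ℕ) = m (Fin.last n) then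
      ∏ i : Fin n, (clebschGordan (s i.succ) (a i.castSucc) (s i.castSucc)
        (κ i.succ) (m i.castSucc) (κ i.castSucc) : ℂ)
    else 0

theorem recoupled_eq_treeVec {p : ℕ} (a s : Fin (p + 2) → ℕ) (k : ℕ) (m : Mag a) :
    recoupled a s k m = treeVec a s k m := rfl

/-- The admissible recoupling spins of a tree. -/
def IsPath {n : ℕ} (a s : Fin (n + 1) → ℕ) : Prop :=
  s (Fin.last n) = a (Fin.last n) ∧ ∀ i : Fin n, Triangle (s i.succ) (a i.castSucc) (s i.castSucc)

instance {n : ℕ} (a s : Fin (n + 1) → ℕ) : Decidable (IsPath a s) := by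
  unfold IsPath; infer_instance

theorem fin_one_eq (i j : Fin (0 + 1)) : i = j :=
  Subsingleton.elim (α := Fin 1) i j

theorem sum_mag_succ {n : ℕ} (s : Fin (n + 2) → ℕ) (f : Mag s → ℂ) :
    ∑ κ, f κ = ∑ κ₀ : Fin (s 0 + 1), ∑ κ : Mag (fun i => s i.succ),
      f (Fin.cons (α := fun i => Fin (s i + 1)) κ₀ κ) := by
  rw [← (Fin.consEquiv fun i => Fin (s i + 1)).sum_comp, Fintype.sum_prod_type]
  rfl

theorem sum_mag_one (s : Fin 1 → ℕ) (f : Mag s → ℂ) :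
    ∑ κ, f κ = ∑ κ₀ : Fin (s 0 + 1), f (fun i => ⟨κ₀, by rw [Subsingleton.elim i 0]; exact κ₀.2⟩) := by
  rw [← (Equiv.piUnique fun i => Fin (s i + 1)).symm.sum_comp]
  refine Finset.sum_congr rfl fun x _ => ?_
  congr 1
  funext i
  rw [Subsingleton.elim i 0]
  rfl

theorem treeVec_zero {a s : Fin 1 → ℕ} (h : s 0 = a 0) (k : ℕ) (m : Mag a) :
    treeVec a s k m = if k = m 0 then 1 else 0 := by
  have hs : s = a := funext fun i => by rw [Subsingleton.elim i 0, h]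
  subst hs
  unfold treeVec
  rw [Finset.sum_eq_single m]
  · simp [eq_comm]
  · intro κ _ hκ
    rw [if_neg]
    rintro ⟨_, h2⟩
    apply hκ
    funext i
    rw [Subsingleton.elim i (Fin.last 0)]
    exact Fin.ext h2
  · simp

/-- Splitting off the root vertex is the recursion behind all inductions on trees. These start from
a single leg, where the recoupled vectors are the basis vectors themselves. -/
theorem treeVec_succ {n : ℕ} (a s : Fin (n + 2) → ℕ) (k : ℕ) (m : Mag a) :
    treeVec a s k m = ∑ κ : Fin (s (Fin.succ 0) + 1),
      (clebschGordan (s (Fin.succ 0)) (a 0) (s 0) κ (m 0) k : ℂ) *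
        treeVec (fun i => a i.succ) (fun i => s i.succ) κ (fun i => m i.succ) := by
  have hR : ∑ κ : Fin (s (Fin.succ 0) + 1),
      (clebschGordan (s (Fin.succ 0)) (a 0) (s 0) κ (m 0) k : ℂ) *
        treeVec (fun i => a i.succ) (fun i => s i.succ) κ (fun i => m i.succ) =
      ∑ κ : Mag (fun i => s i.succ), if (κ (Fin.last n) : ℕ) = m (Fin.last n).succ then
        (clebschGordan (s (Fin.succ 0)) (a 0) (s 0) (κ 0) (m 0) k : ℂ) *
        ∏ i : Fin n, (clebschGordan (s i.succ.succ) (a i.castSucc.succ) (s i.castSucc.succ)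
          (κ i.succ) (m i.castSucc.succ) (κ i.castSucc) : ℂ) else 0 := by
    simp only [treeVec, Finset.mul_sum]
    rw [Finset.sum_comm]
    refine Finset.sum_congr rfl fun κ _ => ?_
    rw [Finset.sum_eq_single (κ 0)]
    · simp
    · intro κ' _ h
      rw [if_neg, mul_zero]
      rintro ⟨h1, _⟩
      exact h (Fin.ext h1.symm)
    · exact fun h => absurd (Finset.mem_univ _) h
  rw [hR]
  unfold treeVec
  rw [sum_mag_succ, Finset.sum_comm]
  refine Finset.sum_congr rfl fun κ _ => ?_
  simp only [Fin.cons_zero, ← Fin.succ_last, Fin.cons_succ, Fin.prod_univ_succ, Fin.castSucc_zero,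
    ← Fin.succ_castSucc]
  -- Here `k` is any natural number; above `s 0` no root index matches it and the Clebsch-Gordan
  -- coefficients vanish too.
  by_cases hk : k < s 0 + 1
  · rw [Finset.sum_eq_single ⟨k, hk⟩]
    · simp
    · intro κ₀ _ h
      rw [if_neg]
      rintro ⟨h1, _⟩
      exact h (Fin.ext h1)
    · simp
  · rw [clebschGordan_eq_zero_of_lt (by omega)]
    simp only [Complex.ofReal_zero, zero_mul, ite_self]
    refine Finset.sum_eq_zero fun κ₀ _ => ?_
    rw [if_neg]
    rintro ⟨h1, _⟩
    omega

theorem isPath_succ {n : ℕ} {a s : Fin (n + 2) → ℕ} : IsPath a s ↔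
    Triangle (s (Fin.succ 0)) (a 0) (s 0) ∧ IsPath (fun i => a i.succ) (fun i => s i.succ) := by
  simp only [IsPath, Fin.forall_fin_succ (n := n), Fin.succ_last, Fin.castSucc_zero,
    ← Fin.succ_castSucc]
  tauto

/-- Iterating one triangle inequality along the tree shows that the finite box in `paths` and
`allPaths` excludes no path. -/
theorem IsPath.le_sum {n : ℕ} {a s : Fin (n + 1) → ℕ} (h : IsPath a s) (i : Fin (n + 1)) :
    s i ≤ ∑ I, a I := by
  induction n with
  | zero =>
    rw [fin_one_eq i (Fin.last 0), h.1]
    simp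
  | succ n ih =>
    obtain ⟨hT, hP⟩ := isPath_succ.mp h
    rw [Fin.sum_univ_succ]
    refine Fin.cases ?_ (fun i => ?_) i
    · have := ih hP 0
      have := hT.1
      omega
    · have := ih hP i
      omega

/-- All admissible recoupling spins of a tree. -/
def allPaths {n : ℕ} (a : Fin (n + 1) → ℕ) : Finset (Fin (n + 1) → ℕ) :=
  (Fintype.piFinset fun _ => Finset.range (∑ I, a I + 1)).filter (IsPath a)

theorem mem_allPaths {n : ℕ} {a s : Fin (n + 1) → ℕ} : s ∈ allPaths a ↔ IsPath a s := by
  simp only [allPaths, Finset.mem_filter, Fintype.mem_piFinset, Finset.mem_range,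
    and_iff_right_iff_imp]
  exact fun h i => Nat.lt_succ_of_le (h.le_sum i)

theorem mem_paths {p : ℕ} {a s : Fin (p + 2) → ℕ} {j : ℕ} :
    s ∈ paths a j ↔ s 0 = j ∧ IsPath a s := by
  simp only [paths, Finset.mem_filter, Fintype.mem_piFinset, Finset.mem_range]
  constructor
  · rintro ⟨_, h0, h1, h2⟩
    exact ⟨h0, h1, h2⟩
  · rintro ⟨h0, h⟩
    exact ⟨fun i => Nat.lt_succ_of_le (h.le_sum i), h0, h.1, h.2⟩

theorem sum_allPaths_succ {n : ℕ} (a : Fin (n + 2) → ℕ) (F : (Fin (n + 2) → ℕ) → ℂ) :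
    ∑ s ∈ allPaths a, F s = ∑ t ∈ allPaths (fun i => a i.succ),
      ∑ c ∈ (Finset.range (t 0 + a 0 + 1)).filter (Triangle (t 0) (a 0)),
        F (Fin.cons (α := fun _ => ℕ) c t) := by
  rw [Finset.sum_sigma']
  refine Finset.sum_bij' (fun s _ => ⟨fun i => s i.succ, s 0⟩)
    (fun x _ => Fin.cons (α := fun _ => ℕ) x.2 x.1) ?_ ?_ ?_ ?_ ?_
  · intro s hs
    obtain ⟨hT, hP⟩ := isPath_succ.mp (mem_allPaths.mp hs)
    simp only [Finset.mem_sigma, mem_allPaths, Finset.mem_filter, Finset.mem_range]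
    exact ⟨hP, Nat.lt_succ_of_le hT.1, hT⟩
  · rintro ⟨t, c⟩ h
    simp only [Finset.mem_sigma, mem_allPaths, Finset.mem_filter, Finset.mem_range] at h
    rw [mem_allPaths, isPath_succ]
    simp only [Fin.cons_succ, Fin.cons_zero]
    exact ⟨h.2.2, h.1⟩
  · intro s _
    exact Fin.cons_self_tail s
  · rintro ⟨t, c⟩ _
    simp
  · intro s _
    congr 1
    exact (Fin.cons_self_tail s).symm

theorem sum_mul_sum_mul_eq {κ κ' μ ν : Type*} [Fintype κ] [Fintype κ'] [Fintype μ]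
    [Fintype ν] (C : κ → μ → ℂ) (C' : κ' → μ → ℂ) (R : κ → ν → ℂ) (R' : κ' → ν → ℂ) :
    ∑ x, ∑ y, (∑ i, C i x * R i y) * (∑ j, C' j x * R' j y) =
      ∑ i, ∑ j, (∑ x, C i x * C' j x) * ∑ y, R i y * R' j y := by
  simp only [Finset.sum_mul_sum]
  have h : ∀ f : μ → ν → κ → κ' → ℂ, ∑ x, ∑ y, ∑ i, ∑ j, f x y i j =
      ∑ i, ∑ j, ∑ x, ∑ y, f x y i j := by
    intro f
    calc ∑ x, ∑ y, ∑ i, ∑ j, f x y i j = ∑ x, ∑ i, ∑ y, ∑ j, f x y i j :=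
          Finset.sum_congr rfl fun x _ => Finset.sum_comm
      _ = ∑ i, ∑ x, ∑ y, ∑ j, f x y i j := Finset.sum_comm
      _ = ∑ i, ∑ x, ∑ j, ∑ y, f x y i j :=
          Finset.sum_congr rfl fun i _ => Finset.sum_congr rfl fun x _ => Finset.sum_comm
      _ = _ := Finset.sum_congr rfl fun i _ => Finset.sum_comm
  rw [h]
  refine Finset.sum_congr rfl fun i _ => Finset.sum_congr rfl fun j _ =>
    Finset.sum_congr rfl fun x _ => Finset.sum_congr rfl fun y _ => ?_
  ring

/-- By induction the inner trees contract to `δ`, which identifies the inner paths and the line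
entering the root; orthonormality at the root vertex then identifies the remaining spin and magnetic
index. -/
theorem treeVec_orthonormal {n : ℕ} {a s s' : Fin (n + 1) → ℕ} (hs : IsPath a s)
    (hs' : IsPath a s') (k : Fin (s 0 + 1)) (k' : Fin (s' 0 + 1)) :
    ∑ x, treeVec a s k x * treeVec a s' k' x = if s = s' ∧ (k : ℕ) = k' then 1 else 0 := by
  induction n with
  | zero =>
    have h : s 0 = a 0 := hs.1
    have h' : s' 0 = a 0 := hs'.1
    have hss : s = s' := funext fun i => by rw [fin_one_eq i 0, h, h']
    rw [sum_mag_one]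
    simp only [treeVec_zero h', hss, true_and]
    rw [Finset.sum_eq_single (⟨k, by rw [← h]; exact k.2⟩ : Fin (a 0 + 1))]
    · simp [eq_comm]
    · intro x _ hx
      rw [if_neg, zero_mul]
      intro h1
      exact hx (Fin.ext h1.symm)
    · simp
  | succ n ih =>
    obtain ⟨hT, hP⟩ := isPath_succ.mp hs
    obtain ⟨hT', hP'⟩ := isPath_succ.mp hs'
    rw [sum_mag_succ]
    simp only [treeVec_succ, Fin.cons_zero, Fin.cons_succ]
    rw [sum_mul_sum_mul_eq (C := fun (κ : Fin (s (Fin.succ 0) + 1)) (x : Fin (a 0 + 1)) =>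
        (clebschGordan (s (Fin.succ 0)) (a 0) (s 0) κ x k : ℂ))
      (C' := fun (κ : Fin (s' (Fin.succ 0) + 1)) (x : Fin (a 0 + 1)) =>
        (clebschGordan (s' (Fin.succ 0)) (a 0) (s' 0) κ x k' : ℂ))
      (R := fun κ x => treeVec (fun i => a i.succ) (fun i => s i.succ) κ x)
      (R' := fun κ x => treeVec (fun i => a i.succ) (fun i => s' i.succ) κ x)]
    simp only [ih hP hP']
    by_cases h : (fun i : Fin (n + 1) => s i.succ) = fun i => s' i.succ
    -- With equal inner paths, `s'` can differ from `s` only in its root spin.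
    · obtain ⟨c', rfl⟩ : ∃ c', s' = Fin.cons (α := fun _ => ℕ) c' (fun i => s i.succ) :=
        ⟨s' 0, by rw [h]; exact (Fin.cons_self_tail s').symm⟩
      simp only [Fin.cons_succ, Fin.cons_zero, true_and] at *
      have key := clebschGordan_orthonormal hT k k'
      have hss : s = Fin.cons (α := fun _ => ℕ) c' (fun i => s i.succ) ↔ s 0 = c' := by
        constructor
        · intro h; rw [h]; rfl
        · intro h; rw [← h]; exact (Fin.cons_self_tail s).symm
      simp only [hss]
      refine Eq.trans ?_ key
      refine Finset.sum_congr rfl fun κ _ => ?_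
      refine (Finset.sum_eq_single κ ?_ ?_).trans ?_
      · intro κ' _ hκ
        rw [if_neg, mul_zero]
        exact fun h => hκ (Fin.ext h.symm)
      · exact fun h => absurd (Finset.mem_univ _) h
      · rw [if_pos rfl, mul_one]
        rfl
    · have hss : s ≠ s' := fun h' => h (by rw [h'])
      simp [h, hss]

/-- The root spin and its magnetic index are summed first. Clebsch-Gordan completeness then frees
the root leg and leaves the completeness relation of the inner tree. -/
theorem treeVec_complete {n : ℕ} (a : Fin (n + 1) → ℕ) (x y : Mag a) :
    ∑ s ∈ allPaths a, ∑ k : Fin (s 0 + 1), treeVec a s k x * treeVec a s k y =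
      if x = y then 1 else 0 := by
  induction n with
  | zero =>
    have hall : allPaths a = {a} := by
      ext s
      rw [mem_allPaths, Finset.mem_singleton]
      constructor
      · intro h
        funext i
        rw [fin_one_eq i (Fin.last 0), h.1]
      · rintro rfl
        exact ⟨rfl, fun i => i.elim0⟩
    rw [hall, Finset.sum_singleton]
    simp only [treeVec_zero (rfl : a 0 = a 0)]
    rw [Finset.sum_eq_single (x 0)]
    · have : x = y ↔ ((x 0 : Fin _) : ℕ) = y 0 := by
        rw [← Fin.ext_iff]
        constructor
        · rintro rfl; rfl
        · intro h; funext i; rw [fin_one_eq i 0, h]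
      simp [this]
    · intro k _ hk
      rw [if_neg, zero_mul]
      exact fun h => hk (Fin.ext h)
    · simp
  | succ n ih =>
    rw [sum_allPaths_succ]
    have hxy : x = y ↔ x 0 = y 0 ∧ (fun i : Fin (n + 1) => x i.succ) = fun i : Fin (n + 1) => y i.succ := by
      constructor
      · rintro rfl; exact ⟨rfl, rfl⟩
      · rintro ⟨h0, h1⟩
        funext i
        refine Fin.cases h0 (fun i => congrFun h1 i) i
    have key : ∀ t ∈ allPaths (fun i : Fin (n + 1) => a i.succ),
        ∑ c ∈ (Finset.range (t 0 + a 0 + 1)).filter (Triangle (t 0) (a 0)),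
          ∑ k : Fin (c + 1), treeVec a (Fin.cons (α := fun _ => ℕ) c t) k x *
            treeVec a (Fin.cons (α := fun _ => ℕ) c t) k y =
        (if x 0 = y 0 then 1 else 0) * ∑ k : Fin (t 0 + 1),
          treeVec (fun i : Fin (n + 1) => a i.succ) t k (fun i : Fin (n + 1) => x i.succ) *
            treeVec (fun i : Fin (n + 1) => a i.succ) t k (fun i : Fin (n + 1) => y i.succ) := by
      intro t _
      simp only [treeVec_succ, Fin.cons_succ, Fin.cons_zero, Finset.sum_mul_sum]
      have hc : ∀ κ κ' : Fin (t 0 + 1),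
          ∑ c ∈ (Finset.range (t 0 + a 0 + 1)).filter (Triangle (t 0) (a 0)), ∑ k : Fin (c + 1),
            (clebschGordan (t 0) (a 0) c κ (x 0) k : ℂ) *
              (clebschGordan (t 0) (a 0) c κ' (y 0) k : ℂ) = if κ = κ' ∧ x 0 = y 0 then 1 else 0 :=
        fun κ κ' => clebschGordan_complete _ _ _ _ _ _
      have hswap : ∀ f : ℕ → ℕ → Fin (t 0 + 1) → Fin (t 0 + 1) → ℂ,
          ∑ c ∈ (Finset.range (t 0 + a 0 + 1)).filter (Triangle (t 0) (a 0)), ∑ k : Fin (c + 1),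
            ∑ i, ∑ j, f c k i j = ∑ i, ∑ j,
          ∑ c ∈ (Finset.range (t 0 + a 0 + 1)).filter (Triangle (t 0) (a 0)), ∑ k : Fin (c + 1),
            f c k i j := by
        intro f
        rw [Finset.sum_congr rfl fun c _ => Finset.sum_comm, Finset.sum_comm]
        refine Finset.sum_congr rfl fun i _ => ?_
        rw [Finset.sum_congr rfl fun c _ => Finset.sum_comm, Finset.sum_comm]
      refine (hswap (fun c k i j => (clebschGordan (t 0) (a 0) c i (x 0) k : ℂ) *
        treeVec (fun i : Fin (n + 1) => a i.succ) t i (fun i : Fin (n + 1) => x i.succ) *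
        ((clebschGordan (t 0) (a 0) c j (y 0) k : ℂ) *
        treeVec (fun i : Fin (n + 1) => a i.succ) t j (fun i : Fin (n + 1) => y i.succ)))).trans ?_
      rw [Finset.mul_sum]
      refine Finset.sum_congr rfl fun κ _ => ?_
      rw [Finset.sum_eq_single κ]
      · have := hc κ κ
        simp only [true_and] at this
        rw [← this]
        simp only [Finset.sum_mul]
        refine Finset.sum_congr rfl fun c _ => Finset.sum_congr rfl fun k _ => ?_
        ring
      · intro κ' _ hκ
        have := hc κ κ'
        rw [if_neg (fun h => hκ h.1.symm)] at this
        rw [← zero_mul (treeVec (fun i : Fin (n + 1) => a i.succ) t κ (fun i : Fin (n + 1) => x i.succ) *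
          treeVec (fun i : Fin (n + 1) => a i.succ) t κ' (fun i : Fin (n + 1) => y i.succ)), ← this]
        simp only [Finset.sum_mul]
        refine Finset.sum_congr rfl fun c _ => Finset.sum_congr rfl fun k _ => ?_
        ring
      · simp
    refine (Finset.sum_congr rfl key).trans ?_
    rw [← Finset.mul_sum, ih]
    by_cases h0 : x 0 = y 0 <;> simp [hxy, h0]

/-- The action of `g` on the tensor product of the spin representations. -/
def tensorD {N : ℕ} (a : Fin N → ℕ) (g : SU2) : Matrix (Mag a) (Mag a) ℂ := fun x y =>
  ∏ I, wignerD (a I) g (x I) (y I)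

/-- The inner tree converts the action on its legs into one Wigner matrix on the line entering the
root, and the root vertex intertwines this with the action on leg `0`. -/
theorem treeVec_covariant {n : ℕ} {a s : Fin (n + 1) → ℕ} (hs : IsPath a s) (g : SU2)
    (k : Fin (s 0 + 1)) (y : Mag a) :
    ∑ x, treeVec a s k x * tensorD a g x y =
      ∑ k' : Fin (s 0 + 1), wignerD (s 0) g k k' * treeVec a s k' y := by
  induction n with
  | zero =>
    have h : s = a := funext fun i => by rw [fin_one_eq i (Fin.last 0), hs.1]
    subst h
    rw [sum_mag_one]
    simp only [treeVec_zero (rfl : s 0 = s 0)]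
    rw [Finset.sum_eq_single k, Finset.sum_eq_single (y 0)]
    · simp [tensorD]
    · intro k' _ hk
      rw [if_neg, mul_zero]
      exact fun h => hk (Fin.ext h)
    · simp
    · intro x _ hx
      rw [if_neg, zero_mul]
      exact fun h => hx (Fin.ext h.symm)
    · simp
  | succ n ih =>
    obtain ⟨hT, hP⟩ := isPath_succ.mp hs
    rw [sum_mag_succ]
    have hD : ∀ (x₀ : Fin (a 0 + 1)) (x : Mag fun i => a i.succ),
        tensorD a g (Fin.cons (α := fun i => Fin (a i + 1)) x₀ x) y =
          wignerD (a 0) g x₀ (y 0) * tensorD (fun i => a i.succ) g x (fun i => y i.succ) := by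
      intro x₀ x
      simp only [tensorD, Fin.prod_univ_succ, Fin.cons_zero, Fin.cons_succ]
    simp only [treeVec_succ a s, Fin.cons_zero, Fin.cons_succ, hD]
    calc _ = ∑ κ : Fin (s (Fin.succ 0) + 1), ∑ x₀ : Fin (a 0 + 1),
          (clebschGordan (s (Fin.succ 0)) (a 0) (s 0) κ x₀ k : ℂ) * wignerD (a 0) g x₀ (y 0) *
          ∑ x : Mag fun i => a i.succ, treeVec (fun i => a i.succ) (fun i => s i.succ) κ x *
            tensorD (fun i => a i.succ) g x (fun i => y i.succ) := by
          simp only [Finset.mul_sum, Finset.sum_mul]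
          symm
          rw [Finset.sum_comm]
          refine Finset.sum_congr rfl fun x₀ _ => ?_
          rw [Finset.sum_comm]
          refine Finset.sum_congr rfl fun x _ => Finset.sum_congr rfl fun κ _ => ?_
          ring
      _ = ∑ κ' : Fin (s (Fin.succ 0) + 1), (∑ κ : Fin (s (Fin.succ 0) + 1), ∑ x₀ : Fin (a 0 + 1),
          (clebschGordan (s (Fin.succ 0)) (a 0) (s 0) κ x₀ k : ℂ) *
            (wignerD (s (Fin.succ 0)) g κ κ' * wignerD (a 0) g x₀ (y 0))) *
            treeVec (fun i => a i.succ) (fun i => s i.succ) κ' (fun i => y i.succ) := by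
          simp only [ih hP, Finset.mul_sum, Finset.sum_mul]
          symm
          rw [Finset.sum_comm]
          refine Finset.sum_congr rfl fun κ _ => ?_
          rw [Finset.sum_comm]
          refine Finset.sum_congr rfl fun x₀ _ => Finset.sum_congr rfl fun κ' _ => ?_
          ring
      _ = _ := by
          simp only [clebschGordan_intertwines, Finset.sum_mul, Finset.mul_sum]
          rw [Finset.sum_comm]
          refine Finset.sum_congr rfl fun κ _ => Finset.sum_congr rfl fun x₀ _ => ?_
          ring

/-! ## Amplitudes of product states on recoupling trees -/

theorem continuous_ketAct {d : ℕ} (ψ : Fin (d + 1) → ℂ) (x : Fin (d + 1)) :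
    Continuous fun g => ketAct g ψ x := by
  simp only [ketAct, Matrix.mulVec, dotProduct]
  exact continuous_finsetSum _ fun y _ => (continuous_wignerD d x y).mul continuous_const

theorem continuous_wignerD_inv (d : ℕ) (k l : Fin (d + 1)) :
    Continuous fun g => wignerD d g⁻¹ k l :=
  (continuous_wignerD d k l).comp continuous_inv

theorem braAct_eq {d : ℕ} (g : SU2) (ψ : Fin (d + 1) → ℂ) (x : Fin (d + 1)) :
    braAct g ψ x = star (ketAct g ψ x) := by
  unfold braAct ketAct
  rw [wignerD_inv, ← Matrix.star_mulVec]
  rfl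

theorem integral_star (f : SU2 → ℂ) : ∫ g, star (f g) ∂haarSU2 = star (∫ g, f g ∂haarSU2) :=
  integral_conj

theorem star_treeVec {n : ℕ} (a s : Fin (n + 1) → ℕ) (k : ℕ) (m : Mag a) :
    star (treeVec a s k m) = treeVec a s k m := by
  simp only [treeVec, star_sum]
  refine Finset.sum_congr rfl fun κ _ => ?_
  split_ifs
  · rw [star_prod]
    exact Finset.prod_congr rfl fun i _ => Complex.conj_ofReal _
  · exact star_zero _

/-- The pairing of a recoupled vector with a product state. -/
def treeAmp {n : ℕ} (a : Fin (n + 1) → ℕ) (ψ : (I : Fin (n + 1)) → Fin (a I + 1) → ℂ)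
    (s : Fin (n + 1) → ℕ) (k : ℕ) : ℂ :=
  ∑ x : Mag a, treeVec a s k x * ∏ I, ψ I (x I)

theorem prod_ketAct {N : ℕ} (a : Fin N → ℕ) (ψ : (I : Fin N) → Fin (a I + 1) → ℂ) (g : SU2)
    (x : Mag a) :
    ∏ I, ketAct g (ψ I) (x I) = ∑ y : Mag a, tensorD a g x y * ∏ I, ψ I (y I) := by
  simp only [ketAct, Matrix.mulVec, dotProduct, tensorD, ← Finset.prod_mul_distrib]
  rw [Finset.prod_univ_sum, Fintype.piFinset_univ]

/-- After insertion of the tree completeness relation, covariance moves `g` from all legs to the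
root. The dependence on `g` becomes linear in single Wigner matrix elements. -/
theorem prod_ketAct_expansion {n : ℕ} (a : Fin (n + 1) → ℕ)
    (ψ : (I : Fin (n + 1)) → Fin (a I + 1) → ℂ) (g : SU2) (x : Mag a) :
    ∏ I, ketAct g (ψ I) (x I) = ∑ s ∈ allPaths a, ∑ k : Fin (s 0 + 1), ∑ l : Fin (s 0 + 1),
      treeVec a s k x * treeAmp a ψ s l * wignerD (s 0) g k l := by
  have h1 : ∏ I, ketAct g (ψ I) (x I) = ∑ y : Mag a, (∑ s ∈ allPaths a, ∑ k : Fin (s 0 + 1),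
      treeVec a s k x * treeVec a s k y) * ∏ I, ketAct g (ψ I) (y I) := by
    simp only [treeVec_complete]
    simp
  rw [h1]
  simp only [Finset.sum_mul]
  rw [Finset.sum_comm]
  refine Finset.sum_congr rfl fun s hs => ?_
  rw [Finset.sum_comm]
  refine Finset.sum_congr rfl fun k _ => ?_
  simp only [prod_ketAct, Finset.mul_sum]
  rw [Finset.sum_comm]
  have h2 : ∀ z : Mag a, ∑ y : Mag a, treeVec a s k x * treeVec a s k y *
      (tensorD a g y z * ∏ I, ψ I (z I)) = treeVec a s k x * (∑ l : Fin (s 0 + 1),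
        wignerD (s 0) g k l * treeVec a s l z) * ∏ I, ψ I (z I) := by
    intro z
    rw [← treeVec_covariant (mem_allPaths.mp hs), Finset.mul_sum, Finset.sum_mul]
    exact Finset.sum_congr rfl fun y _ => by ring
  simp only [h2, treeAmp, Finset.mul_sum, Finset.sum_mul]
  rw [Finset.sum_comm]
  exact Finset.sum_congr rfl fun l _ => Finset.sum_congr rfl fun z _ => by ring

theorem sum_ite_match {n j : ℕ} (F : ℕ → ℕ → ℂ) (c : ℂ) (k m : Fin (j + 1)) :
    ∑ k' : Fin (n + 1), ∑ l : Fin (n + 1), F k' l *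
      (if n = j ∧ (k' : ℕ) = k ∧ (l : ℕ) = m then c else 0) =
      if n = j then F k m * c else 0 := by
  by_cases h : n = j
  · subst h
    rw [Finset.sum_eq_single k, Finset.sum_eq_single m]
    · simp
    · intro l _ hl
      rw [if_neg, mul_zero]
      exact fun h => hl (Fin.ext h.2.2)
    · simp
    · intro k' _ hk
      refine Finset.sum_eq_zero fun l _ => ?_
      rw [if_neg, mul_zero]
      exact fun h => hk (Fin.ext h.2.1)
    · simp
  · simp [h]

theorem paths_eq_filter {p : ℕ} (a : Fin (p + 2) → ℕ) (j : ℕ) :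
    paths a j = (allPaths a).filter fun s => s 0 = j := by
  ext s
  rw [mem_paths, Finset.mem_filter, mem_allPaths, and_comm]

/-- Schur orthogonality selects the trees with root spin `j` and fixes both root indices. The
integral is a component of `ketPart`. -/
theorem integral_prod_ketAct {p : ℕ} (a : Fin (p + 2) → ℕ)
    (ψ : (I : Fin (p + 2)) → Fin (a I + 1) → ℂ) (j : ℕ) (m k : Fin (j + 1)) (x : Mag a) :
    ∫ g : SU2, (∏ I, ketAct g (ψ I) (x I)) * star (wignerD j g k m) ∂haarSU2 =
      ∑ s ∈ paths a j, treeVec a s k x * treeAmp a ψ s m * ((j : ℂ) + 1)⁻¹ := by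
  simp only [prod_ketAct_expansion, Finset.sum_mul, mul_assoc]
  have hint : ∀ (s : Fin (p + 2) → ℕ) (k' l : Fin (s 0 + 1)), Integrable (fun g =>
      treeVec a s k' x * (treeAmp a ψ s l * (wignerD (s 0) g k' l * star (wignerD j g k m))))
      haarSU2 := fun s k' l =>
    ((integrable_wignerD_mul_star k' l k m).const_mul _).const_mul _
  rw [integral_finsetSum _ fun s _ => integrable_finsetSum _ fun k' _ =>
    integrable_finsetSum _ fun l _ => hint s k' l, paths_eq_filter, Finset.sum_filter]
  refine Finset.sum_congr rfl fun s _ => ?_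
  rw [integral_finsetSum _ fun k' _ => integrable_finsetSum _ fun l _ => hint s k' l]
  have h : ∀ k' : Fin (s 0 + 1), ∫ g, ∑ l : Fin (s 0 + 1), treeVec a s k' x * (treeAmp a ψ s l *
      (wignerD (s 0) g k' l * star (wignerD j g k m))) ∂haarSU2 =
      ∑ l : Fin (s 0 + 1), treeVec a s k' x * treeAmp a ψ s l *
        (if s 0 = j ∧ (k' : ℕ) = k ∧ (l : ℕ) = m then ((s 0 : ℂ) + 1)⁻¹ else 0) := by
    intro k'
    rw [integral_finsetSum _ fun l _ => hint s k' l]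
    refine Finset.sum_congr rfl fun l _ => ?_
    rw [integral_const_mul, integral_const_mul, haar_orthogonality, mul_assoc]
  simp only [h]
  rw [sum_ite_match (fun k' l => treeVec a s k' x * treeAmp a ψ s l)]
  by_cases hj : s 0 = j
  · rw [if_pos hj, if_pos hj, hj]; ring
  · rw [if_neg hj, if_neg hj]

theorem sum_allPaths_eq {p : ℕ} (a : Fin (p + 2) → ℕ) (J : Finset ℕ) (F : (Fin (p + 2) → ℕ) → ℂ)
    (h : ∀ s ∈ allPaths a, s 0 ∉ J → F s = 0) :
    ∑ s ∈ allPaths a, F s = ∑ j ∈ J, ∑ s ∈ paths a j, F s := by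
  rw [← Finset.sum_filter_of_ne (p := fun s => s 0 ∈ J)
    (fun s hs hF => by_contra fun hJ => hF (h s hs hJ)),
    ← Finset.sum_fiberwise_of_maps_to (g := fun s : Fin (p + 2) → ℕ => s 0) (t := J)
      (s := (allPaths a).filter fun s => s 0 ∈ J) (fun s hs => (Finset.mem_filter.mp hs).2)]
  refine Finset.sum_congr rfl fun j hj => Finset.sum_congr ?_ fun _ _ => rfl
  rw [paths_eq_filter, Finset.filter_filter]
  refine Finset.filter_congr fun s _ => ?_
  constructor
  · exact fun h => h.2
  · exact fun h => ⟨h ▸ hj, h⟩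

theorem paths_eq_empty {p : ℕ} (a : Fin (p + 2) → ℕ) {j : ℕ} (hj : j ∉ centralSpins a) :
    paths a j = ∅ := by
  refine Finset.eq_empty_of_forall_notMem fun s hs => hj ?_
  obtain ⟨h0, h⟩ := mem_paths.mp hs
  rw [centralSpins, Finset.mem_range, ← h0]
  exact Nat.lt_succ_of_le (h.le_sum 0)

/-- Only the bra factor is expanded in trees; each resulting term is an integral of the preceding
kind. -/
theorem integral_prod_ketAct_mul_star {p q : ℕ} (a : Fin (p + 2) → ℕ) (b : Fin (q + 2) → ℕ)
    (ψ : (I : Fin (p + 2)) → Fin (a I + 1) → ℂ) (φ : (J : Fin (q + 2)) → Fin (b J + 1) → ℂ)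
    (x : Mag a) (y : Mag b) :
    ∫ g : SU2, (∏ I, ketAct g (ψ I) (x I)) * star (∏ J, ketAct g (φ J) (y J)) ∂haarSU2 =
      ∑ j ∈ centralSpins a, ∑ s ∈ paths a j, ∑ s' ∈ paths b j, ((j : ℂ) + 1)⁻¹ *
        (∑ m : Fin (j + 1), treeAmp a ψ s m * star (treeAmp b φ s' m)) *
        ∑ k : Fin (j + 1), treeVec a s k x * treeVec b s' k y := by
  simp only [prod_ketAct_expansion b, star_sum, star_mul', star_treeVec, Finset.mul_sum]
  have hint : ∀ (s : Fin (q + 2) → ℕ) (k l : Fin (s 0 + 1)), Integrable (fun g =>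
      (∏ I, ketAct g (ψ I) (x I)) * (treeVec b s k y * star (treeAmp b φ s l) *
        star (wignerD (s 0) g k l))) haarSU2 := fun s k l =>
    integrable_haar ((continuous_finsetProd _ fun I _ => continuous_ketAct _ _).mul
      (continuous_const.mul (continuous_star.comp (continuous_wignerD _ _ _))))
  rw [integral_finsetSum _ fun s _ => integrable_finsetSum _ fun k _ =>
    integrable_finsetSum _ fun l _ => hint s k l]
  have h : ∀ s : Fin (q + 2) → ℕ, ∫ g, ∑ k : Fin (s 0 + 1), ∑ l : Fin (s 0 + 1),
      (∏ I, ketAct g (ψ I) (x I)) * (treeVec b s k y * star (treeAmp b φ s l) *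
        star (wignerD (s 0) g k l)) ∂haarSU2 = ∑ k : Fin (s 0 + 1), ∑ l : Fin (s 0 + 1),
      treeVec b s k y * star (treeAmp b φ s l) *
        ∑ t ∈ paths a (s 0), treeVec a t k x * treeAmp a ψ t l * ((s 0 : ℂ) + 1)⁻¹ := by
    intro s
    rw [integral_finsetSum _ fun k _ => integrable_finsetSum _ fun l _ => hint s k l]
    refine Finset.sum_congr rfl fun k _ => ?_
    rw [integral_finsetSum _ fun l _ => hint s k l]
    refine Finset.sum_congr rfl fun l _ => ?_
    rw [← integral_prod_ketAct, ← integral_const_mul]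
    congr 1; funext g; ring
  simp only [h]
  rw [sum_allPaths_eq b (centralSpins a)]
  · refine Finset.sum_congr rfl fun j _ => ?_
    rw [Finset.sum_comm]
    refine Finset.sum_congr rfl fun s' hs' => ?_
    obtain ⟨rfl, _⟩ := mem_paths.mp hs'
    simp only [Finset.mul_sum, Finset.sum_mul]
    rw [Finset.sum_congr rfl fun k _ => Finset.sum_comm, Finset.sum_comm]
    refine Finset.sum_congr rfl fun s _ => ?_
    refine Finset.sum_congr rfl fun k _ => Finset.sum_congr rfl fun m _ => ?_
    ring
  -- An out-going tree whose root spin is not a central spin of `a` meets no in-going path, so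
  -- regrouping by `centralSpins a` loses nothing.
  · intro s _ hs
    simp [paths_eq_empty a hs]

/-! ## The expansion coefficients -/

/-- The coupling of two vectors to spin `j`. -/
def couple {d e : ℕ} (ψ : Fin (d + 1) → ℂ) (φ : Fin (e + 1) → ℂ) (c k : ℕ) : ℂ :=
  ∑ x : Fin (d + 1), ∑ y : Fin (e + 1), (clebschGordan d e c x y k : ℂ) * (ψ x * φ y)

theorem couple_ketAct {d e : ℕ} (ψ : Fin (d + 1) → ℂ) (φ : Fin (e + 1) → ℂ) (c : ℕ) (g : SU2)
    (k : Fin (c + 1)) :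
    couple (ketAct g ψ) (ketAct g φ) c k = ∑ l : Fin (c + 1), wignerD c g k l * couple ψ φ c l := by
  simp only [couple, ketAct, Matrix.mulVec, dotProduct]
  simp only [Finset.sum_mul_sum]
  simp only [Finset.mul_sum]
  calc _ = ∑ x : Fin (d + 1), ∑ y : Fin (e + 1), (∑ x' : Fin (d + 1), ∑ y' : Fin (e + 1),
        (clebschGordan d e c x' y' k : ℂ) * (wignerD d g x' x * wignerD e g y' y)) *
          (ψ x * φ y) := by
        simp only [Finset.sum_mul]
        have h : ∀ f : Fin (d + 1) → Fin (e + 1) → Fin (d + 1) → Fin (e + 1) → ℂ,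
            ∑ x, ∑ y, ∑ i, ∑ j, f x y i j = ∑ i, ∑ j, ∑ x, ∑ y, f x y i j := by
          intro f
          rw [Finset.sum_congr rfl fun x _ => Finset.sum_comm, Finset.sum_comm]
          refine Finset.sum_congr rfl fun i _ => ?_
          rw [Finset.sum_congr rfl fun x _ => Finset.sum_comm, Finset.sum_comm]
        rw [h]
        refine Finset.sum_congr rfl fun x _ => Finset.sum_congr rfl fun y _ =>
          Finset.sum_congr rfl fun i _ => Finset.sum_congr rfl fun j _ => ?_
        ring
    _ = _ := by
        simp only [clebschGordan_intertwines, Finset.sum_mul]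
        rw [Finset.sum_congr rfl fun x _ => Finset.sum_comm, Finset.sum_comm]
        refine Finset.sum_congr rfl fun l _ => Finset.sum_congr rfl fun x _ =>
          Finset.sum_congr rfl fun y _ => ?_
        ring

theorem sum_mul_integral {κ μ ν : Type*} [Fintype κ] [Fintype μ] [Fintype ν] (c : κ → μ → ν → ℂ)
    (f : κ → μ → ν → SU2 → ℂ) (hf : ∀ k x y, Continuous (f k x y)) :
    ∑ k, ∑ x, ∑ y, c k x y * ∫ g, f k x y g ∂haarSU2 =
      ∫ g, ∑ k, ∑ x, ∑ y, c k x y * f k x y g ∂haarSU2 := by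
  have hint : ∀ k x y, Integrable (fun g => c k x y * f k x y g) haarSU2 := fun k x y =>
    (integrable_haar (hf k x y)).const_mul _
  rw [integral_finsetSum _ fun k _ => integrable_finsetSum _ fun x _ =>
    integrable_finsetSum _ fun y _ => hint k x y]
  refine Finset.sum_congr rfl fun k _ => ?_
  rw [integral_finsetSum _ fun x _ => integrable_finsetSum _ fun y _ => hint k x y]
  refine Finset.sum_congr rfl fun x _ => ?_
  rw [integral_finsetSum _ fun y _ => hint k x y]
  exact Finset.sum_congr rfl fun y _ => (integral_const_mul _ _).symm

/-- By covariance of the coupling, the factor `g` produced by the two legs is undone by `g⁻¹` on the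
coupled line. The summed integrand is constant, and the Haar measure has mass one. -/
theorem endCoeff_eq {d e : ℕ} (ψ : Fin (d + 1) → ℂ) (φ : Fin (e + 1) → ℂ) (c : ℕ)
    (μ : Fin (c + 1)) : endCoeff ψ φ c μ = couple ψ φ c μ := by
  unfold endCoeff
  rw [sum_mul_integral (fun (k : Fin (c + 1)) (x : Fin (d + 1)) (y : Fin (e + 1)) =>
      (clebschGordan d e c x y k : ℂ)) (fun k x y g => ketAct g ψ x * ketAct g φ y * wignerD c g⁻¹ μ k)
    (fun k x y => ((continuous_ketAct _ _).mul (continuous_ketAct _ _)).mul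
      (continuous_wignerD_inv _ _ _))]
  have h : ∀ g, ∑ k : Fin (c + 1), ∑ x : Fin (d + 1), ∑ y : Fin (e + 1),
      (clebschGordan d e c x y k : ℂ) * (ketAct g ψ x * ketAct g φ y * wignerD c g⁻¹ μ k) =
      couple ψ φ c μ := by
    intro g
    have h1 : ∀ k : Fin (c + 1), ∑ x : Fin (d + 1), ∑ y : Fin (e + 1),
      (clebschGordan d e c x y k : ℂ) * (ketAct g ψ x * ketAct g φ y * wignerD c g⁻¹ μ k) =
      wignerD c g⁻¹ μ k * couple (ketAct g ψ) (ketAct g φ) c k := by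
      intro k
      simp only [couple, Finset.mul_sum]
      exact Finset.sum_congr rfl fun x _ => Finset.sum_congr rfl fun y _ => by ring
    simp only [h1, couple_ketAct]
    change (wignerD c g⁻¹ *ᵥ (wignerD c g *ᵥ fun l => couple ψ φ c l)) μ = _
    rw [Matrix.mulVec_mulVec, wignerD_inv_mul, Matrix.one_mulVec]
  simp only [h, integral_const, probReal_univ, one_smul]

/-- An internal line with magnetic index `ν` behaves as a leg in the basis state `ν`, so this vertex
is a special case of the end vertex. -/
theorem midCoeff_eq {e : ℕ} (ψ : Fin (e + 1) → ℂ) (d c : ℕ) (ν : Fin (d + 1)) (μ : Fin (c + 1)) :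
    midCoeff ψ d c ν μ = ∑ y : Fin (e + 1), (clebschGordan d e c ν y μ : ℂ) * ψ y := by
  have h : midCoeff ψ d c ν μ = endCoeff (Pi.single ν 1 : Fin (d + 1) → ℂ) ψ c μ := by
    unfold midCoeff endCoeff
    rw [Finset.sum_comm]
    simp [ketAct, mul_comm]
  rw [h, endCoeff_eq, couple, Finset.sum_eq_single ν]
  · simp
  · intro x _ hx
    simp [hx]
  · simp

theorem endCoeffBra_eq {d e : ℕ} (ψ : Fin (d + 1) → ℂ) (φ : Fin (e + 1) → ℂ) (c : ℕ)
    (μ : Fin (c + 1)) : endCoeffBra ψ φ c μ = star (endCoeff ψ φ c μ) := by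
  simp only [endCoeffBra, endCoeff, star_sum, star_mul', ← integral_star, braAct_eq,
    wignerD_inv_apply, star_star]
  refine Finset.sum_congr rfl fun k _ => Finset.sum_congr rfl fun x _ =>
    Finset.sum_congr rfl fun y _ => ?_
  congr 1
  · exact (Complex.conj_ofReal _).symm
  · congr 1; funext g; ring

theorem midCoeffBra_eq {e : ℕ} (ψ : Fin (e + 1) → ℂ) (d c : ℕ) (ν : Fin (d + 1))
    (μ : Fin (c + 1)) : midCoeffBra ψ d c ν μ = star (midCoeff ψ d c ν μ) := by
  simp only [midCoeffBra, midCoeff, star_sum, star_mul', ← integral_star, braAct_eq,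
    wignerD_inv_apply, star_star]
  refine Finset.sum_congr rfl fun k _ => Finset.sum_congr rfl fun x _ =>
    Finset.sum_congr rfl fun y _ => ?_
  congr 1
  · exact (Complex.conj_ofReal _).symm
  · congr 1; funext g; ring

theorem chainCoeffBra_eq (γ : Sphere → SU2) {p : ℕ} (a : Fin (p + 2) → ℕ)
    (n : Fin (p + 2) → Sphere) (s : Fin (p + 2) → ℕ) (m : ℕ) :
    chainCoeffBra γ a n s m = star (chainCoeff γ a n s m) := by
  simp only [chainCoeffBra, chainCoeff, star_sum, endCoeffBra_eq, midCoeffBra_eq]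
  refine Finset.sum_congr rfl fun μ _ => ?_
  split_ifs
  · rw [star_mul', star_prod]
  · rw [star_zero]

/-- The operator on the recoupling line given by the coupling to a leg. -/
def legAmp {e : ℕ} (ψ : Fin (e + 1) → ℂ) (d c ν μ : ℕ) : ℂ :=
  ∑ y : Fin (e + 1), (clebschGordan d e c ν y μ : ℂ) * ψ y

/-- The contraction of the coupling coefficients of a product state along a recoupling tree. -/
def chainAmp {p : ℕ} (a : Fin (p + 2) → ℕ) (ψ : (I : Fin (p + 2)) → Fin (a I + 1) → ℂ)
    (s : Fin (p + 2) → ℕ) (m : ℕ) : ℂ :=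
  ∑ μ : Mag (fun i : Fin (p + 1) => s i.castSucc),
    if (μ 0 : ℕ) = m then
      couple (ψ (Fin.last (p + 1))) (ψ (Fin.last p).castSucc) (s (Fin.last p).castSucc)
        (μ (Fin.last p)) *
        ∏ i : Fin p, legAmp (ψ i.castSucc.castSucc) (s i.succ.castSucc)
          (s i.castSucc.castSucc) (μ i.succ) (μ i.castSucc)
    else 0

theorem chainCoeff_eq_chainAmp (γ : Sphere → SU2) {p : ℕ} (a : Fin (p + 2) → ℕ)
    (n : Fin (p + 2) → Sphere) (s : Fin (p + 2) → ℕ) (m : ℕ) :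
    chainCoeff γ a n s m = chainAmp a (fun I => coherent γ (a I) (n I)) s m := by
  simp only [chainCoeff, chainAmp, endCoeff_eq, midCoeff_eq, legAmp]

theorem treeAmp_succ {n : ℕ} (a : Fin (n + 2) → ℕ) (ψ : (I : Fin (n + 2)) → Fin (a I + 1) → ℂ)
    (s : Fin (n + 2) → ℕ) (k : ℕ) :
    treeAmp a ψ s k = ∑ κ : Fin (s (Fin.succ 0) + 1),
      legAmp (ψ 0) (s (Fin.succ 0)) (s 0) κ k *
        treeAmp (fun i => a i.succ) (fun i => ψ i.succ) (fun i => s i.succ) κ := by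
  unfold treeAmp legAmp
  rw [sum_mag_succ]
  simp only [treeVec_succ a s, Fin.cons_zero, Fin.cons_succ, Fin.prod_univ_succ, Finset.sum_mul,
    Finset.mul_sum]
  rw [Finset.sum_congr rfl fun x _ => Finset.sum_comm, Finset.sum_comm]
  refine Finset.sum_congr rfl fun κ _ => ?_
  rw [Finset.sum_comm]
  refine Finset.sum_congr rfl fun x _ => Finset.sum_congr rfl fun y _ => ?_
  ring

theorem treeAmp_zero {a s : Fin 1 → ℕ} (h : s 0 = a 0) (ψ : (I : Fin 1) → Fin (a I + 1) → ℂ)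
    (k : Fin (a 0 + 1)) : treeAmp a ψ s k = ψ 0 k := by
  unfold treeAmp
  rw [sum_mag_one]
  simp only [treeVec_zero h]
  rw [Finset.sum_eq_single k]
  · simp
  · intro x _ hx
    rw [if_neg, zero_mul]
    exact fun h => hx (Fin.ext h.symm)
  · simp

theorem legAmp_eq_zero_of_lt {e : ℕ} (ψ : Fin (e + 1) → ℂ) {d c ν μ : ℕ} (h : c < μ) :
    legAmp ψ d c ν μ = 0 := by
  simp [legAmp, clebschGordan_eq_zero_of_lt h]

theorem couple_eq_zero_of_lt {d e : ℕ} (ψ : Fin (d + 1) → ℂ) (φ : Fin (e + 1) → ℂ) {c k : ℕ}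
    (h : c < k) : couple ψ φ c k = 0 := by
  simp [couple, clebschGordan_eq_zero_of_lt h]

theorem treeAmp_two {a s : Fin 2 → ℕ} (h : s 1 = a 1) (ψ : (I : Fin 2) → Fin (a I + 1) → ℂ)
    (k : ℕ) : treeAmp a ψ s k = couple (ψ 1) (ψ 0) (s 0) k := by
  rw [treeAmp_succ]
  have h' : s (Fin.succ 0) = a 1 := h
  rw [h', couple]
  refine Finset.sum_congr rfl fun κ _ => ?_
  rw [treeAmp_zero (a := fun i => a i.succ) (s := fun i => s i.succ) h (fun i => ψ i.succ) κ,
    legAmp, Finset.sum_mul]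
  refine Finset.sum_congr rfl fun y _ => ?_
  change _ * _ * ψ 1 κ = _
  ring

theorem chainAmp_succ {p : ℕ} (a : Fin (p + 3) → ℕ) (ψ : (I : Fin (p + 3)) → Fin (a I + 1) → ℂ)
    (s : Fin (p + 3) → ℕ) (m : ℕ) :
    chainAmp a ψ s m = ∑ κ : Fin (s (Fin.succ 0) + 1),
      legAmp (ψ 0) (s (Fin.succ 0)) (s 0) κ m *
        chainAmp (fun i => a i.succ) (fun i => ψ i.succ) (fun i => s i.succ) κ := by
  have hR : ∑ κ : Fin (s (Fin.succ 0) + 1), legAmp (ψ 0) (s (Fin.succ 0)) (s 0) κ m *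
        chainAmp (fun i => a i.succ) (fun i => ψ i.succ) (fun i => s i.succ) κ =
      ∑ μ : Mag (fun i : Fin (p + 1) => s i.castSucc.succ),
        legAmp (ψ 0) (s (Fin.succ 0)) (s 0) (μ 0) m *
        (couple (ψ (Fin.last (p + 1)).succ) (ψ (Fin.last p).castSucc.succ)
          (s (Fin.last p).castSucc.succ) (μ (Fin.last p)) *
        ∏ i : Fin p, legAmp (ψ i.castSucc.castSucc.succ) (s i.succ.castSucc.succ)
          (s i.castSucc.castSucc.succ) (μ i.succ) (μ i.castSucc)) := by
    simp only [chainAmp, Finset.mul_sum]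
    rw [Finset.sum_comm]
    refine Finset.sum_congr rfl fun μ _ => ?_
    refine (Finset.sum_eq_single (μ 0) ?_ ?_).trans ?_
    · intro κ _ h
      rw [if_neg, mul_zero]
      exact fun h1 => h (Fin.ext h1.symm)
    · exact fun h => absurd (Finset.mem_univ _) h
    · rw [if_pos rfl]
  rw [hR]
  unfold chainAmp
  rw [sum_mag_succ, Finset.sum_comm]
  refine Finset.sum_congr rfl fun μ _ => ?_
  by_cases hm : m < s 0 + 1
  · refine (Finset.sum_eq_single (⟨m, hm⟩ : Fin (s 0 + 1)) ?_ ?_).trans ?_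
    · intro κ _ h
      rw [if_neg]
      exact fun h1 => h (Fin.ext h1)
    · exact fun h => absurd (Finset.mem_univ _) h
    · refine (if_pos rfl).trans ?_
      rw [Fin.prod_univ_succ, mul_left_comm]
      rfl
  · rw [legAmp_eq_zero_of_lt _ (by omega), zero_mul]
    refine Finset.sum_eq_zero fun κ _ => if_neg ?_
    intro h
    have hκ : (κ : ℕ) < s 0 + 1 := κ.2
    have : (κ : ℕ) = m := h
    omega

/-- Both amplitudes obey the same root recursion. They differ at the far end, where the chain
couples the last two legs in one vertex; the path condition matches the outermost line with the last
leg. -/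
theorem chainAmp_eq_treeAmp {p : ℕ} {a s : Fin (p + 2) → ℕ} (hs : IsPath a s)
    (ψ : (I : Fin (p + 2)) → Fin (a I + 1) → ℂ) (m : ℕ) : chainAmp a ψ s m = treeAmp a ψ s m := by
  induction p generalizing m with
  | zero =>
    rw [treeAmp_two hs.1]
    unfold chainAmp
    rw [sum_mag_one]
    by_cases hm : m < s 0 + 1
    · refine (Finset.sum_eq_single (⟨m, hm⟩ : Fin (s 0 + 1)) ?_ ?_).trans ?_
      · intro κ _ h
        rw [if_neg]
        exact fun h1 => h (Fin.ext h1)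
      · exact fun h => absurd (Finset.mem_univ _) h
      · rw [if_pos rfl, Fin.prod_univ_zero, mul_one]
        rfl
    · rw [couple_eq_zero_of_lt _ _ (by omega)]
      refine Finset.sum_eq_zero fun κ _ => if_neg ?_
      intro h
      have hκ : (κ : ℕ) < s 0 + 1 := κ.2
      have : (κ : ℕ) = m := h
      omega
  | succ p ih =>
    obtain ⟨_, hP⟩ := isPath_succ.mp hs
    rw [chainAmp_succ, treeAmp_succ]
    exact Finset.sum_congr rfl fun κ _ => by rw [ih hP]

theorem coeff_eq (γ : Sphere → SU2) {p q : ℕ} {a s : Fin (p + 2) → ℕ} {b s' : Fin (q + 2) → ℕ}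
    (n : Fin (p + 2) → Sphere) (n' : Fin (q + 2) → Sphere) (hs : IsPath a s) (hs' : IsPath b s')
    (j : ℕ) : coeff γ a b n n' j s s' = ∑ m : Fin (j + 1),
      treeAmp a (fun I => coherent γ (a I) (n I)) s m *
        star (treeAmp b (fun I => coherent γ (b I) (n' I)) s' m) := by
  simp only [coeff, Finset.sum_range, chainCoeffBra_eq, chainCoeff_eq_chainAmp,
    chainAmp_eq_treeAmp hs, chainAmp_eq_treeAmp hs']

/-! ## The space of intertwiners -/

/-- The recoupled vectors of a tree, as the rows of a matrix. -/
def treeMat {n : ℕ} (a s : Fin (n + 1) → ℕ) (j : ℕ) : Matrix (Fin (j + 1)) (Mag a) ℂ := fun k x =>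
  treeVec a s k x

theorem conjTranspose_treeMat {n : ℕ} (a s : Fin (n + 1) → ℕ) (j : ℕ) :
    (treeMat a s j)ᴴ = (treeMat a s j)ᵀ := by
  funext x k
  exact star_treeVec a s k x

theorem treeMat_mul_transpose {p : ℕ} {a s s' : Fin (p + 2) → ℕ} {j j' : ℕ} (hs : s ∈ paths a j)
    (hs' : s' ∈ paths a j') (k : Fin (j + 1)) (k' : Fin (j' + 1)) :
    (treeMat a s j * (treeMat a s' j')ᵀ) k k' = if s = s' ∧ (k : ℕ) = k' then 1 else 0 := by
  obtain ⟨rfl, h⟩ := mem_paths.mp hs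
  obtain ⟨rfl, h'⟩ := mem_paths.mp hs'
  exact treeVec_orthonormal h h' k k'

theorem treeMat_mul_tensorD {p : ℕ} {a s : Fin (p + 2) → ℕ} {j : ℕ} (hs : s ∈ paths a j)
    (g : SU2) : treeMat a s j * tensorD a g = wignerD j g * treeMat a s j := by
  obtain ⟨rfl, h⟩ := mem_paths.mp hs
  funext k y
  exact treeVec_covariant h g k y

theorem conjTranspose_tensorD {N : ℕ} (a : Fin N → ℕ) (g : SU2) :
    (tensorD a g)ᴴ = tensorD a g⁻¹ := by
  funext x y
  rw [Matrix.conjTranspose_apply]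
  simp only [tensorD, star_prod, wignerD_inv_apply]

theorem tensorD_mul_treeMat {p : ℕ} {a s : Fin (p + 2) → ℕ} {j : ℕ} (hs : s ∈ paths a j)
    (g : SU2) : tensorD a g * (treeMat a s j)ᵀ = (treeMat a s j)ᵀ * wignerD j g := by
  have h := congrArg Matrix.conjTranspose (treeMat_mul_tensorD hs g⁻¹)
  rwa [Matrix.conjTranspose_mul, Matrix.conjTranspose_mul, conjTranspose_tensorD,
    ← wignerD_inv, inv_inv, conjTranspose_treeMat] at h

/-- The vertex space as a space of matrices. -/
def vertexOf {M N : ℕ} (a : Fin M → ℕ) (b : Fin N → ℕ) :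
    Matrix (Mag a) (Mag b) ℂ →ₗ[ℂ] VertexSpace a b where
  toFun V := WithLp.toLp 2 fun x => V x.1 x.2
  map_add' _ _ := rfl
  map_smul' _ _ := rfl

/-- The matrix of components of a vector of the vertex space. -/
def vertexMat {M N : ℕ} {a : Fin M → ℕ} {b : Fin N → ℕ} (v : VertexSpace a b) :
    Matrix (Mag a) (Mag b) ℂ := fun x y => v (x, y)

theorem vertexOf_vertexMat {M N : ℕ} {a : Fin M → ℕ} {b : Fin N → ℕ} (v : VertexSpace a b) :
    vertexOf a b (vertexMat v) = v := rfl

theorem vertexMat_vertexOf {M N : ℕ} {a : Fin M → ℕ} {b : Fin N → ℕ}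
    (V : Matrix (Mag a) (Mag b) ℂ) : vertexMat (vertexOf a b V) = V := rfl

theorem vertexAct_eq {M N : ℕ} {a : Fin M → ℕ} {b : Fin N → ℕ} (g : SU2) (v : VertexSpace a b) :
    vertexAct g v = vertexOf a b (tensorD a g * vertexMat v * tensorD b g⁻¹) := by
  refine PiLp.ext fun x => ?_
  change ∑ y : Mag a × Mag b, tensorD a g x.1 y.1 * tensorD b g⁻¹ y.2 x.2 * v y =
    (tensorD a g * vertexMat v * tensorD b g⁻¹) x.1 x.2
  rw [Fintype.sum_prod_type, Finset.sum_comm]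
  simp only [Matrix.mul_apply, Finset.sum_mul]
  refine Finset.sum_congr rfl fun y _ => Finset.sum_congr rfl fun z _ => ?_
  simp only [vertexMat]
  ring

theorem isIntertwiner_iff {M N : ℕ} {a : Fin M → ℕ} {b : Fin N → ℕ} {v : VertexSpace a b} :
    IsIntertwiner v ↔ ∀ g, tensorD a g * vertexMat v * tensorD b g⁻¹ = vertexMat v := by
  refine forall_congr' fun g => ?_
  rw [vertexAct_eq]
  constructor
  · intro h
    conv_rhs => rw [← h]
    rfl
  · intro h
    rw [h]
    rfl

/-- The subspace of intertwiners. -/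
def intertwiners {M N : ℕ} (a : Fin M → ℕ) (b : Fin N → ℕ) : Submodule ℂ (VertexSpace a b) where
  carrier := {v | IsIntertwiner v}
  zero_mem' := isIntertwiner_iff.mpr fun g => by
    change tensorD a g * (0 : Matrix (Mag a) (Mag b) ℂ) * _ = 0
    simp
  add_mem' {v w} hv hw := isIntertwiner_iff.mpr fun g => by
    change tensorD a g * (vertexMat v + vertexMat w) * _ = vertexMat v + vertexMat w
    rw [Matrix.mul_add, Matrix.add_mul, isIntertwiner_iff.mp hv, isIntertwiner_iff.mp hw]
  smul_mem' c v hv := isIntertwiner_iff.mpr fun g => by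
    change tensorD a g * (c • vertexMat v) * _ = c • vertexMat v
    rw [Matrix.mul_smul, Matrix.smul_mul, isIntertwiner_iff.mp hv]

theorem mem_intertwiners {M N : ℕ} {a : Fin M → ℕ} {b : Fin N → ℕ} {v : VertexSpace a b} :
    v ∈ intertwiners a b ↔ IsIntertwiner v := Iff.rfl

theorem recoupledIntertwiner_eq {p q : ℕ} (a : Fin (p + 2) → ℕ) (b : Fin (q + 2) → ℕ) (j : ℕ)
    (s : Fin (p + 2) → ℕ) (s' : Fin (q + 2) → ℕ) :
    recoupledIntertwiner a b j s s' = vertexOf a b ((treeMat a s j)ᵀ * treeMat b s' j) := by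
  refine PiLp.ext fun x => ?_
  change ∑ k ∈ Finset.range (j + 1), treeVec a s k x.1 * treeVec b s' k x.2 = _
  rw [Finset.sum_range]
  rfl

theorem isIntertwiner_recoupledIntertwiner {p q : ℕ} {a : Fin (p + 2) → ℕ} {b : Fin (q + 2) → ℕ}
    {j : ℕ} {s : Fin (p + 2) → ℕ} {s' : Fin (q + 2) → ℕ} (hs : s ∈ paths a j)
    (hs' : s' ∈ paths b j) : IsIntertwiner (recoupledIntertwiner a b j s s') := by
  rw [isIntertwiner_iff]
  intro g
  rw [recoupledIntertwiner_eq, vertexMat_vertexOf, ← Matrix.mul_assoc, tensorD_mul_treeMat hs,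
    Matrix.mul_assoc, treeMat_mul_tensorD hs', Matrix.mul_assoc, ← Matrix.mul_assoc (wignerD j g),
    wignerD_mul_inv, Matrix.one_mul]

theorem inner_vertexOf {M N : ℕ} {a : Fin M → ℕ} {b : Fin N → ℕ} (V W : Matrix (Mag a) (Mag b) ℂ) :
    inner ℂ (vertexOf a b V) (vertexOf a b W) = (Vᴴ * W).trace := by
  rw [PiLp.inner_apply, Fintype.sum_prod_type, Finset.sum_comm]
  simp only [Matrix.trace, Matrix.diag, Matrix.mul_apply, Matrix.conjTranspose_apply]
  refine Finset.sum_congr rfl fun y _ => Finset.sum_congr rfl fun x _ => ?_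
  rw [RCLike.inner_apply, mul_comm]
  rfl

/-- The inner product is a trace that factors into the overlaps of the in-going and of the out-going
trees; the surviving trace counts the `2j + 1` central magnetic numbers. -/
theorem inner_recoupledIntertwiner {p q : ℕ} {a : Fin (p + 2) → ℕ} {b : Fin (q + 2) → ℕ}
    {j j' : ℕ} {s t : Fin (p + 2) → ℕ} {s' t' : Fin (q + 2) → ℕ} (hs : s ∈ paths a j)
    (hs' : s' ∈ paths b j) (ht : t ∈ paths a j') (ht' : t' ∈ paths b j') :
    inner ℂ (recoupledIntertwiner a b j s s') (recoupledIntertwiner a b j' t t') =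
      if s = t ∧ s' = t' then (j : ℂ) + 1 else 0 := by
  have e : inner ℂ (recoupledIntertwiner a b j s s') (recoupledIntertwiner a b j' t t') =
      ((treeMat a s j * (treeMat a t j')ᵀ) * (treeMat b t' j' * (treeMat b s' j)ᵀ)).trace := by
    rw [recoupledIntertwiner_eq, recoupledIntertwiner_eq, inner_vertexOf, Matrix.conjTranspose_mul,
      ← conjTranspose_treeMat a s, Matrix.conjTranspose_conjTranspose, conjTranspose_treeMat b,
      Matrix.mul_assoc, Matrix.trace_mul_comm]
    simp only [Matrix.mul_assoc]
  rw [e]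
  by_cases hst : s = t
  · subst hst
    obtain rfl : j = j' := by
      rw [← (mem_paths.mp hs).1, ← (mem_paths.mp ht).1]
    have h1 : treeMat a s j * (treeMat a s j)ᵀ = 1 := by
      funext k k'
      rw [treeMat_mul_transpose hs hs, Matrix.one_apply]
      simp [Fin.ext_iff]
    rw [h1, Matrix.one_mul]
    simp only [Matrix.trace, Matrix.diag, treeMat_mul_transpose ht' hs', and_true, true_and]
    by_cases h : s' = t'
    · simp [h]
    · simp [h, Ne.symm h]
  · have h1 : treeMat a s j * (treeMat a t j')ᵀ = 0 := by
      funext k k'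
      rw [treeMat_mul_transpose hs ht]
      simp [hst]
    simp [h1, hst]

theorem orthonormal_recouplingBasis {p q : ℕ} (a : Fin (p + 2) → ℕ) (b : Fin (q + 2) → ℕ) :
    Orthonormal ℂ (recouplingBasis a b) := by
  rw [orthonormal_iff_ite]
  rintro ⟨j, ⟨s, hs⟩, ⟨s', hs'⟩⟩ ⟨j', ⟨t, ht⟩, ⟨t', ht'⟩⟩
  simp only [recouplingBasis]
  rw [inner_smul_left, inner_smul_right, inner_recoupledIntertwiner hs hs' ht ht']
  by_cases h : s = t ∧ s' = t'
  · obtain ⟨rfl, rfl⟩ := h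
    obtain rfl : j = j' := by
      rw [← (mem_paths.mp hs).1, ← (mem_paths.mp ht).1]
    have hpos : (0 : ℝ) < (j : ℝ) + 1 := by positivity
    have hsq : (Real.sqrt ((j : ℝ) + 1) : ℂ) * (Real.sqrt ((j : ℝ) + 1) : ℂ) = (j : ℂ) + 1 := by
      rw [← Complex.ofReal_mul, Real.mul_self_sqrt hpos.le]
      push_cast; rfl
    have hne : (Real.sqrt ((j : ℝ) + 1) : ℂ) ≠ 0 := by
      exact_mod_cast (Real.sqrt_pos.mpr hpos).ne'
    rw [if_pos ⟨rfl, rfl⟩, if_pos rfl, map_inv₀, Complex.conj_ofReal, ← hsq]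
    field_simp
  · rw [if_neg h, if_neg, mul_zero, mul_zero]
    intro h'
    exact h ⟨congrArg (fun x => x.2.1.1) h', congrArg (fun x => x.2.2.1) h'⟩

theorem sum_treeMat {p : ℕ} (a : Fin (p + 2) → ℕ) :
    ∑ s ∈ allPaths a, (treeMat a s (s 0))ᵀ * treeMat a s (s 0) = 1 := by
  funext x y
  rw [Matrix.sum_apply, Matrix.one_apply, ← treeVec_complete]
  rfl

theorem recoupledIntertwiner_mem_span {p q : ℕ} {a : Fin (p + 2) → ℕ} {b : Fin (q + 2) → ℕ}
    {j : ℕ} {s : Fin (p + 2) → ℕ} {s' : Fin (q + 2) → ℕ} (hs : s ∈ paths a j)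
    (hs' : s' ∈ paths b j) :
    recoupledIntertwiner a b j s s' ∈ Submodule.span ℂ (Set.range (recouplingBasis a b)) := by
  have hmem := Submodule.subset_span (R := ℂ)
    (Set.mem_range_self (f := recouplingBasis a b) ⟨j, ⟨s, hs⟩, ⟨s', hs'⟩⟩)
  have hpos : (0 : ℝ) < (j : ℝ) + 1 := by positivity
  have hne : ((Real.sqrt ((j : ℝ) + 1))⁻¹ : ℂ) ≠ 0 := by
    exact_mod_cast inv_ne_zero (Real.sqrt_pos.mpr hpos).ne'
  exact (Submodule.smul_mem_iff _ hne).mp hmem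

/-- An invariant vector is an intertwining matrix between tensor products. Cutting it by the tree
completeness relations on both sides gives blocks intertwining irreducible representations, and
Schur's lemma leaves multiples of glued trees. -/
theorem mem_span_recouplingBasis {p q : ℕ} (a : Fin (p + 2) → ℕ) (b : Fin (q + 2) → ℕ)
    (v : VertexSpace a b) :
    v ∈ Submodule.span ℂ (Set.range (recouplingBasis a b)) ↔ IsIntertwiner v := by
  constructor
  · intro hv
    refine mem_intertwiners.mp ((Submodule.span_le.mpr ?_) hv)
    rintro _ ⟨⟨j, ⟨s, hs⟩, ⟨s', hs'⟩⟩, rfl⟩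
    exact (intertwiners a b).smul_mem _ (isIntertwiner_recoupledIntertwiner hs hs')
  · intro hv
    rw [isIntertwiner_iff] at hv
    have hexp : v = ∑ s ∈ allPaths a, ∑ s' ∈ allPaths b, vertexOf a b ((treeMat a s (s 0))ᵀ *
        (treeMat a s (s 0) * vertexMat v * (treeMat b s' (s' 0))ᵀ) * treeMat b s' (s' 0)) := by
      simp only [← map_sum]
      have h : ∑ s ∈ allPaths a, ∑ s' ∈ allPaths b, (treeMat a s (s 0))ᵀ *
          (treeMat a s (s 0) * vertexMat v * (treeMat b s' (s' 0))ᵀ) * treeMat b s' (s' 0) =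
          (∑ s ∈ allPaths a, (treeMat a s (s 0))ᵀ * treeMat a s (s 0)) * vertexMat v *
          (∑ s' ∈ allPaths b, (treeMat b s' (s' 0))ᵀ * treeMat b s' (s' 0)) := by
        rw [Matrix.sum_mul, Matrix.sum_mul]
        refine Finset.sum_congr rfl fun s _ => ?_
        rw [Matrix.mul_sum]
        refine Finset.sum_congr rfl fun s' _ => ?_
        simp only [Matrix.mul_assoc]
      rw [h, sum_treeMat, sum_treeMat, Matrix.one_mul, Matrix.mul_one, vertexOf_vertexMat]
    rw [hexp]
    refine Submodule.sum_mem _ fun s hs => Submodule.sum_mem _ fun s' hs' => ?_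
    have hs := mem_paths.mpr ⟨rfl, mem_allPaths.mp hs⟩
    have hs' := mem_paths.mpr ⟨rfl, mem_allPaths.mp hs'⟩
    -- The root spins become free variables, so that equality of the two spins can be substituted.
    generalize s 0 = j at *
    generalize s' 0 = j' at *
    have hT : ∀ g, wignerD j g * (treeMat a s j * vertexMat v * (treeMat b s' j')ᵀ) =
        (treeMat a s j * vertexMat v * (treeMat b s' j')ᵀ) * wignerD j' g := by
      intro g
      rw [Matrix.mul_assoc _ _ (wignerD j' g), ← tensorD_mul_treeMat hs', ← Matrix.mul_assoc,
        ← Matrix.mul_assoc, ← treeMat_mul_tensorD hs]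
      conv_rhs => rw [← hv g]
      have h1 : tensorD b g⁻¹ * tensorD b g * (treeMat b s' j')ᵀ = (treeMat b s' j')ᵀ := by
        rw [Matrix.mul_assoc, tensorD_mul_treeMat hs', ← Matrix.mul_assoc,
          tensorD_mul_treeMat hs', Matrix.mul_assoc, wignerD_inv_mul, Matrix.mul_one]
      simp only [Matrix.mul_assoc] at h1 ⊢
      rw [h1]
    by_cases hj : j = j'
    · subst hj
      rw [schur_self hT, Matrix.mul_smul, Matrix.smul_mul, Matrix.mul_one, map_smul,
        ← recoupledIntertwiner_eq]
      exact Submodule.smul_mem _ _ (recoupledIntertwiner_mem_span hs hs')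
    · rw [schur_of_ne hj hT, Matrix.mul_zero, Matrix.zero_mul, map_zero]
      exact Submodule.zero_mem _

/-! ## The coherent intertwiner -/

theorem coherentIntertwiner_apply (γ : Sphere → SU2) {p q : ℕ} (a : Fin (p + 2) → ℕ)
    (b : Fin (q + 2) → ℕ) (n : Fin (p + 2) → Sphere) (n' : Fin (q + 2) → Sphere) (x : Mag a)
    (y : Mag b) : coherentIntertwiner γ a b n n' (x, y) = ∑ j ∈ centralSpins a,
      ∑ s ∈ paths a j, ∑ s' ∈ paths b j, ((j : ℂ) + 1)⁻¹ * coeff γ a b n n' j s s' *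
        ∑ k : Fin (j + 1), treeVec a s k x * treeVec b s' k y := by
  have h := integral_prod_ketAct_mul_star a b (fun I => coherent γ (a I) (n I))
    (fun J => coherent γ (b J) (n' J)) x y
  have h' : coherentIntertwiner γ a b n n' (x, y) =
      ∫ g : SU2, (∏ I, ketAct g (coherent γ (a I) (n I)) (x I)) *
        star (∏ J, ketAct g (coherent γ (b J) (n' J)) (y J)) ∂haarSU2 := by
    simp only [star_prod, ← braAct_eq]
    rfl
  rw [h', h]
  refine Finset.sum_congr rfl fun j _ => Finset.sum_congr rfl fun s hs =>
    Finset.sum_congr rfl fun s' hs' => ?_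
  rw [coeff_eq γ n n' (mem_paths.mp hs).2 (mem_paths.mp hs').2]

theorem coherentIntertwiner_eq_sum (γ : Sphere → SU2) {p q : ℕ} (a : Fin (p + 2) → ℕ)
    (b : Fin (q + 2) → ℕ) (n : Fin (p + 2) → Sphere) (n' : Fin (q + 2) → Sphere) :
    coherentIntertwiner γ a b n n' = ∑ j ∈ centralSpins a, ∑ s ∈ paths a j, ∑ s' ∈ paths b j,
      (((j : ℂ) + 1)⁻¹ * coeff γ a b n n' j s s') • recoupledIntertwiner a b j s s' := by
  refine PiLp.ext fun ⟨x, y⟩ => ?_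
  rw [coherentIntertwiner_apply]
  simp only [recoupledIntertwiner_eq, ← map_smul, ← map_sum]
  change _ = (∑ j ∈ centralSpins a, ∑ s ∈ paths a j, ∑ s' ∈ paths b j,
      (((j : ℂ) + 1)⁻¹ * coeff γ a b n n' j s s') • ((treeMat a s j)ᵀ * treeMat b s' j)) x y
  simp only [Matrix.sum_apply]
  rfl

/-- Invariance is read off from the expansion: each glued pair of trees is invariant. -/
theorem isIntertwiner_coherentIntertwiner (γ : Sphere → SU2) {p q : ℕ} (a : Fin (p + 2) → ℕ)
    (b : Fin (q + 2) → ℕ) (n : Fin (p + 2) → Sphere) (n' : Fin (q + 2) → Sphere) :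
    IsIntertwiner (coherentIntertwiner γ a b n n') := by
  rw [coherentIntertwiner_eq_sum, ← mem_intertwiners]
  exact Submodule.sum_mem _ fun j _ => Submodule.sum_mem _ fun s hs => Submodule.sum_mem _
    fun s' hs' => Submodule.smul_mem _ _ (isIntertwiner_recoupledIntertwiner hs hs')

theorem ketPart_eq (γ : Sphere → SU2) {p : ℕ} (a : Fin (p + 2) → ℕ) (n : Fin (p + 2) → Sphere)
    (j : ℕ) (m k : Fin (j + 1)) (x : Mag a) :
    ketPart γ a n j m k x = ∑ s ∈ paths a j, treeVec a s k x *
      treeAmp a (fun I => coherent γ (a I) (n I)) s m * ((j : ℂ) + 1)⁻¹ := by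
  rw [← integral_prod_ketAct, ketPart]
  simp only [wignerD_inv_apply]

theorem braPart_eq (γ : Sphere → SU2) {p : ℕ} (a : Fin (p + 2) → ℕ) (n : Fin (p + 2) → Sphere)
    (j : ℕ) (m k : Fin (j + 1)) (x : Mag a) :
    braPart γ a n j m k x = star (ketPart γ a n j m k x) := by
  rw [braPart, ketPart, ← integral_star]
  congr 1
  funext g
  rw [star_mul', star_prod, wignerD_inv_apply, star_star, mul_comm]
  simp only [braAct_eq]

/-- Each half contributes a factor `(2j+1)⁻¹` from Schur orthogonality; the prefactor cancels one of
them, and the sum over `m` rebuilds the coefficient. -/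
theorem coherentIntertwiner_split (γ : Sphere → SU2) {p q : ℕ} (a : Fin (p + 2) → ℕ)
    (b : Fin (q + 2) → ℕ) (n : Fin (p + 2) → Sphere) (n' : Fin (q + 2) → Sphere) (x : Mag a)
    (y : Mag b) : coherentIntertwiner γ a b n n' (x, y) = ∑ j ∈ centralSpins a, ((j : ℂ) + 1) *
      ∑ k : Fin (j + 1), ∑ m : Fin (j + 1), ketPart γ a n j m k x * braPart γ b n' j m k y := by
  rw [coherentIntertwiner_apply]
  refine Finset.sum_congr rfl fun j _ => ?_
  have hd : (j : ℂ) + 1 ≠ 0 := by exact_mod_cast Nat.succ_ne_zero j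
  have hstar : star (((j : ℂ) + 1)⁻¹) = ((j : ℂ) + 1)⁻¹ := by simp
  simp only [braPart_eq, ketPart_eq, star_sum, star_mul', star_treeVec, hstar,
    Finset.sum_mul_sum]
  have h : ∀ f : Fin (j + 1) → Fin (j + 1) → (Fin (p + 2) → ℕ) → (Fin (q + 2) → ℕ) → ℂ,
      ∑ k, ∑ m, ∑ s ∈ paths a j, ∑ s' ∈ paths b j, f k m s s' =
      ∑ s ∈ paths a j, ∑ s' ∈ paths b j, ∑ k, ∑ m, f k m s s' := by
    intro f
    rw [Finset.sum_congr rfl fun k _ => Finset.sum_comm, Finset.sum_comm]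
    refine Finset.sum_congr rfl fun s _ => ?_
    rw [Finset.sum_congr rfl fun k _ => Finset.sum_comm, Finset.sum_comm]
  rw [h, Finset.mul_sum]
  refine Finset.sum_congr rfl fun s hs => ?_
  rw [Finset.mul_sum]
  refine Finset.sum_congr rfl fun s' hs' => ?_
  rw [coeff_eq γ n n' (mem_paths.mp hs).2 (mem_paths.mp hs').2, mul_assoc, Finset.sum_mul_sum,
    Finset.sum_comm, Finset.mul_sum, Finset.mul_sum]
  refine Finset.sum_congr rfl fun k _ => ?_
  rw [Finset.mul_sum, Finset.mul_sum]
  refine Finset.sum_congr rfl fun m _ => ?_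
  field_simp

/-! ## Entropy and diagonalization -/

section Entropy

variable {X Y : Type*} [Fintype X] [DecidableEq X] [Fintype Y] [DecidableEq Y]

/-- Conjugation of real diagonal matrices by a unitary, as a homomorphism of algebras. -/
def conjDiagonal (W : Matrix X Y ℂ) (h : Wᴴ * W = 1) (h' : W * Wᴴ = 1) :
    (Y → ℝ) →ₐ[ℝ] Matrix X X ℂ where
  toFun d := W * Matrix.diagonal (fun y => (d y : ℂ)) * Wᴴ
  map_one' := by simp [h']
  map_mul' d e := by
    have : W * Matrix.diagonal (fun y => (d y : ℂ)) * Wᴴ *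
        (W * Matrix.diagonal (fun y => (e y : ℂ)) * Wᴴ) = W * Matrix.diagonal (fun y => (d y : ℂ)) *
        (Wᴴ * W) * Matrix.diagonal (fun y => (e y : ℂ)) * Wᴴ := by
      simp only [Matrix.mul_assoc]
    rw [this, h, Matrix.mul_one, Matrix.mul_assoc W (Matrix.diagonal _) (Matrix.diagonal _),
      Matrix.diagonal_mul_diagonal]
    simp
  map_zero' := by simp
  map_add' d e := by
    rw [← Matrix.add_mul, ← Matrix.mul_add, Matrix.diagonal_add]
    simp
  commutes' r := by
    have : Matrix.diagonal (fun _ : Y => (r : ℂ)) = (r : ℂ) • (1 : Matrix Y Y ℂ) := by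
      rw [Matrix.smul_one_eq_diagonal]
    change W * Matrix.diagonal (fun _ : Y => (r : ℂ)) * Wᴴ = _
    rw [this, Matrix.mul_smul, Matrix.smul_mul, Matrix.mul_one, h', Matrix.algebraMap_eq_diagonal,
      Matrix.smul_one_eq_diagonal]
    rfl

theorem conjDiagonal_apply (W : Matrix X Y ℂ) (h : Wᴴ * W = 1) (h' : W * Wᴴ = 1) (d : Y → ℝ) :
    conjDiagonal W h h' d = W * Matrix.diagonal (fun y => (d y : ℂ)) * Wᴴ := rfl

theorem trace_conjDiagonal (W : Matrix X Y ℂ) (h : Wᴴ * W = 1) (h' : W * Wᴴ = 1) (d : Y → ℝ) :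
    (conjDiagonal W h h' d).trace = ((∑ y, d y : ℝ) : ℂ) := by
  rw [conjDiagonal_apply, Matrix.trace_mul_comm, ← Matrix.mul_assoc, h, Matrix.one_mul,
    Matrix.trace_diagonal, Complex.ofReal_sum]

theorem isHermitian_conjDiagonal (W : Matrix X Y ℂ) (h : Wᴴ * W = 1) (h' : W * Wᴴ = 1)
    (d : Y → ℝ) : (conjDiagonal W h h' d).IsHermitian := by
  unfold Matrix.IsHermitian
  rw [conjDiagonal_apply, Matrix.conjTranspose_mul, Matrix.conjTranspose_mul,
    Matrix.conjTranspose_conjTranspose, Matrix.diagonal_conjTranspose, Matrix.mul_assoc]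
  congr 3
  funext y
  exact Complex.conj_ofReal _

/-- On finitely many points `x ln x` is a polynomial, and polynomials commute with the algebra
homomorphism `conjDiagonal`. -/
theorem entropy_conjDiagonal (W : Matrix X Y ℂ) (h : Wᴴ * W = 1) (h' : W * Wᴴ = 1) (d : Y → ℝ) :
    entropy (conjDiagonal W h h' d) = ∑ y, Real.negMulLog (d y) := by
  set ρ := conjDiagonal W h h' d with hρ
  have hsa : IsSelfAdjoint ρ := isHermitian_conjDiagonal W h h' d
  have hfin : (spectrum ℝ ρ).Finite := Matrix.finite_real_spectrum
  have h1 : ρ * cfc Real.log ρ = cfc (fun x => x * Real.log x) ρ := by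
    rw [cfc_mul (fun x => x) Real.log ρ (hfin.continuousOn _) (hfin.continuousOn _), cfc_id' ℝ ρ]
  -- The nodes include both the spectrum and the values of `d`, so the two sets need not be
  -- identified.
  let S : Finset ℝ := hfin.toFinset ∪ Finset.univ.image d
  let q : Polynomial ℝ := Lagrange.interpolate S id (fun x => x * Real.log x)
  have hq : ∀ x ∈ S, q.eval x = x * Real.log x := fun x hx =>
    Lagrange.eval_interpolate_at_node (v := id) _ Function.injective_id.injOn hx
  have h2 : cfc (fun x => x * Real.log x) ρ = Polynomial.aeval ρ q := by
    rw [← cfc_polynomial q ρ]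
    refine cfc_congr fun x hx => (hq x ?_).symm
    exact Finset.mem_union_left _ (hfin.mem_toFinset.mpr hx)
  have h3 : Polynomial.aeval d q = fun y => d y * Real.log (d y) := by
    funext y
    have := Polynomial.aeval_algHom_apply (Pi.evalAlgHom ℝ (fun _ : Y => ℝ) y) d q
    rw [← hq (d y) (Finset.mem_union_right _ (Finset.mem_image_of_mem d (Finset.mem_univ y)))]
    exact this.symm
  unfold entropy
  rw [h1, h2, hρ, Polynomial.aeval_algHom_apply, h3, trace_conjDiagonal, Complex.ofReal_re,
    ← Finset.sum_neg_distrib]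
  exact Finset.sum_congr rfl fun y _ => by rw [Real.negMulLog]; ring

theorem exists_eq_conjDiagonal {A : Matrix X X ℂ} (hA : A.IsHermitian) :
    ∃ (V : Matrix X X ℂ) (h : Vᴴ * V = 1) (h' : V * Vᴴ = 1) (d : X → ℝ),
      A = conjDiagonal V h h' d := by
  refine ⟨hA.eigenvectorUnitary, Unitary.coe_star_mul_self hA.eigenvectorUnitary,
    Unitary.coe_mul_star_self hA.eigenvectorUnitary, hA.eigenvalues, ?_⟩
  conv_lhs => rw [hA.spectral_theorem, Unitary.conjStarAlgAut_apply]
  rfl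

theorem entropy_of_diagonal {A : Matrix X X ℂ} (hA : A.IsHermitian)
    (hd : ∀ s t, s ≠ t → A s t = 0) :
    entropy A = -∑ s, ∑ t, (A s t).re * Real.log (A s t).re := by
  have h : A = conjDiagonal (1 : Matrix X X ℂ) (by simp) (by simp) (fun s => (A s s).re) := by
    rw [conjDiagonal_apply, Matrix.one_mul, Matrix.conjTranspose_one, Matrix.mul_one]
    funext s t
    by_cases hst : s = t
    · subst hst
      rw [Matrix.diagonal_apply_eq]
      exact (Complex.conj_eq_iff_re.mp (hA.apply s s)).symm
    · rw [Matrix.diagonal_apply_ne _ hst, hd s t hst]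
  conv_lhs => rw [h]
  rw [entropy_conjDiagonal, ← Finset.sum_neg_distrib]
  refine Finset.sum_congr rfl fun s _ => ?_
  rw [Finset.sum_eq_single s, Real.negMulLog]
  · ring
  · intro t _ ht
    rw [hd s t (Ne.symm ht)]
    simp
  · simp

end Entropy

/-! ## The reduced density matrix -/

section Density

open scoped Kronecker

variable {p : ℕ}

/-- The indices of the recoupled vectors with central spin in `J`. -/
abbrev TreeIndex (a : Fin (p + 2) → ℕ) (J : Finset ℕ) : Type :=
  Σ j : J, paths a j × Fin (j.1 + 1)

/-- The recoupled vectors with central spin in `J`, as the rows of a matrix. -/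
def treeBasis (a : Fin (p + 2) → ℕ) (J : Finset ℕ) : Matrix (TreeIndex a J) (Mag a) ℂ :=
  fun i x => treeVec a i.2.1.1 i.2.2 x

theorem treeBasis_mul_conjTranspose (a : Fin (p + 2) → ℕ) (J : Finset ℕ) :
    treeBasis a J * (treeBasis a J)ᴴ = 1 := by
  funext ⟨⟨j, hj⟩, ⟨s, hs⟩, k⟩ ⟨⟨j', hj'⟩, ⟨s', hs'⟩, k'⟩
  have h := treeMat_mul_transpose hs hs' k k'
  rw [← conjTranspose_treeMat] at h
  refine h.trans ?_
  rw [Matrix.one_apply]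
  by_cases hss : s = s'
  · subst hss
    obtain rfl : j = j' := (mem_paths.mp hs).1.symm.trans (mem_paths.mp hs').1
    simp [Fin.ext_iff]
  · rw [if_neg (fun h => hss h.1), if_neg]
    intro h'
    exact hss (congrArg (fun x => x.2.1.1) h')

/-- For a general `J` the rows are only orthonormal; all central spins of `a` are needed for
completeness. -/
theorem conjTranspose_treeBasis_mul (a : Fin (p + 2) → ℕ) :
    (treeBasis a (centralSpins a))ᴴ * treeBasis a (centralSpins a) = 1 := by
  funext x y
  rw [Matrix.one_apply, ← treeVec_complete, sum_allPaths_eq a (centralSpins a), Matrix.mul_apply,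
    Fintype.sum_sigma, ← Finset.sum_coe_sort (centralSpins a)]
  · refine Finset.sum_congr rfl fun j _ => ?_
    rw [Fintype.sum_prod_type, ← Finset.sum_coe_sort (paths a j)]
    refine Finset.sum_congr rfl fun s _ => ?_
    simp only [Matrix.conjTranspose_apply, treeBasis, star_treeVec]
    rw [(mem_paths.mp s.2).1]
  · intro s hs hJ
    rw [centralSpins, Finset.mem_range] at hJ
    exact absurd (Nat.lt_succ_of_le ((mem_allPaths.mp hs).le_sum 0)) hJ

theorem treeBasis_conj_blockDiagonal {q : ℕ} (a : Fin (p + 2) → ℕ) (b : Fin (q + 2) → ℕ)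
    (J : Finset ℕ) (β : (j : J) → Matrix (paths a j) (paths b j) ℂ) (x : Mag a) (y : Mag b) :
    ((treeBasis a J)ᴴ * Matrix.blockDiagonal' (fun j : J => β j ⊗ₖ
      (1 : Matrix (Fin (j.1 + 1)) (Fin (j.1 + 1)) ℂ)) * treeBasis b J) x y =
      ∑ j : J, ∑ s, ∑ t, β j s t * ∑ k : Fin (j.1 + 1), treeVec a s k x * treeVec b t k y := by
  rw [Matrix.mul_assoc, Matrix.mul_apply, Fintype.sum_sigma]
  refine Finset.sum_congr rfl fun j _ => ?_
  rw [Fintype.sum_prod_type]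
  refine Finset.sum_congr rfl fun s _ => ?_
  have h : ∀ k : Fin (j.1 + 1), (Matrix.blockDiagonal' (fun j : J => β j ⊗ₖ
      (1 : Matrix (Fin (j.1 + 1)) (Fin (j.1 + 1)) ℂ)) * treeBasis b J) ⟨j, s, k⟩ y =
      ∑ t, β j s t * treeVec b t k y := by
    intro k
    rw [Matrix.mul_apply, Fintype.sum_sigma, Finset.sum_eq_single j, Fintype.sum_prod_type]
    · refine Finset.sum_congr rfl fun t _ => ?_
      rw [Finset.sum_eq_single k]
      · rw [Matrix.blockDiagonal'_apply_eq, Matrix.kroneckerMap_apply, Matrix.one_apply_eq, mul_one]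
        rfl
      · intro k' _ hk
        rw [Matrix.blockDiagonal'_apply_eq, Matrix.kroneckerMap_apply,
          Matrix.one_apply_ne hk.symm, mul_zero, zero_mul]
      · simp
    · intro j' _ hj
      refine Finset.sum_eq_zero fun t _ => ?_
      rw [Matrix.blockDiagonal'_apply_ne _ _ _ hj.symm, zero_mul]
    · simp
  simp only [h, Finset.mul_sum]
  rw [Finset.sum_comm]
  refine Finset.sum_congr rfl fun t _ => Finset.sum_congr rfl fun k _ => ?_
  simp only [Matrix.conjTranspose_apply, treeBasis, star_treeVec]
  ring

variable {q : ℕ} (γ : Sphere → SU2) (a : Fin (p + 2) → ℕ) (b : Fin (q + 2) → ℕ)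
  (n : Fin (p + 2) → Sphere) (n' : Fin (q + 2) → Sphere)

/-- The matrix of the coefficients `c_{j, j_ι, j̃_ι}` for a fixed central spin. -/
def coeffMatrix (j : ℕ) : Matrix (paths a j) (paths b j) ℂ := fun s s' =>
  coeff γ a b n n' j s s'

theorem vertexMat_coherentIntertwiner : vertexMat (coherentIntertwiner γ a b n n') =
    (treeBasis a (centralSpins a))ᴴ * Matrix.blockDiagonal' (fun j : centralSpins a =>
      (((j.1 : ℂ) + 1)⁻¹ • coeffMatrix γ a b n n' j.1) ⊗ₖ
        (1 : Matrix (Fin (j.1 + 1)) (Fin (j.1 + 1)) ℂ)) * treeBasis b (centralSpins a) := by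
  funext x y
  rw [treeBasis_conj_blockDiagonal]
  change coherentIntertwiner γ a b n n' (x, y) = _
  rw [coherentIntertwiner_apply, ← Finset.sum_coe_sort]
  refine Finset.sum_congr rfl fun j _ => ?_
  rw [← Finset.sum_coe_sort]
  refine Finset.sum_congr rfl fun s _ => ?_
  rw [← Finset.sum_coe_sort]
  rfl

/-- Tracing out `B` uses only the orthonormality of the out-going rows. Their completeness is not
available, since central spins of `b` may lie outside `centralSpins a`. -/
theorem vertexMat_mul_conjTranspose : vertexMat (coherentIntertwiner γ a b n n') *
    (vertexMat (coherentIntertwiner γ a b n n'))ᴴ =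
    (treeBasis a (centralSpins a))ᴴ * Matrix.blockDiagonal' (fun j : centralSpins a =>
      (((j.1 : ℂ) + 1)⁻¹ • ((j.1 : ℂ) + 1)⁻¹ •
        (coeffMatrix γ a b n n' j.1 * (coeffMatrix γ a b n n' j.1)ᴴ)) ⊗ₖ
        (1 : Matrix (Fin (j.1 + 1)) (Fin (j.1 + 1)) ℂ)) * treeBasis a (centralSpins a) := by
  rw [vertexMat_coherentIntertwiner, Matrix.conjTranspose_mul, Matrix.conjTranspose_mul,
    Matrix.conjTranspose_conjTranspose]
  have h : ∀ (U : Matrix (TreeIndex a (centralSpins a)) (Mag a) ℂ)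
      (B : Matrix (TreeIndex a (centralSpins a)) (TreeIndex b (centralSpins a)) ℂ)
      (T : Matrix (TreeIndex b (centralSpins a)) (Mag b) ℂ), T * Tᴴ = 1 →
      Uᴴ * B * T * (Tᴴ * (Bᴴ * U)) = Uᴴ * (B * Bᴴ) * U := by
    intro U B T hT
    have : Uᴴ * B * T * (Tᴴ * (Bᴴ * U)) = Uᴴ * B * (T * Tᴴ) * (Bᴴ * U) := by
      simp only [Matrix.mul_assoc]
    rw [this, hT, Matrix.mul_one]
    simp only [Matrix.mul_assoc]
  rw [h _ _ _ (treeBasis_mul_conjTranspose b _), Matrix.blockDiagonal'_conjTranspose,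
    ← Matrix.blockDiagonal'_mul]
  congr 3
  funext j
  have hstar : star (((j.1 : ℂ) + 1)⁻¹) = ((j.1 : ℂ) + 1)⁻¹ := by simp
  rw [Matrix.conjTranspose_kronecker, ← Matrix.mul_kronecker_mul, Matrix.conjTranspose_one,
    Matrix.mul_one, Matrix.conjTranspose_smul, hstar, Matrix.smul_mul, Matrix.mul_smul]

theorem norm_sq_eq_trace {M N : ℕ} {a : Fin M → ℕ} {b : Fin N → ℕ} (v : VertexSpace a b) :
    ((‖v‖ ^ 2 : ℝ) : ℂ) = (vertexMat v * (vertexMat v)ᴴ).trace := by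
  have h := inner_vertexOf (vertexMat v) (vertexMat v)
  rw [vertexOf_vertexMat, inner_self_eq_norm_sq_to_K, Matrix.trace_mul_comm] at h
  rw [← h]
  simp

theorem trace_coeffMatrix (j : ℕ) :
    (coeffMatrix γ a b n n' j * (coeffMatrix γ a b n n' j)ᴴ).trace =
      ((∑ s ∈ paths a j, ∑ s' ∈ paths b j, ‖coeff γ a b n n' j s s'‖ ^ 2 : ℝ) : ℂ) := by
  simp only [Matrix.trace, Matrix.diag, Matrix.mul_apply, Matrix.conjTranspose_apply, coeffMatrix]
  rw [← Finset.sum_coe_sort (paths a j), Complex.ofReal_sum]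
  refine Finset.sum_congr rfl fun s _ => ?_
  rw [← Finset.sum_coe_sort (paths b j), Complex.ofReal_sum]
  refine Finset.sum_congr rfl fun s' _ => ?_
  rw [Complex.star_def, Complex.mul_conj, Complex.normSq_eq_norm_sq]

theorem norm_sq_coherentIntertwiner : ‖coherentIntertwiner γ a b n n'‖ ^ 2 =
    ∑ j ∈ centralSpins a, ∑ s ∈ paths a j, ∑ s' ∈ paths b j,
      ((j : ℝ) + 1)⁻¹ * ‖coeff γ a b n n' j s s'‖ ^ 2 := by
  have h := norm_sq_eq_trace (coherentIntertwiner γ a b n n')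
  rw [vertexMat_mul_conjTranspose, Matrix.trace_mul_comm, ← Matrix.mul_assoc,
    treeBasis_mul_conjTranspose, Matrix.one_mul, Matrix.trace_blockDiagonal'] at h
  simp only [Matrix.trace_kronecker, Matrix.trace_smul, trace_coeffMatrix, Matrix.trace_one,
    Fintype.card_fin] at h
  rw [Finset.sum_coe_sort (centralSpins a) (fun j => (((j : ℂ) + 1)⁻¹ • ((j : ℂ) + 1)⁻¹ •
    ((∑ s ∈ paths a j, ∑ s' ∈ paths b j, ‖coeff γ a b n n' j s s'‖ ^ 2 : ℝ) : ℂ)) *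
      ((j + 1 : ℕ) : ℂ))] at h
  apply Complex.ofReal_injective
  rw [h, Complex.ofReal_sum]
  refine Finset.sum_congr rfl fun j _ => ?_
  have hd : (j : ℂ) + 1 ≠ 0 := by exact_mod_cast Nat.succ_ne_zero j
  simp only [← Finset.mul_sum]
  push_cast
  simp only [smul_eq_mul]
  field_simp

theorem pMatrix_eq (j : ℕ) : pMatrix γ a b n n' j =
    ((((j : ℝ) + 1)⁻¹ / ‖coherentIntertwiner γ a b n n'‖ ^ 2 : ℝ) : ℂ) •
      (coeffMatrix γ a b n n' j * (coeffMatrix γ a b n n' j)ᴴ) := by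
  funext s t
  rw [Matrix.smul_apply, Matrix.mul_apply, pMatrix, ← Finset.sum_coe_sort]
  simp only [Matrix.conjTranspose_apply, coeffMatrix]
  push_cast
  rw [smul_eq_mul]
  ring

theorem posSemidef_pMatrix (j : ℕ) : (pMatrix γ a b n n' j).PosSemidef := by
  rw [pMatrix_eq]
  refine (Matrix.posSemidef_self_mul_conjTranspose _).smul ?_
  rw [Complex.zero_le_real]
  positivity

theorem centralProb_eq (j : ℕ) : centralProb γ a b n n' j =
    ((j : ℝ) + 1)⁻¹ / ‖coherentIntertwiner γ a b n n'‖ ^ 2 *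
      ∑ s ∈ paths a j, ∑ s' ∈ paths b j, ‖coeff γ a b n n' j s s'‖ ^ 2 := by
  rw [centralProb, pMatrix_eq, Matrix.trace_smul, trace_coeffMatrix, smul_eq_mul,
    ← Complex.ofReal_mul, Complex.ofReal_re]

theorem centralProb_nonneg (j : ℕ) : 0 ≤ centralProb γ a b n n' j := by
  rw [centralProb_eq]
  positivity

theorem sum_centralProb (h : coherentIntertwiner γ a b n n' ≠ 0) :
    ∑ j ∈ centralSpins a, centralProb γ a b n n' j = 1 := by
  have hn : ‖coherentIntertwiner γ a b n n'‖ ^ 2 ≠ 0 := by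
    simpa using h
  simp only [centralProb_eq]
  have h' : ∀ j : ℕ, ((j : ℝ) + 1)⁻¹ / ‖coherentIntertwiner γ a b n n'‖ ^ 2 *
      ∑ s ∈ paths a j, ∑ s' ∈ paths b j, ‖coeff γ a b n n' j s s'‖ ^ 2 =
      (∑ s ∈ paths a j, ∑ s' ∈ paths b j, ((j : ℝ) + 1)⁻¹ * ‖coeff γ a b n n' j s s'‖ ^ 2) /
      ‖coherentIntertwiner γ a b n n'‖ ^ 2 := by
    intro j
    simp only [← Finset.mul_sum]
    ring
  simp only [h']
  rw [← Finset.sum_div, ← norm_sq_coherentIntertwiner, div_self hn]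

theorem reducedDensity_eq : reducedDensity (coherentIntertwiner γ a b n n') =
    (treeBasis a (centralSpins a))ᴴ * Matrix.blockDiagonal' (fun j : centralSpins a =>
      (((j.1 : ℂ) + 1)⁻¹ • pMatrix γ a b n n' j.1) ⊗ₖ
        (1 : Matrix (Fin (j.1 + 1)) (Fin (j.1 + 1)) ℂ)) * treeBasis a (centralSpins a) := by
  have h : reducedDensity (coherentIntertwiner γ a b n n') =
      ((‖coherentIntertwiner γ a b n n'‖ ^ 2 : ℝ) : ℂ)⁻¹ •
        (vertexMat (coherentIntertwiner γ a b n n') *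
          (vertexMat (coherentIntertwiner γ a b n n'))ᴴ) := by
    funext x x'
    rw [Matrix.smul_apply, Matrix.mul_apply, smul_eq_mul, Finset.mul_sum]
    refine Finset.sum_congr rfl fun y _ => ?_
    rw [density, div_eq_inv_mul]
    rfl
  rw [h, vertexMat_mul_conjTranspose, ← Matrix.smul_mul, ← Matrix.mul_smul,
    ← Matrix.blockDiagonal'_smul]
  congr 3
  funext j
  rw [Pi.smul_apply, ← Matrix.smul_kronecker, pMatrix_eq]
  congr 1
  simp only [smul_smul]
  congr 1
  push_cast
  ring

theorem reducedDensity_apply (x x' : Mag a) :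
    reducedDensity (coherentIntertwiner γ a b n n') x x' =
      ∑ j ∈ centralSpins a, ∑ s : paths a j, ∑ t : paths a j, pMatrix γ a b n n' j s t *
        (((j : ℂ) + 1)⁻¹ * ∑ k ∈ Finset.range (j + 1), recoupled a s.1 k x *
          star (recoupled a t.1 k x')) := by
  rw [reducedDensity_eq, treeBasis_conj_blockDiagonal, ← Finset.sum_coe_sort (centralSpins a)]
  refine Finset.sum_congr rfl fun j _ => Finset.sum_congr rfl fun s _ =>
    Finset.sum_congr rfl fun t _ => ?_
  simp only [recoupled_eq_treeVec, star_treeVec]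
  rw [Finset.sum_range, Matrix.smul_apply, smul_eq_mul]
  ring

theorem trace_pMatrix (j : ℕ) :
    (pMatrix γ a b n n' j).trace = (centralProb γ a b n n' j : ℂ) := by
  rw [centralProb_eq, pMatrix_eq, Matrix.trace_smul, trace_coeffMatrix, smul_eq_mul,
    ← Complex.ofReal_mul]

/-- The unitaries diagonalizing the `p_j`, tensored with the identity and carried to the recoupling
basis, diagonalize `ρ_A`. Its eigenvalues are `d / (2j+1)`, repeated for each central magnetic
number, and the logarithm of the quotient splits. -/
theorem entanglement_eq : entanglement (coherentIntertwiner γ a b n n') =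
    intertwinerEntropy γ a b n n' + ∑ j ∈ centralSpins a,
      centralProb γ a b n n' j * Real.log ((j : ℝ) + 1) := by
  choose V hV hV' d hd using fun j => exists_eq_conjDiagonal (posSemidef_pMatrix γ a b n n' j).1
  let B := Matrix.blockDiagonal' (fun j : centralSpins a => V j.1 ⊗ₖ
    (1 : Matrix (Fin (j.1 + 1)) (Fin (j.1 + 1)) ℂ))
  let W := (treeBasis a (centralSpins a))ᴴ * B
  have hB : Bᴴ * B = 1 := by
    simp only [B]
    rw [Matrix.blockDiagonal'_conjTranspose, ← Matrix.blockDiagonal'_mul,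
      ← Matrix.blockDiagonal'_one]
    congr 1
    funext j
    rw [Matrix.conjTranspose_kronecker, ← Matrix.mul_kronecker_mul, hV]
    simp
  have hB' : B * Bᴴ = 1 := by
    simp only [B]
    rw [Matrix.blockDiagonal'_conjTranspose, ← Matrix.blockDiagonal'_mul,
      ← Matrix.blockDiagonal'_one]
    congr 1
    funext j
    rw [Matrix.conjTranspose_kronecker, ← Matrix.mul_kronecker_mul, hV']
    simp
  have hW : Wᴴ * W = 1 := by
    simp only [W]
    rw [Matrix.conjTranspose_mul, Matrix.conjTranspose_conjTranspose, Matrix.mul_assoc,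
      ← Matrix.mul_assoc (treeBasis a _), treeBasis_mul_conjTranspose, Matrix.one_mul, hB]
  have hW' : W * Wᴴ = 1 := by
    simp only [W]
    rw [Matrix.conjTranspose_mul, Matrix.conjTranspose_conjTranspose, Matrix.mul_assoc,
      ← Matrix.mul_assoc B, hB', Matrix.one_mul, conjTranspose_treeBasis_mul]
  have hρ : reducedDensity (coherentIntertwiner γ a b n n') =
      conjDiagonal W hW hW' (fun i => d i.1.1 i.2.1 / ((i.1.1 : ℝ) + 1)) := by
    have hdiag : Matrix.blockDiagonal' (fun j : centralSpins a =>
        (((j.1 : ℂ) + 1)⁻¹ • pMatrix γ a b n n' j.1) ⊗ₖ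
          (1 : Matrix (Fin (j.1 + 1)) (Fin (j.1 + 1)) ℂ)) =
        B * Matrix.diagonal (fun i : TreeIndex a (centralSpins a) =>
          ((d i.1.1 i.2.1 / ((i.1.1 : ℝ) + 1) : ℝ) : ℂ)) * Bᴴ := by
      have h1 := Matrix.blockDiagonal'_diagonal (fun (j : centralSpins a)
        (i : paths a j × Fin (j.1 + 1)) => ((d j.1 i.1 / ((j.1 : ℝ) + 1) : ℝ) : ℂ))
      simp only [B]
      rw [← h1, Matrix.blockDiagonal'_conjTranspose, ← Matrix.blockDiagonal'_mul,
        ← Matrix.blockDiagonal'_mul]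
      congr 1
      funext j
      have h2 : Matrix.diagonal (fun i : paths a j × Fin (j.1 + 1) =>
          ((d j.1 i.1 / ((j.1 : ℝ) + 1) : ℝ) : ℂ)) =
          (((j.1 : ℂ) + 1)⁻¹ • Matrix.diagonal (fun i => (d j.1 i : ℂ))) ⊗ₖ
            (1 : Matrix (Fin (j.1 + 1)) (Fin (j.1 + 1)) ℂ) := by
        rw [← Matrix.diagonal_smul, ← Matrix.diagonal_one, Matrix.diagonal_kronecker_diagonal]
        congr 1
        funext i
        simp [div_eq_inv_mul]
      rw [h2, Matrix.conjTranspose_kronecker, ← Matrix.mul_kronecker_mul,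
        ← Matrix.mul_kronecker_mul, Matrix.conjTranspose_one, Matrix.mul_one, Matrix.mul_one,
        Matrix.mul_smul, Matrix.smul_mul]
      conv_lhs => rw [hd j.1, conjDiagonal_apply]
    rw [reducedDensity_eq, hdiag, conjDiagonal_apply]
    simp only [W]
    rw [Matrix.conjTranspose_mul, Matrix.conjTranspose_conjTranspose]
    simp only [Matrix.mul_assoc]
  have hent : ∀ j, entropy (pMatrix γ a b n n' j) = ∑ i, Real.negMulLog (d j i) := by
    intro j
    conv_lhs => rw [hd j]
    rw [entropy_conjDiagonal]
  have htr : ∀ j, centralProb γ a b n n' j = ∑ i, d j i := by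
    intro j
    apply Complex.ofReal_injective
    rw [← trace_pMatrix]
    conv_lhs => rw [hd j]
    rw [trace_conjDiagonal]
  rw [entanglement, hρ, entropy_conjDiagonal, intertwinerEntropy, ← Finset.sum_add_distrib,
    ← Finset.sum_coe_sort (centralSpins a), Fintype.sum_sigma]
  refine Finset.sum_congr rfl fun j _ => ?_
  rw [hent, htr, Fintype.sum_prod_type, Finset.sum_mul, ← Finset.sum_add_distrib]
  refine Finset.sum_congr rfl fun i _ => ?_
  have hpos : (0 : ℝ) < (j.1 : ℝ) + 1 := by positivity
  simp only [Finset.sum_const, Finset.card_univ, Fintype.card_fin, nsmul_eq_mul]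
  -- The logarithm of the quotient splits only for a nonzero eigenvalue; zero eigenvalues contribute
  -- nothing.
  rcases eq_or_ne (d j.1 i) 0 with h0 | h0
  · simp [h0]
  · rw [Real.negMulLog, Real.negMulLog, Real.log_div h0 hpos.ne']
    push_cast
    field_simp
    ring

/-- This is the grouping property of entropy: `p_j` and `p̄_j` are diagonalized by the same unitary,
with eigenvalues `d` and `d / p̃_j`. -/
theorem intertwinerEntropy_eq : intertwinerEntropy γ a b n n' =
    -∑ j ∈ centralSpins a, centralProb γ a b n n' j * Real.log (centralProb γ a b n n' j) +
      ∑ j ∈ centralSpins a, centralProb γ a b n n' j * entropy (pBar γ a b n n' j) := by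
  rw [intertwinerEntropy, ← Finset.sum_neg_distrib, ← Finset.sum_add_distrib]
  refine Finset.sum_congr rfl fun j _ => ?_
  obtain ⟨V, hV, hV', d, hd⟩ := exists_eq_conjDiagonal (posSemidef_pMatrix γ a b n n' j).1
  have htr : centralProb γ a b n n' j = ∑ i, d i := by
    apply Complex.ofReal_injective
    rw [← trace_pMatrix, hd, trace_conjDiagonal]
  set c := centralProb γ a b n n' j with hc
  have hbar : pBar γ a b n n' j = conjDiagonal V hV hV' (c⁻¹ • d) := by
    rw [map_smul, ← hd, pBar, ← hc, ← Complex.ofReal_inv]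
    rfl
  rw [hbar, entropy_conjDiagonal, hd, entropy_conjDiagonal]
  rcases eq_or_ne c 0 with h0 | h0
  -- A positive semidefinite block of trace zero vanishes, so all terms are zero.
  · have hz : pMatrix γ a b n n' j = 0 := by
      refine (Matrix.PosSemidef.trace_eq_zero_iff (posSemidef_pMatrix γ a b n n' j)).mp ?_
      rw [trace_pMatrix, ← hc, h0]; simp
    have he := entropy_conjDiagonal V hV hV' d
    rw [← hd, hz] at he
    rw [h0, ← he]
    simp [entropy]
  · have hcd : c * Real.log c = ∑ i, d i * Real.log c := by
      rw [← Finset.sum_mul, ← htr]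
    rw [hcd, ← Finset.sum_neg_distrib, Finset.mul_sum, ← Finset.sum_add_distrib]
    refine Finset.sum_congr rfl fun i _ => ?_
    rcases eq_or_ne (d i) 0 with hi | hi
    · simp [hi]
    · rw [Pi.smul_apply, smul_eq_mul, Real.negMulLog, Real.negMulLog,
        Real.log_mul (inv_ne_zero h0) hi, Real.log_inv]
      field_simp
      ring

end Density

section Diagonal

variable {p q : ℕ} (γ : Sphere → SU2) (a : Fin (p + 2) → ℕ) (b : Fin (q + 2) → ℕ)
  (n : Fin (p + 2) → Sphere) (n' : Fin (q + 2) → Sphere)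

theorem centralProb_of_diagonal (j : ℕ)
    (hd : ∀ s t : paths a j, s ≠ t → pMatrix γ a b n n' j s t = 0) :
    centralProb γ a b n n' j = ∑ s, ∑ t, (pMatrix γ a b n n' j s t).re := by
  rw [centralProb, Matrix.trace, Complex.re_sum]
  refine Finset.sum_congr rfl fun s _ => ?_
  rw [Finset.sum_eq_single s]
  · rfl
  · intro t _ ht
    rw [hd s t ht.symm, Complex.zero_re]
  · simp

theorem isHermitian_pBar (j : ℕ) : (pBar γ a b n n' j).IsHermitian := by
  unfold Matrix.IsHermitian
  rw [pBar, Matrix.conjTranspose_smul, (posSemidef_pMatrix γ a b n n' j).1.eq]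
  congr 1
  rw [← Complex.ofReal_inv]
  exact Complex.conj_ofReal _

theorem entropy_pBar_of_diagonal (j : ℕ)
    (hd : ∀ s t : paths a j, s ≠ t → pMatrix γ a b n n' j s t = 0) :
    entropy (pBar γ a b n n' j) =
      -∑ s, ∑ t, (pBar γ a b n n' j s t).re * Real.log (pBar γ a b n n' j s t).re :=
  entropy_of_diagonal (isHermitian_pBar γ a b n n' j) fun s t hst => by
    rw [pBar, Matrix.smul_apply, hd s t hst, smul_zero]

theorem intertwinerEntropy_of_diagonal
    (hd : ∀ j, ∀ s t : paths a j, s ≠ t → pMatrix γ a b n n' j s t = 0) :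
    intertwinerEntropy γ a b n n' = -∑ j ∈ centralSpins a, ∑ s, ∑ t,
      (pMatrix γ a b n n' j s t).re * Real.log (pMatrix γ a b n n' j s t).re := by
  rw [intertwinerEntropy, ← Finset.sum_neg_distrib]
  exact Finset.sum_congr rfl fun j _ =>
    entropy_of_diagonal (posSemidef_pMatrix γ a b n n' j).1 (hd j)

end Diagonal

/-! ## Four legs -/

theorem couple_swap (d e c : ℕ) : ∃ ε : ℝ, ε * ε = 1 ∧ ∀ (ψ : Fin (d + 1) → ℂ)
    (φ : Fin (e + 1) → ℂ) (k : ℕ), couple ψ φ c k = ε * couple φ ψ c k := by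
  obtain ⟨ε, hε, h⟩ := clebschGordan_swap d e c
  refine ⟨ε, hε, fun ψ φ k => ?_⟩
  simp only [couple]
  rw [Finset.sum_comm, Finset.mul_sum]
  refine Finset.sum_congr rfl fun y _ => ?_
  rw [Finset.mul_sum]
  refine Finset.sum_congr rfl fun x _ => ?_
  rw [h]
  push_cast
  ring

theorem coherentCG_eq (γ : Sphere → SU2) (a : Fin 2 → ℕ) (n : Fin 2 → Sphere) (j m : ℕ) :
    coherentCG γ a n j m = couple (coherent γ (a 0) (n 0)) (coherent γ (a 1) (n 1)) j m := by
  unfold coherentCG couple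
  exact Finset.sum_congr rfl fun x _ => Finset.sum_congr rfl fun y _ => by ring

theorem paths_two (a : Fin 2 → ℕ) (j : ℕ) :
    paths (p := 0) a j = if Triangle (a 1) (a 0) j then {![j, a 1]} else ∅ := by
  ext s
  rw [mem_paths]
  have h : s 0 = j ∧ IsPath a s ↔ Triangle (a 1) (a 0) j ∧ s = ![j, a 1] := by
    constructor
    · rintro ⟨rfl, h1, h2⟩
      have h1 : s 1 = a 1 := h1
      have h2 : Triangle (s 1) (a 0) (s 0) := h2 0
      refine ⟨h1 ▸ h2, funext fun i => ?_⟩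
      fin_cases i
      · rfl
      · exact h1
    · rintro ⟨hT, rfl⟩
      refine ⟨rfl, rfl, fun i => ?_⟩
      rw [fin_one_eq i 0]
      exact hT
  rw [h]
  split_ifs with hT
  · simp [hT]
  · simp [hT]

theorem sum_paths_two (a : Fin 2 → ℕ) (j : ℕ) (r : ℝ) :
    ∑ _s ∈ paths (p := 0) a j, r = if Triangle (a 1) (a 0) j then r else 0 := by
  rw [paths_two]
  split_ifs <;> simp

theorem coherentCG_of_not_triangle (γ : Sphere → SU2) {a : Fin 2 → ℕ} (n : Fin 2 → Sphere) {j : ℕ}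
    (h : ¬ Triangle (a 1) (a 0) j) (m : ℕ) : coherentCG γ a n j m = 0 := by
  have h' : ¬ Triangle (a 0) (a 1) j := by
    unfold Triangle at h ⊢
    rwa [add_comm (a 0) (a 1), and_congr_right_iff.mpr fun _ => and_left_comm]
  simp [coherentCG, clebschGordan_of_not_triangle h']

/-- The trees couple the second leg to the first, `coherentCG` the first to the second. The two
orders differ by signs independent of the magnetic indices, which the modulus removes. -/
theorem norm_coeff_two (γ : Sphere → SU2) (a b : Fin 2 → ℕ) (n n' : Fin 2 → Sphere) {j : ℕ}
    {s s' : Fin 2 → ℕ} (hs : s ∈ paths (p := 0) a j) (hs' : s' ∈ paths (p := 0) b j) :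
    ‖coeff (p := 0) (q := 0) γ a b n n' j s s'‖ =
      ‖∑ m ∈ Finset.range (j + 1), coherentCG γ a n j m * star (coherentCG γ b n' j m)‖ := by
  obtain ⟨h0, hP⟩ := mem_paths.mp hs
  obtain ⟨h0', hP'⟩ := mem_paths.mp hs'
  obtain ⟨ε, hε, h⟩ := couple_swap (a 1) (a 0) j
  obtain ⟨ε', hε', h'⟩ := couple_swap (b 1) (b 0) j
  have hn : ‖(ε : ℂ) * ε'‖ = 1 := by
    rw [← Complex.ofReal_mul, Complex.norm_real, Real.norm_eq_abs]
    have h1 : |ε * ε'| * |ε * ε'| = 1 := by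
      rw [abs_mul_abs_self]
      linear_combination ε' * ε' * hε + hε'
    exact (mul_self_eq_one_iff.mp h1).resolve_right (by linarith [abs_nonneg (ε * ε')])
  rw [coeff_eq γ n n' hP hP', Finset.sum_range, ← one_mul ‖∑ m : Fin (j + 1), coherentCG _ _ _ _ _ * _‖,
    ← hn, ← norm_mul, Finset.mul_sum]
  refine congrArg _ (Finset.sum_congr rfl fun m _ => ?_)
  rw [treeAmp_two hP.1, treeAmp_two hP'.1, h0, h0', h, h', coherentCG_eq, coherentCG_eq, star_mul']
  have : star (ε' : ℂ) = ε' := Complex.conj_ofReal _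
  rw [this]
  ring

theorem centralProb_eq_fourLegProb (γ : Sphere → SU2) (a b : Fin 2 → ℕ) (n n' : Fin 2 → Sphere)
    (j : ℕ) : centralProb (p := 0) (q := 0) γ a b n n' j = fourLegProb γ a b n n' j := by
  rw [centralProb_eq, Finset.sum_congr rfl fun s hs => Finset.sum_congr rfl fun s' hs' => by
    rw [norm_coeff_two γ a b n n' hs hs']]
  rw [Finset.sum_congr rfl fun s _ => sum_paths_two b j _, sum_paths_two]
  unfold fourLegProb
  by_cases ha : Triangle (a 1) (a 0) j
  · by_cases hb : Triangle (b 1) (b 0) j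
    · rw [if_pos ha, if_pos hb]
      field_simp
    · rw [if_pos ha, if_neg hb]
      simp [coherentCG_of_not_triangle γ n' hb]
  · rw [if_neg ha]
    simp [coherentCG_of_not_triangle γ n ha]

theorem eq_of_mem_paths_two {a s : Fin 2 → ℕ} {j : ℕ} (hs : s ∈ paths (p := 0) a j) :
    s = ![j, a 1] := by
  rw [paths_two] at hs
  split_ifs at hs
  · exact Finset.mem_singleton.mp hs
  · simp at hs

theorem subsingleton_paths_two {a : Fin 2 → ℕ} {j : ℕ} : Subsingleton (paths (p := 0) a j) :=
  ⟨fun s t => Subtype.ext ((eq_of_mem_paths_two s.2).trans (eq_of_mem_paths_two t.2).symm)⟩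

theorem pMatrix_two_diagonal (γ : Sphere → SU2) (a b : Fin 2 → ℕ) (n n' : Fin 2 → Sphere) (j : ℕ)
    (s t : paths (p := 0) a j) (h : s ≠ t) : pMatrix (p := 0) (q := 0) γ a b n n' j s t = 0 := by
  exact absurd (subsingleton_paths_two.elim s t) h

theorem intertwinerEntropy_two (γ : Sphere → SU2) (a b : Fin 2 → ℕ) (n n' : Fin 2 → Sphere) :
    intertwinerEntropy (p := 0) (q := 0) γ a b n n' = -∑ j ∈ centralSpins (p := 0) a,
      fourLegProb γ a b n n' j * Real.log (fourLegProb γ a b n n' j) := by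
  rw [intertwinerEntropy_of_diagonal _ _ _ _ _ (pMatrix_two_diagonal γ a b n n')]
  congr 1
  refine Finset.sum_congr rfl fun j _ => ?_
  rw [← centralProb_eq_fourLegProb, centralProb_of_diagonal _ _ _ _ _ _
    (pMatrix_two_diagonal γ a b n n' j)]
  have := subsingleton_paths_two (a := a) (j := j)
  rcases isEmpty_or_nonempty (paths (p := 0) a j) with he | ⟨⟨s⟩⟩
  · simp
  · simp only [Fintype.sum_subsingleton _ s]

end Intertwiner

end

/-! ### Assembly of the statements -/

theorem mainTheorem2 (γ : Intertwiner.Sphere → Intertwiner.SU2) (hγ : Intertwiner.IsSection γ) :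
    (∀ (p q : ℕ) (a : Fin (p + 2) → ℕ) (b : Fin (q + 2) → ℕ)
        (n : Fin (p + 2) → Intertwiner.Sphere) (n' : Fin (q + 2) → Intertwiner.Sphere),
      -- the recoupling basis is an orthonormal basis of the intertwiner space
      (Orthonormal ℂ (Intertwiner.recouplingBasis a b) ∧
        ∀ v : Intertwiner.VertexSpace a b,
          v ∈ Submodule.span ℂ (Set.range (Intertwiner.recouplingBasis a b)) ↔
            Intertwiner.IsIntertwiner v) ∧
      -- the coherent intertwiner is gauge invariant and is split by a central spin
      Intertwiner.IsIntertwiner (Intertwiner.coherentIntertwiner γ a b n n') ∧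
      (∀ (x : Intertwiner.Mag a) (y : Intertwiner.Mag b),
        Intertwiner.coherentIntertwiner γ a b n n' (x, y) =
          ∑ j ∈ Intertwiner.centralSpins a, ((j : ℂ) + 1) *
            ∑ k : Fin (j + 1), ∑ m : Fin (j + 1),
              Intertwiner.ketPart γ a n j m k x * Intertwiner.braPart γ b n' j m k y) ∧
      -- its expansion in the recoupling basis
      Intertwiner.coherentIntertwiner γ a b n n' =
        ∑ j ∈ Intertwiner.centralSpins a, ∑ s ∈ Intertwiner.paths a j, ∑ s' ∈ Intertwiner.paths b j,
          (((j : ℂ) + 1)⁻¹ * Intertwiner.coeff γ a b n n' j s s') •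
            Intertwiner.recoupledIntertwiner a b j s s' ∧
      ‖Intertwiner.coherentIntertwiner γ a b n n'‖ ^ 2 =
        ∑ j ∈ Intertwiner.centralSpins a, ∑ s ∈ Intertwiner.paths a j, ∑ s' ∈ Intertwiner.paths b j,
          ((j : ℝ) + 1)⁻¹ * ‖Intertwiner.coeff γ a b n n' j s s'‖ ^ 2 ∧
      (Intertwiner.coherentIntertwiner γ a b n n' ≠ 0 →
        -- the reduced density matrix
        (∀ x x' : Intertwiner.Mag a,
          Intertwiner.reducedDensity (Intertwiner.coherentIntertwiner γ a b n n') x x' =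
            ∑ j ∈ Intertwiner.centralSpins a,
              ∑ s : Intertwiner.paths a j, ∑ t : Intertwiner.paths a j,
                Intertwiner.pMatrix γ a b n n' j s t * (((j : ℂ) + 1)⁻¹ *
                  ∑ k ∈ Finset.range (j + 1), Intertwiner.recoupled a s.1 k x *
                    star (Intertwiner.recoupled a t.1 k x'))) ∧
        -- the blocks are positive, and the central spin has a probability distribution
        (∀ j, (Intertwiner.pMatrix γ a b n n' j).PosSemidef) ∧
        (∀ j, 0 ≤ Intertwiner.centralProb γ a b n n' j) ∧
        ∑ j ∈ Intertwiner.centralSpins a, Intertwiner.centralProb γ a b n n' j = 1 ∧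
        -- the entanglement entropy
        Intertwiner.entanglement (Intertwiner.coherentIntertwiner γ a b n n') =
          Intertwiner.intertwinerEntropy γ a b n n' +
            ∑ j ∈ Intertwiner.centralSpins a,
              Intertwiner.centralProb γ a b n n' j * Real.log ((j : ℝ) + 1) ∧
        Intertwiner.intertwinerEntropy γ a b n n' =
          -∑ j ∈ Intertwiner.centralSpins a, Intertwiner.centralProb γ a b n n' j *
              Real.log (Intertwiner.centralProb γ a b n n' j) +
            ∑ j ∈ Intertwiner.centralSpins a, Intertwiner.centralProb γ a b n n' j *
              Intertwiner.entropy (Intertwiner.pBar γ a b n n' j) ∧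
        -- entrywise form when the blocks are diagonal
        ((∀ j, ∀ s t : Intertwiner.paths a j, s ≠ t → Intertwiner.pMatrix γ a b n n' j s t = 0) →
          (∀ j, Intertwiner.centralProb γ a b n n' j =
            ∑ s, ∑ t, (Intertwiner.pMatrix γ a b n n' j s t).re) ∧
          (∀ j, Intertwiner.entropy (Intertwiner.pBar γ a b n n' j) =
            -∑ s, ∑ t, (Intertwiner.pBar γ a b n n' j s t).re *
              Real.log (Intertwiner.pBar γ a b n n' j s t).re) ∧
          Intertwiner.intertwinerEntropy γ a b n n' =
            -∑ j ∈ Intertwiner.centralSpins a, ∑ s, ∑ t,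
              (Intertwiner.pMatrix γ a b n n' j s t).re *
                Real.log (Intertwiner.pMatrix γ a b n n' j s t).re))) ∧
    -- the case of four legs
    (∀ (a b : Fin 2 → ℕ) (n n' : Fin 2 → Intertwiner.Sphere),
      Intertwiner.coherentIntertwiner γ a b n n' ≠ 0 →
        (∀ j, Intertwiner.centralProb (p := 0) (q := 0) γ a b n n' j =
          Intertwiner.fourLegProb γ a b n n' j) ∧
        Intertwiner.entanglement (Intertwiner.coherentIntertwiner γ a b n n') =
          -∑ j ∈ Intertwiner.centralSpins (p := 0) a, Intertwiner.fourLegProb γ a b n n' j *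
              Real.log (Intertwiner.fourLegProb γ a b n n' j) +
            ∑ j ∈ Intertwiner.centralSpins (p := 0) a, Intertwiner.fourLegProb γ a b n n' j *
              Real.log ((j : ℝ) + 1)) := by
  refine ⟨fun p q a b n n' => ⟨⟨Intertwiner.orthonormal_recouplingBasis a b,
    Intertwiner.mem_span_recouplingBasis a b⟩,
    Intertwiner.isIntertwiner_coherentIntertwiner γ a b n n',
    Intertwiner.coherentIntertwiner_split γ a b n n',
    Intertwiner.coherentIntertwiner_eq_sum γ a b n n',
    Intertwiner.norm_sq_coherentIntertwiner γ a b n n', fun h =>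
    ⟨Intertwiner.reducedDensity_apply γ a b n n', Intertwiner.posSemidef_pMatrix γ a b n n',
      Intertwiner.centralProb_nonneg γ a b n n', Intertwiner.sum_centralProb γ a b n n' h,
      Intertwiner.entanglement_eq γ a b n n', Intertwiner.intertwinerEntropy_eq γ a b n n',
      fun hd => ⟨fun j => Intertwiner.centralProb_of_diagonal γ a b n n' j (hd j),
        fun j => Intertwiner.entropy_pBar_of_diagonal γ a b n n' j (hd j),
        Intertwiner.intertwinerEntropy_of_diagonal γ a b n n' hd⟩⟩⟩, fun a b n n' _ => ⟨
    Intertwiner.centralProb_eq_fourLegProb γ a b n n', ?_⟩⟩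
  have h := Intertwiner.entanglement_eq (p := 0) (q := 0) γ a b n n'
  rw [Intertwiner.intertwinerEntropy_two] at h
  simpa only [Intertwiner.centralProb_eq_fourLegProb] using h
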